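/- **Setting.** Let $d\ge 1$, let $\Theta^\star\in\mathbb{R}^{d\times d}$ satisfy $\operatorname{rank}(\Theta^\star)\le r$ and $\|\Theta^\star\|_\infty\le\alpha$, where $\|\cdot\|_\infty$ is the largest absolute value of an entry. Write $\|\cdot\|_F$ for the Frobenius norm, $\|\cdot\|_{nu}$ for the nuclear norm (the sum of the singular values) and $\langle A,B\rangle=\operatorname{tr}(A^\top B)$. Let $\sigma\ge0$ and $\Delta\ge 0$ with $\sigma+\Delta>0$. For $k=1,\dots,n$ one has $$y_k=\langle X_k,\Theta^\star\rangle+\epsilon_k,\qquad \dot y_k=\mathcal{Q}_\Delta(y_k+\tau_k),$$ where $\mathcal{Q}_\Delta(a)=\Delta\big(\lfloor a/\Delta\rfloor+\tfrac12\big)$ for $\Delta>0$ and $\mathcal{Q}_0(a)=a$. Here $X_k=e_{i(k)}e_{j(k)}^\top$ with $(i(k),j(k))$ uniform on $\{1,\dots,d\}^2$; the noise variables $\epsilon_k$ are identically distributed with $\mathbb{E}\,\epsilon_k=0$ and $\|\epsilon_k\|_{\psi_1}:=\inf\{t>0:\mathbb{E}\exp(|\epsilon_k|/t)\le2\}\le\sigma$;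 the dithers $\tau_k$ are uniform on $[-\frac\Delta2,\frac\Delta2]$ (equal to $0$ if $\Delta=0$); for each $k$ the variables $X_k,\epsilon_k,\tau_k$ are independent, and the triples $(X_k,\epsilon_k,\tau_k)$, $k=1,\dots,n$, are independent. Given $\lambda$, let $\widehat\Theta$ be any solution of $$\widehat\Theta\in\arg\min_{\|\Theta\|_\infty\le\alpha}\ \frac1{2n}\sum_{k=1}^n\big(\dot y_k-\langle X_k,\Theta\rangle\big)^2+\lambda\|\Theta\|_{nu}.$$ **Theorem.** For every $\delta_0>0$ there is $C_0>0$, depending only on $\delta_0$, such that for every $C_1\ge C_0$ and all $c,K>0$ there are $C_2,C_3>0$, depending only on $\delta_0,C_1,c,K$, with the following property. In the setting above, let $\delta\ge\delta_0$, suppose that $$c\,d\log^3 d\ \le\ n\ \le\ K\,r^2d^2\log d,$$ and put $\lambda=C_1(\sigma+\Delta)\sqrt{\frac{\delta\log d}{nd}}$ and $\mathscr{L}=\alpha+\sigma+\Delta$. Then there is an event of probability at least $1-4d^{-\delta}$ on which every minimizer $\widehat\Theta$ as above satisfies, with $\widehat{\mathbf\Delta}:=\widehat\Theta-\Theta^\star$,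 $$\frac{\|\widehat{\mathbf\Delta}\|_F}{d}\le C_2\,\mathscr{L}\sqrt{\frac{\delta rd\log d}{n}}\qquad\text{and}\qquad\frac{\|\widehat{\mathbf\Delta}\|_{nu}}{d}\le C_3\,\mathscr{L}\,r\sqrt{\frac{\delta d\log d}{n}}.$$ -/

import Mathlib

open MeasureTheory ProbabilityTheory Set
open scoped ENNReal

noncomputable section

namespace QMC

/-- Frobenius norm. -/
def frobNorm {d : ℕ} (A : Matrix (Fin d) (Fin d) ℝ) : ℝ :=
  √(∑ i, ∑ j, A i j ^ 2)

/-- Max norm: the largest absolute value of an entry. -/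
def maxNorm {d : ℕ} (A : Matrix (Fin d) (Fin d) ℝ) : ℝ :=
  ⨆ p : Fin d × Fin d, |A p.1 p.2|

/-- Nuclear norm: the sum of the singular values of `A`, viewed as a map of Euclidean space. -/
def nuclearNorm {d : ℕ} (A : Matrix (Fin d) (Fin d) ℝ) : ℝ :=
  ∑ i : Fin d, (Matrix.toEuclideanLin A).singularValues i

/-- The trace inner product of matrices. -/
def matInner {d : ℕ} (A B : Matrix (Fin d) (Fin d) ℝ) : ℝ :=
  (A.transpose * B).trace

/-- The sub-exponential norm `inf {t > 0 : E exp (|Z| / t) ≤ 2}`, which is `∞` if there is no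
such `t`. -/
def psi1Norm {Ω : Type*} [MeasurableSpace Ω] (μ : Measure Ω) (Z : Ω → ℝ) : ℝ≥0∞ :=
  ⨅ (t : ℝ) (_ : 0 < t ∧ ∫⁻ ω, ENNReal.ofReal (Real.exp (|Z ω| / t)) ∂μ ≤ 2), ENNReal.ofReal t

/-- The uniform quantizer of resolution `Δ`; resolution `0` means no quantization. -/
def quantize (Δ a : ℝ) : ℝ :=
  if Δ = 0 then a else Δ * ((⌊a / Δ⌋ : ℝ) + 1 / 2)

/-- The law of the dither: uniform on `[-Δ/2, Δ/2]`, that is, the point mass at `0` if `Δ = 0`. -/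
def uniformDither (Δ : ℝ) : Measure ℝ :=
  if Δ = 0 then Measure.dirac 0 else ProbabilityTheory.cond volume (Icc (-(Δ / 2)) (Δ / 2))

/-- The design matrix `e_i e_jᵀ` attached to a position `(i, j)`. -/
def design {d : ℕ} (p : Fin d × Fin d) : Matrix (Fin d) (Fin d) ℝ :=
  Matrix.single p.1 p.2 1

/-- The dithered and quantized observation of the entry of `Θ` at position `p`, with noise `e`
and dither `t`. -/
def quantizedObs {d : ℕ} (Δ : ℝ) (Θ : Matrix (Fin d) (Fin d) ℝ) (p : Fin d × Fin d)
    (e t : ℝ) : ℝ :=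
  quantize Δ ((matInner (design p) Θ + e) + t)

/-- The randomness of the model: positions `J k` that are uniform on `[d] × [d]`, noise `ε k` that
is identically distributed with mean zero and sub-exponential norm at most `σ`, and dither `τ k`.
The position, the noise and the dither of one sample are independent, and the `n` samples are
independent of each other. -/
structure IsModel {Ω : Type*} [MeasurableSpace Ω] (μ : Measure Ω) {d n : ℕ} (σ Δ : ℝ)
    (J : Fin n → Ω → Fin d × Fin d) (ε τ : Fin n → Ω → ℝ) : Prop where
  position_law : ∀ k, HasLaw (J k) (uniformOn univ) μ
  noise_identDistrib : ∀ k l, IdentDistrib (ε k) (ε l) μ μ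
  noise_mean : ∀ k, ∫ ω, ε k ω ∂μ = 0
  noise_psi1 : ∀ k, psi1Norm μ (ε k) ≤ ENNReal.ofReal σ
  dither_law : ∀ k, HasLaw (τ k) (uniformDither Δ) μ
  indep_position_noise : ∀ k, IndepFun (J k) (ε k) μ
  indep_dither : ∀ k, IndepFun (fun ω => (J k ω, ε k ω)) (τ k) μ
  indep_samples : iIndepFun (fun k ω => (J k ω, ε k ω, τ k ω)) μ

/-- The regularized least squares objective, for positions `p k` and observations `y k`. -/
def objective {d n : ℕ} (lam : ℝ) (p : Fin n → Fin d × Fin d) (y : Fin n → ℝ)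
    (Θ : Matrix (Fin d) (Fin d) ℝ) : ℝ :=
  1 / (2 * (n : ℝ)) * ∑ k, (y k - matInner (design (p k)) Θ) ^ 2 + lam * nuclearNorm Θ

/-- `Θ` minimizes the objective over the max norm ball of radius `α`. -/
def IsEstimator {d n : ℕ} (α lam : ℝ) (p : Fin n → Fin d × Fin d) (y : Fin n → ℝ)
    (Θ : Matrix (Fin d) (Fin d) ℝ) : Prop :=
  maxNorm Θ ≤ α ∧ IsMinOn (objective lam p y) {M | maxNorm M ≤ α} Θ

end QMC

end

/-!
If the operator norm of the noise matrix is at most `n * λ / 2`, optimality of the estimator and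
decomposability of the nuclear norm put the error in the cone where its nuclear norm is of order
`√r` times its Frobenius norm, and bound the empirical quadratic form of the error by a multiple of
`λ * √r` times its Frobenius norm. Restricted convexity of the sampling operator over that cone
turns this into the rates.

The dither makes the quantized observation conditionally unbiased, so the noise matrix is a sum of
independent centered terms with sub-exponential coefficients; the Golden–Thompson inequality bounds
the trace exponential of its dilation. Restricted convexity follows from symmetrization, the
contraction principle and the same trace exponential bound for the Rademacher matrix.

Writing `X = √(δ * d * log d / n)`, both deviation bounds need `X` below a constant. For larger `X`
the Frobenius bound is the diameter of the max norm ball, and the nuclear norm bound follows from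
comparing the objective at `Θhat` and `Θ` with the `ℓ¹` norm of the noise.
-/

/-! ### The nuclear norm -/

namespace QMC

open Matrix
open scoped Matrix.Norms.L2Operator

section OperatorNorm

variable {m n : Type*} [Fintype m] [Fintype n]

theorem dotProduct_self_eq_norm_sq (x : n → ℝ) : x ⬝ᵥ x = ‖WithLp.toLp 2 x‖ ^ 2 := by
  rw [EuclideanSpace.real_norm_sq_eq]
  simp only [dotProduct, sq]

theorem dotProduct_self_nonneg (x : n → ℝ) : 0 ≤ x ⬝ᵥ x :=
  (sq_nonneg _).trans_eq (dotProduct_self_eq_norm_sq x).symm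

theorem dotProduct_le_norm_mul_norm (x y : n → ℝ) :
    x ⬝ᵥ y ≤ ‖WithLp.toLp 2 x‖ * ‖WithLp.toLp 2 y‖ := by
  simpa [EuclideanSpace.inner_eq_star_dotProduct, dotProduct_comm] using
    real_inner_le_norm (WithLp.toLp 2 x) (WithLp.toLp 2 y)

theorem dotProduct_mulVec_mul_mul {o p : Type*} [Fintype o] [Fintype p] (B : Matrix o m ℝ)
    (A : Matrix m n ℝ) (C : Matrix n p ℝ) (x : o → ℝ) (y : p → ℝ) :
    x ⬝ᵥ (B * A * C) *ᵥ y = Bᵀ *ᵥ x ⬝ᵥ A *ᵥ (C *ᵥ y) := by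
  rw [mulVec_transpose, ← dotProduct_mulVec, mulVec_mulVec, mulVec_mulVec, Matrix.mul_assoc]

variable [DecidableEq n]

theorem two_mul_dotProduct_mulVec_le (A : Matrix m n ℝ) (x : m → ℝ) (y : n → ℝ) :
    2 * (x ⬝ᵥ A *ᵥ y) ≤ ‖A‖ * (x ⬝ᵥ x + y ⬝ᵥ y) := by
  rw [dotProduct_self_eq_norm_sq, dotProduct_self_eq_norm_sq]
  set a := ‖WithLp.toLp 2 x‖
  set b := ‖WithLp.toLp 2 y‖
  have bilinear_le : x ⬝ᵥ A *ᵥ y ≤ a * (‖A‖ * b) :=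
    (dotProduct_le_norm_mul_norm x _).trans
      (mul_le_mul_of_nonneg_left (A.l2_opNorm_mulVec (WithLp.toLp 2 y)) (norm_nonneg _))
  nlinarith [mul_nonneg (norm_nonneg A) (sq_nonneg (a - b))]

theorem l2_opNorm_le_of_two_mul_dotProduct_le {A : Matrix m n ℝ} {t : ℝ} (ht : 0 ≤ t)
    (h : ∀ x y, 2 * (x ⬝ᵥ A *ᵥ y) ≤ t * (x ⬝ᵥ x + y ⬝ᵥ y)) : ‖A‖ ≤ t := by
  refine ContinuousLinearMap.opNorm_le_bound _ ht fun z => ?_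
  change ‖WithLp.toLp 2 (A *ᵥ z.ofLp)‖ ≤ t * ‖z‖
  set a := ‖WithLp.toLp 2 (A *ᵥ z.ofLp)‖
  set b := ‖z‖
  rcases (norm_nonneg _ : 0 ≤ a).eq_or_lt with ha | ha
  · exact ha.symm.trans_le (mul_nonneg ht (norm_nonneg z))
  rcases (norm_nonneg _ : 0 ≤ b).eq_or_lt with hb | hb
  · have hz : z = 0 := norm_eq_zero.1 hb.symm
    simp [hz] at ha
  -- The test vectors `‖z‖ A z` and `‖A z‖ z` have the same length.
  have htest := h (b • A *ᵥ z.ofLp) (a • z.ofLp)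
  have hAz : A *ᵥ z.ofLp ⬝ᵥ A *ᵥ z.ofLp = a ^ 2 := dotProduct_self_eq_norm_sq _
  have hz : z.ofLp ⬝ᵥ z.ofLp = b ^ 2 := dotProduct_self_eq_norm_sq _
  simp only [mulVec_smul, smul_dotProduct, dotProduct_smul, smul_eq_mul, hAz, hz] at htest
  refine le_of_mul_le_mul_right ?_ (by positivity : 0 < 2 * a ^ 2 * b)
  linarith

theorem diag_le_l2_opNorm (A : Matrix n n ℝ) (i : n) : A i i ≤ ‖A‖ := by
  have h := two_mul_dotProduct_mulVec_le A (Pi.single i 1) (Pi.single i 1)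
  simp only [mulVec_single_one, single_one_dotProduct, Pi.single_eq_same, col_apply] at h
  linarith

theorem l2_opNorm_le_one_of_transpose_mul_self_eq_one {U : Matrix m n ℝ} (hU : Uᵀ * U = 1) :
    ‖U‖ ≤ 1 := by
  refine l2_opNorm_le_of_two_mul_dotProduct_le zero_le_one fun x y => ?_
  have hy : U *ᵥ y ⬝ᵥ U *ᵥ y = y ⬝ᵥ y := by
    rw [dotProduct_mulVec, vecMul_mulVec, hU, vecMul_one]
  have hsq := dotProduct_self_nonneg (x - U *ᵥ y)
  simp only [sub_dotProduct, dotProduct_sub, hy, dotProduct_comm _ x] at hsq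
  linarith

end OperatorNorm

theorem rank_add_le {m n : Type*} [Finite m] [Fintype n] (A B : Matrix m n ℝ) :
    (A + B).rank ≤ A.rank + B.rank := by
  rw [Matrix.rank, Matrix.rank, Matrix.rank, Matrix.mulVecLin_add]
  exact (Submodule.finrank_mono (LinearMap.range_add_le _ _)).trans
    (Submodule.finrank_add_le_finrank_add_finrank _ _)

section OrthogonalComplement

variable {m k : Type*} [DecidableEq m] [Fintype k]

/-- The orthogonal projection onto the orthogonal complement of the column space of a matrix `U`
with orthonormal columns. -/
def complProj (U : Matrix m k ℝ) : Matrix m m ℝ :=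
  1 - U * Uᵀ

variable {U : Matrix m k ℝ}

theorem complProj_transpose : (complProj U)ᵀ = complProj U := by
  simp [complProj]

variable [Fintype m] [DecidableEq k]

theorem complProj_mul_self (hU : Uᵀ * U = 1) : complProj U * U = 0 := by
  rw [complProj, Matrix.sub_mul, Matrix.mul_assoc, hU, Matrix.one_mul, Matrix.mul_one, sub_self]

theorem transpose_mul_complProj (hU : Uᵀ * U = 1) : Uᵀ * complProj U = 0 := by
  rw [← transpose_inj, transpose_mul, complProj_transpose, transpose_transpose,
    complProj_mul_self hU, transpose_zero]

theorem complProj_mul_complProj (hU : Uᵀ * U = 1) :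
    complProj U * complProj U = complProj U := by
  nth_rewrite 1 [complProj]
  rw [Matrix.sub_mul, Matrix.one_mul, Matrix.mul_assoc,
    transpose_mul_complProj hU, Matrix.mul_zero, sub_zero]

theorem complProj_mul_mul_complProj {n : Type*} [Fintype n] [DecidableEq n] {V : Matrix n k ℝ}
    (hU : Uᵀ * U = 1) (hV : Vᵀ * V = 1) (A : Matrix m n ℝ) :
    complProj U * (complProj U * A * complProj V) * complProj V =
      complProj U * A * complProj V := by
  rw [← Matrix.mul_assoc, ← Matrix.mul_assoc, complProj_mul_complProj hU, Matrix.mul_assoc _ _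
    (complProj V), complProj_mul_complProj hV]

theorem dotProduct_self_eq_add_complProj (hU : Uᵀ * U = 1) (x : m → ℝ) :
    x ⬝ᵥ x = Uᵀ *ᵥ x ⬝ᵥ Uᵀ *ᵥ x + complProj U *ᵥ x ⬝ᵥ complProj U *ᵥ x := by
  rw [dotProduct_mulVec, vecMul_mulVec, transpose_transpose, dotProduct_mulVec (complProj U *ᵥ x),
    vecMul_mulVec, complProj_transpose, complProj_mul_complProj hU, complProj, ← add_dotProduct,
    ← vecMul_add, add_sub_cancel, vecMul_one]

theorem l2_opNorm_mul_transpose_add_le {n : Type*} [Fintype n] [DecidableEq n]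
    {V : Matrix n k ℝ} {W : Matrix m n ℝ} (hU : Uᵀ * U = 1) (hV : Vᵀ * V = 1) (hW : ‖W‖ ≤ 1) :
    ‖U * Vᵀ + complProj U * W * complProj V‖ ≤ 1 := by
  refine l2_opNorm_le_of_two_mul_dotProduct_le zero_le_one fun x y => ?_
  have range_part : 2 * (x ⬝ᵥ (U * Vᵀ) *ᵥ y) ≤ Uᵀ *ᵥ x ⬝ᵥ Uᵀ *ᵥ x + Vᵀ *ᵥ y ⬝ᵥ Vᵀ *ᵥ y := by
    have h := dotProduct_self_nonneg (Uᵀ *ᵥ x - Vᵀ *ᵥ y)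
    rw [← mulVec_mulVec, dotProduct_mulVec, ← mulVec_transpose]
    simp only [sub_dotProduct, dotProduct_sub, dotProduct_comm _ (Uᵀ *ᵥ x)] at h
    linarith
  have compl_part := two_mul_dotProduct_mulVec_le W (complProj U *ᵥ x) (complProj V *ᵥ y)
  have norm_le := mul_le_mul_of_nonneg_right hW
    (add_nonneg (dotProduct_self_nonneg (complProj U *ᵥ x))
      (dotProduct_self_nonneg (complProj V *ᵥ y)))
  rw [add_mulVec, dotProduct_add, dotProduct_mulVec_mul_mul (complProj U), complProj_transpose,
    dotProduct_self_eq_add_complProj hU x, dotProduct_self_eq_add_complProj hV y]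
  linarith

end OrthogonalComplement

section CompactSVD

variable {d : ℕ}

theorem toEuclideanLin_rank (A : Matrix (Fin d) (Fin d) ℝ) :
    Module.finrank ℝ (toEuclideanLin A).range = A.rank := by
  rw [A.rank_eq_finrank_range_toLin (EuclideanSpace.basisFun (Fin d) ℝ).toBasis
    (EuclideanSpace.basisFun (Fin d) ℝ).toBasis, toEuclideanLin_eq_toLin_orthonormal]

theorem exists_orthonormal_transpose_mul_eq_diagonal (A : Matrix (Fin d) (Fin d) ℝ) :
    ∃ V : Matrix (Fin d) (Fin d) ℝ, Vᵀ * V = 1 ∧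
      (A * V)ᵀ * (A * V) = diagonal fun i : Fin d => (toEuclideanLin A).singularValues i ^ 2 := by
  set T := toEuclideanLin A
  have hd : Module.finrank ℝ (EuclideanSpace ℝ (Fin d)) = d := finrank_euclideanSpace_fin
  have hT := T.isSymmetric_adjoint_comp_self
  set b := hT.eigenvectorBasis hd with hb
  have hbb := orthonormal_iff_ite.1 b.orthonormal
  refine ⟨of fun a i => b i a, ?_, ?_⟩
  · ext i j
    rw [one_apply, ← hbb i j]
    simp [mul_apply, PiLp.inner_apply, mul_comm]
  · ext i j
    rw [diagonal_apply]
    calc _ = inner ℝ (T (b i)) (T (b j)) := by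
          rw [EuclideanSpace.inner_eq_star_dotProduct, dotProduct_comm]
          rfl
      _ = T.singularValues j ^ 2 * inner ℝ (b i) (b j) := by
          rw [← LinearMap.adjoint_inner_right, ← LinearMap.comp_apply,
            hT.apply_eigenvectorBasis hd j, ← T.sq_singularValues_fin hd j, inner_smul_right, ← hb]
          simp
      _ = _ := by
          rw [hbb]
          split_ifs with h <;> simp [h]

theorem sum_eq_sum_castLE {r d : ℕ} (h : r ≤ d) {f : Fin d → ℝ}
    (hf : ∀ j : Fin d, r ≤ j → f j = 0) : ∑ j, f j = ∑ i, f (Fin.castLE h i) := by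
  refine (Finset.sum_of_injOn (Fin.castLE h) (Fin.castLE_injective h).injOn (by simp)
    (fun j _ hj => hf j ?_) fun _ _ => rfl).symm
  contrapose! hj
  exact ⟨⟨j, hj⟩, by simp⟩

theorem exists_compact_svd (A : Matrix (Fin d) (Fin d) ℝ) :
    ∃ k, k = A.rank ∧ ∃ (U V : Matrix (Fin d) (Fin k) ℝ) (w : Fin k → ℝ),
      Uᵀ * U = 1 ∧ Vᵀ * V = 1 ∧ (∀ i, 0 ≤ w i) ∧ A = U * diagonal w * Vᵀ ∧
      nuclearNorm A = ∑ i, w i := by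
  obtain ⟨V, hV, hAV⟩ := exists_orthonormal_transpose_mul_eq_diagonal A
  set T := toEuclideanLin A
  set ι : Fin A.rank → Fin d := Fin.castLE A.rank_le_height
  set w : Fin A.rank → ℝ := fun i => T.singularValues i
  have pos_iff : ∀ i : ℕ, 0 < T.singularValues i ↔ i < A.rank := fun i => by
    rw [T.singularValues_pos_iff_lt_finrank_range, toEuclideanLin_rank]
  have hw : ∀ i, w i ≠ 0 := fun i => ((pos_iff i).2 i.2).ne'
  have vanish : ∀ j : Fin d, A.rank ≤ j → T.singularValues j = 0 := fun j hj =>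
    (T.singularValues_nonneg j).eq_or_lt.elim Eq.symm fun h => absurd ((pos_iff j).1 h) hj.not_gt
  have col_vanish : ∀ j : Fin d, A.rank ≤ j → (A * V).col j = 0 := fun j hj => by
    rw [← dotProduct_self_eq_zero]
    refine (congrFun₂ hAV j j).trans ?_
    rw [diagonal_apply_eq, vanish j hj, zero_pow two_ne_zero]
  have gram : ((A * V).submatrix id ι)ᵀ * (A * V).submatrix id ι = diagonal fun i => w i ^ 2 := by
    ext i j
    refine (congrFun₂ hAV (ι i) (ι j)).trans ?_
    simp [diagonal_apply, ι, w]
  refine ⟨A.rank, rfl, (A * V).submatrix id ι * diagonal fun i => (w i)⁻¹, V.submatrix id ι, w,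
    ?_, ?_, fun i => T.singularValues_nonneg i, ?_, ?_⟩
  · rw [transpose_mul, diagonal_transpose, Matrix.mul_assoc, ← Matrix.mul_assoc _ _ (diagonal _),
      gram, diagonal_mul_diagonal, diagonal_mul_diagonal, ← diagonal_one]
    congr 1
    ext i
    have := hw i
    field_simp
  · ext i j
    refine (congrFun₂ hV (ι i) (ι j)).trans ?_
    simp [one_apply, ι]
  · have inv_mul_w : (diagonal fun i => (w i)⁻¹) * diagonal w = 1 := by
      simp [diagonal_mul_diagonal, hw]
    rw [Matrix.mul_assoc _ _ (diagonal w), inv_mul_w, Matrix.mul_one]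
    have A_eq : A = A * V * Vᵀ := by
      rw [Matrix.mul_assoc, mul_eq_one_comm.1 hV, Matrix.mul_one]
    ext a c
    calc A a c = ∑ j, (A * V) a j * V c j := congrFun₂ A_eq a c
      _ = ∑ i, (A * V) a (ι i) * V c (ι i) :=
        sum_eq_sum_castLE A.rank_le_height fun j hj => by
          rw [show (A * V) a j = 0 from congrFun (col_vanish j hj) a, zero_mul]
  · exact sum_eq_sum_castLE A.rank_le_height vanish

end CompactSVD

section Duality

variable {d : ℕ}

theorem matInner_add_left (A B C : Matrix (Fin d) (Fin d) ℝ) :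
    matInner (A + B) C = matInner A C + matInner B C := by
  simp [matInner, Matrix.add_mul]

theorem matInner_add_right (A B C : Matrix (Fin d) (Fin d) ℝ) :
    matInner A (B + C) = matInner A B + matInner A C := by
  simp [matInner, Matrix.mul_add]

theorem matInner_sub_right (A B C : Matrix (Fin d) (Fin d) ℝ) :
    matInner A (B - C) = matInner A B - matInner A C := by
  simp [matInner, Matrix.mul_sub]

theorem matInner_neg_left (A B : Matrix (Fin d) (Fin d) ℝ) :
    matInner (-A) B = -matInner A B := by
  simp [matInner]

theorem matInner_smul_left (c : ℝ) (A B : Matrix (Fin d) (Fin d) ℝ) :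
    matInner (c • A) B = c * matInner A B := by
  simp [matInner]

theorem matInner_smul_right (c : ℝ) (A B : Matrix (Fin d) (Fin d) ℝ) :
    matInner A (c • B) = c * matInner A B := by
  simp [matInner]

theorem matInner_sum_left {ι : Type*} (s : Finset ι) (f : ι → Matrix (Fin d) (Fin d) ℝ)
    (A : Matrix (Fin d) (Fin d) ℝ) :
    matInner (∑ i ∈ s, f i) A = ∑ i ∈ s, matInner (f i) A := by
  simp [matInner, Finset.sum_mul, Matrix.trace_sum, Matrix.transpose_sum]

theorem matInner_comm (A B : Matrix (Fin d) (Fin d) ℝ) : matInner A B = matInner B A := by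
  rw [matInner, matInner, ← trace_transpose, transpose_mul, transpose_transpose]

theorem matInner_eq_sum (A B : Matrix (Fin d) (Fin d) ℝ) :
    matInner A B = ∑ i, ∑ j, A i j * B i j := by
  rw [Finset.sum_comm]
  simp [matInner, trace, mul_apply]

theorem matInner_mul_mul (B A C D : Matrix (Fin d) (Fin d) ℝ) :
    matInner (B * A * C) D = matInner A (Bᵀ * D * Cᵀ) := by
  rw [matInner, matInner, transpose_mul, Matrix.mul_assoc, trace_mul_comm, transpose_mul]
  simp only [Matrix.mul_assoc]

theorem matInner_mul_diagonal_mul_transpose {k : Type*} [Fintype k] [DecidableEq k]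
    (W : Matrix (Fin d) (Fin d) ℝ) (U V : Matrix (Fin d) k ℝ) (w : k → ℝ) :
    matInner W (U * diagonal w * Vᵀ) = ∑ i, (Uᵀ * W * V) i i * w i := by
  rw [matInner_comm, matInner, transpose_mul, transpose_mul, transpose_transpose,
    diagonal_transpose, Matrix.mul_assoc, trace_mul_comm]
  simp only [Matrix.mul_assoc, trace, diag_apply, diagonal_mul, mul_comm]

theorem frobNorm_sq (A : Matrix (Fin d) (Fin d) ℝ) : frobNorm A ^ 2 = matInner A A := by
  rw [frobNorm, Real.sq_sqrt (by positivity), matInner_eq_sum]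
  simp only [sq]

theorem frobNorm_nonneg (A : Matrix (Fin d) (Fin d) ℝ) : 0 ≤ frobNorm A :=
  Real.sqrt_nonneg _

theorem nuclearNorm_nonneg (A : Matrix (Fin d) (Fin d) ℝ) : 0 ≤ nuclearNorm A :=
  Finset.sum_nonneg fun _ _ => LinearMap.singularValues_nonneg _ _

theorem matInner_le_l2_opNorm_mul_nuclearNorm (W A : Matrix (Fin d) (Fin d) ℝ) :
    matInner W A ≤ ‖W‖ * nuclearNorm A := by
  obtain ⟨k, -, U, V, w, hU, hV, hw, hA, hA_nuc⟩ := exists_compact_svd A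
  have hUV : ‖Uᵀ * W * V‖ ≤ ‖W‖ := by
    have hU' : ‖Uᵀ‖ ≤ 1 := by
      simpa [conjTranspose_eq_transpose_of_trivial] using
        (l2_opNorm_conjTranspose U).trans_le (l2_opNorm_le_one_of_transpose_mul_self_eq_one hU)
    calc ‖Uᵀ * W * V‖ ≤ ‖Uᵀ * W‖ * ‖V‖ := l2_opNorm_mul _ _
      _ ≤ ‖Uᵀ‖ * ‖W‖ * ‖V‖ := by gcongr; exact l2_opNorm_mul _ _
      _ ≤ 1 * ‖W‖ * 1 := by
        gcongr
        exact l2_opNorm_le_one_of_transpose_mul_self_eq_one hV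
      _ = ‖W‖ := by ring
  rw [hA_nuc, Finset.mul_sum]
  conv_lhs => rw [hA, matInner_mul_diagonal_mul_transpose]
  exact Finset.sum_le_sum fun i _ =>
    mul_le_mul_of_nonneg_right ((diag_le_l2_opNorm _ i).trans hUV) (hw i)

theorem matInner_le_nuclearNorm {W : Matrix (Fin d) (Fin d) ℝ} (hW : ‖W‖ ≤ 1)
    (A : Matrix (Fin d) (Fin d) ℝ) : matInner W A ≤ nuclearNorm A :=
  (matInner_le_l2_opNorm_mul_nuclearNorm W A).trans
    (mul_le_of_le_one_left (nuclearNorm_nonneg A) hW)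

theorem exists_l2_opNorm_le_one_matInner_eq_nuclearNorm (A : Matrix (Fin d) (Fin d) ℝ) :
    ∃ W : Matrix (Fin d) (Fin d) ℝ, ‖W‖ ≤ 1 ∧ matInner W A = nuclearNorm A := by
  obtain ⟨k, -, U, V, w, hU, hV, -, hA, hA_nuc⟩ := exists_compact_svd A
  refine ⟨U * Vᵀ, ?_, ?_⟩
  · simpa using l2_opNorm_mul_transpose_add_le hU hV (W := 0) (by simp)
  · have hUV : Uᵀ * (U * Vᵀ) * V = 1 := by
      rw [← Matrix.mul_assoc, hU, Matrix.one_mul, hV]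
    conv_lhs => rw [hA, matInner_mul_diagonal_mul_transpose, hUV]
    simp [hA_nuc]

theorem nuclearNorm_zero : nuclearNorm (0 : Matrix (Fin d) (Fin d) ℝ) = 0 := by
  simp [nuclearNorm]

theorem nuclearNorm_smul_le {c : ℝ} (hc : 0 ≤ c) (A : Matrix (Fin d) (Fin d) ℝ) :
    nuclearNorm (c • A) ≤ c * nuclearNorm A := by
  obtain ⟨W, hW, hWA⟩ := exists_l2_opNorm_le_one_matInner_eq_nuclearNorm (c • A)
  rw [← hWA, matInner_smul_right]
  exact mul_le_mul_of_nonneg_left (matInner_le_nuclearNorm hW A) hc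

theorem nuclearNorm_add_le (A B : Matrix (Fin d) (Fin d) ℝ) :
    nuclearNorm (A + B) ≤ nuclearNorm A + nuclearNorm B := by
  obtain ⟨W, hW, hWAB⟩ := exists_l2_opNorm_le_one_matInner_eq_nuclearNorm (A + B)
  rw [← hWAB, matInner_add_right]
  exact add_le_add (matInner_le_nuclearNorm hW A) (matInner_le_nuclearNorm hW B)

theorem nuclearNorm_sub_le (A B : Matrix (Fin d) (Fin d) ℝ) :
    nuclearNorm (A - B) ≤ nuclearNorm A + nuclearNorm B := by
  obtain ⟨W, hW, hWAB⟩ := exists_l2_opNorm_le_one_matInner_eq_nuclearNorm (A - B)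
  rw [← hWAB, matInner_sub_right, sub_eq_add_neg, ← matInner_neg_left]
  exact add_le_add (matInner_le_nuclearNorm hW A)
    (matInner_le_nuclearNorm ((norm_neg W).trans_le hW) B)

theorem nuclearNorm_le_sqrt_rank_mul_frobNorm (A : Matrix (Fin d) (Fin d) ℝ) :
    nuclearNorm A ≤ √A.rank * frobNorm A := by
  obtain ⟨k, hk, U, V, w, hU, hV, -, hA, hA_nuc⟩ := exists_compact_svd A
  have hUAV : Uᵀ * A * V = diagonal w := by
    conv_lhs => rw [hA]
    rw [Matrix.mul_assoc, Matrix.mul_assoc _ Vᵀ, hV, Matrix.mul_one, ← Matrix.mul_assoc, hU,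
      Matrix.one_mul]
  have hF : frobNorm A ^ 2 = ∑ i, w i ^ 2 := by
    rw [frobNorm_sq]
    conv_lhs => rw [hA, matInner_mul_diagonal_mul_transpose, ← hA, hUAV]
    simp [sq]
  refine le_of_sq_le_sq ?_ (mul_nonneg (Real.sqrt_nonneg _) (frobNorm_nonneg A))
  rw [mul_pow, Real.sq_sqrt (Nat.cast_nonneg _), hF, hA_nuc, ← hk]
  simpa using sq_sum_le_card_mul_sum_sq (s := Finset.univ) (f := w)

-- The certificates of `Θ` and of `P * D * Q` have orthogonal column and row spaces, so adding them
-- costs nothing in norm.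
theorem exists_dual_certificate {k : Type*} [Fintype k] [DecidableEq k]
    {U V : Matrix (Fin d) k ℝ} (hU : Uᵀ * U = 1) (hV : Vᵀ * V = 1) (w : k → ℝ)
    (D : Matrix (Fin d) (Fin d) ℝ) :
    ∃ Z : Matrix (Fin d) (Fin d) ℝ, ‖Z‖ ≤ 1 ∧ matInner Z (U * diagonal w * Vᵀ) = ∑ i, w i ∧
      matInner Z (complProj U * D * complProj V) =
        nuclearNorm (complProj U * D * complProj V) := by
  set D₂ := complProj U * D * complProj V with hD₂
  obtain ⟨W, hW, hWD₂⟩ := exists_l2_opNorm_le_one_matInner_eq_nuclearNorm D₂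
  refine ⟨U * Vᵀ + complProj U * W * complProj V, l2_opNorm_mul_transpose_add_le hU hV hW, ?_, ?_⟩
  · have certificate_compress : Uᵀ * (U * Vᵀ + complProj U * W * complProj V) * V = 1 := by
      simp only [Matrix.mul_add, ← Matrix.mul_assoc, hU, transpose_mul_complProj hU,
        Matrix.one_mul, Matrix.zero_mul, hV, add_zero]
    rw [matInner_mul_diagonal_mul_transpose, certificate_compress]
    simp
  · have hUD₂ : Uᵀ * D₂ = 0 := by
      rw [hD₂, ← Matrix.mul_assoc, ← Matrix.mul_assoc, transpose_mul_complProj hU,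
        Matrix.zero_mul, Matrix.zero_mul]
    have hUVD₂ : matInner (U * Vᵀ) D₂ = 0 := by
      rw [matInner, transpose_mul, Matrix.mul_assoc, hUD₂, Matrix.mul_zero, trace_zero]
    rw [matInner_add_left, hUVD₂, zero_add, matInner_mul_mul, complProj_transpose,
      complProj_transpose, complProj_mul_mul_complProj hU hV, hWD₂]

-- With `P` and `Q` the projections onto the complements of the column and row spaces of `Θ`, take
-- `D₂ = P * D * Q`.
theorem exists_nuclearNorm_decomposition (Θ D : Matrix (Fin d) (Fin d) ℝ) :
    ∃ D₁ D₂ : Matrix (Fin d) (Fin d) ℝ, D = D₁ + D₂ ∧ D₁.rank ≤ 2 * Θ.rank ∧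
      frobNorm D₁ ≤ frobNorm D ∧
      nuclearNorm Θ + nuclearNorm D₂ - nuclearNorm D₁ ≤ nuclearNorm (Θ + D) := by
  obtain ⟨k, hk, U, V, w, hU, hV, -, hΘ, hΘ_nuc⟩ := exists_compact_svd Θ
  set P := complProj U with hP
  set Q := complProj V with hQ
  set D₂ := P * D * Q with hD₂
  refine ⟨D - D₂, D₂, by simp, ?_, ?_, ?_⟩
  · have hD₁ : D - D₂ = U * (Uᵀ * D) + P * D * V * Vᵀ := by
      rw [hD₂, hQ, complProj, Matrix.mul_sub, Matrix.mul_one, hP, complProj]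
      simp only [Matrix.sub_mul, Matrix.one_mul, Matrix.mul_assoc]
      abel
    have h₁ := ((U.rank_mul_le_left (Uᵀ * D)).trans U.rank_le_width)
    have h₂ := ((P * D * V).rank_mul_le_left Vᵀ).trans (P * D * V).rank_le_width
    rw [hD₁]
    exact (rank_add_le _ _).trans (by omega)
  · have orthogonal : matInner D₂ D = matInner D₂ D₂ := by
      conv_rhs => rw [hD₂, matInner_mul_mul, complProj_transpose, complProj_transpose, ← hD₂,
        complProj_mul_mul_complProj hU hV, matInner_comm]
    refine le_of_sq_le_sq ?_ (frobNorm_nonneg D)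
    have h := sq_nonneg (frobNorm D₂)
    rw [frobNorm_sq] at h
    rw [frobNorm_sq, frobNorm_sq, matInner_sub_right, matInner_comm _ D, matInner_comm _ D₂,
      matInner_sub_right, matInner_sub_right, matInner_comm D D₂, orthogonal]
    linarith
  · obtain ⟨Z, hZ, hZΘ, hZD₂⟩ := exists_dual_certificate hU hV w D
    have dual_le := matInner_le_nuclearNorm hZ (Θ + D)
    have dual_neg_le := matInner_le_nuclearNorm ((norm_neg Z).trans_le hZ) (D - D₂)
    rw [← hΘ, ← hΘ_nuc] at hZΘ
    rw [matInner_add_right, hZΘ] at dual_le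
    rw [matInner_neg_left, matInner_sub_right, hZD₂] at dual_neg_le
    linarith

end Duality

end QMC

/-! ### Trace exponential inequalities -/

namespace QMC

open Filter Matrix NormedSpace
open scoped Matrix.Norms.L2Operator Topology

section LieProductFormula

theorem norm_pow_sub_pow_le {𝔸 : Type*} [NormedRing 𝔸] [NormOneClass 𝔸] {x y : 𝔸}
    {c : ℝ} (hc : 1 ≤ c) (hx : ‖x‖ ≤ c) (hy : ‖y‖ ≤ c) (n : ℕ) :
    ‖x ^ n - y ^ n‖ ≤ n * c ^ n * ‖x - y‖ := by
  induction n with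
  | zero => simp
  | succ n ih =>
    have hxn : ‖x ^ n‖ ≤ c ^ (n + 1) :=
      (norm_pow_le x n).trans ((pow_le_pow_left₀ (norm_nonneg _) hx n).trans
        (pow_le_pow_right₀ hc n.le_succ))
    calc ‖x ^ (n + 1) - y ^ (n + 1)‖ = ‖x ^ n * (x - y) + (x ^ n - y ^ n) * y‖ := by
          rw [pow_succ, pow_succ]
          noncomm_ring
      _ ≤ ‖x ^ n‖ * ‖x - y‖ + ‖x ^ n - y ^ n‖ * ‖y‖ :=
          (norm_add_le _ _).trans (add_le_add (norm_mul_le _ _) (norm_mul_le _ _))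
      _ ≤ c ^ (n + 1) * ‖x - y‖ + n * c ^ n * ‖x - y‖ * c := by gcongr
      _ = (n + 1 : ℕ) * c ^ (n + 1) * ‖x - y‖ := by
          push_cast
          ring

variable {𝔸 : Type*} [NormedRing 𝔸] [NormedAlgebra ℝ 𝔸] [CompleteSpace 𝔸]

theorem tendsto_mul_norm_exp_mul_exp_sub_exp (a b : 𝔸) :
    Tendsto (fun n : ℕ => (n : ℝ) *
      ‖exp ((n : ℝ)⁻¹ • a) * exp ((n : ℝ)⁻¹ • b) - exp ((n : ℝ)⁻¹ • (a + b))‖) atTop (𝓝 0) := by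
  set f : ℝ → 𝔸 := fun t => exp (t • a) * exp (t • b) - exp (t • (a + b))
  have deriv_zero : HasDerivAt f 0 0 := by
    have hab : HasDerivAt f _ 0 := ((hasDerivAt_exp_smul_const (𝕂 := ℝ) a 0).mul
      (hasDerivAt_exp_smul_const (𝕂 := ℝ) b 0)).sub (hasDerivAt_exp_smul_const (𝕂 := ℝ) (a + b) 0)
    convert hab using 1
    simp
  have inv_tendsto : Tendsto (fun n : ℕ => (n : ℝ)⁻¹) atTop (𝓝[≠] 0) :=
    (tendsto_inv_atTop_nhdsGT_zero.comp tendsto_natCast_atTop_atTop).mono_right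
      (nhdsWithin_mono _ fun _ => ne_of_gt)
  have slope := ((hasDerivAt_iff_tendsto_slope_zero.1 deriv_zero).comp inv_tendsto).norm
  simpa [f, Function.comp_def, norm_smul] using slope

theorem exp_inv_smul_pow {n : ℕ} (hn : n ≠ 0) (a : 𝔸) : exp ((n : ℝ)⁻¹ • a) ^ n = exp a := by
  let _ := NormedAlgebra.restrictScalars ℚ ℝ 𝔸
  rw [← NormedSpace.exp_nsmul, ← Nat.cast_smul_eq_nsmul ℝ, smul_smul,
    mul_inv_cancel₀ (Nat.cast_ne_zero.2 hn), one_smul]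

variable [NormOneClass 𝔸]

theorem norm_exp_le_exp_norm (a : 𝔸) : ‖exp a‖ ≤ Real.exp ‖a‖ := by
  rw [Real.exp_eq_exp_ℝ, ← (exp_series_hasSum_exp' (𝕂 := ℝ) a).tsum_eq]
  refine tsum_of_norm_bounded (exp_series_hasSum_exp' (𝕂 := ℝ) ‖a‖) fun n => ?_
  rw [norm_smul, smul_eq_mul, Real.norm_of_nonneg (by positivity)]
  exact mul_le_mul_of_nonneg_left (norm_pow_le a n) (by positivity)

theorem tendsto_exp_mul_exp_pow (a b : 𝔸) :
    Tendsto (fun n : ℕ => (exp ((n : ℝ)⁻¹ • a) * exp ((n : ℝ)⁻¹ • b)) ^ n) atTop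
      (𝓝 (exp (a + b))) := by
  rw [tendsto_iff_norm_sub_tendsto_zero]
  have bound_tendsto :=
    (tendsto_mul_norm_exp_mul_exp_sub_exp a b).const_mul (Real.exp (‖a‖ + ‖b‖))
  rw [mul_zero] at bound_tendsto
  refine squeeze_zero' (.of_forall fun _ => norm_nonneg _) ?_ bound_tendsto
  filter_upwards [eventually_ne_atTop 0] with n hn
  set s := (n : ℝ)⁻¹
  set c := Real.exp (s * (‖a‖ + ‖b‖))
  have hs : 0 ≤ s := by positivity
  have exp_le : ∀ x : 𝔸, ‖exp (s • x)‖ ≤ Real.exp (s * ‖x‖) := fun x => by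
    simpa [norm_smul, abs_of_nonneg hs] using norm_exp_le_exp_norm (s • x)
  have mul_le : ‖exp (s • a) * exp (s • b)‖ ≤ c :=
    calc ‖exp (s • a) * exp (s • b)‖ ≤ ‖exp (s • a)‖ * ‖exp (s • b)‖ := norm_mul_le _ _
      _ ≤ Real.exp (s * ‖a‖) * Real.exp (s * ‖b‖) := by gcongr <;> exact exp_le _
      _ = c := by rw [← Real.exp_add, ← mul_add]
  have add_le : ‖exp (s • (a + b))‖ ≤ c :=
    (exp_le _).trans (Real.exp_le_exp.2 (mul_le_mul_of_nonneg_left (norm_add_le a b) hs))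
  have c_pow : c ^ n = Real.exp (‖a‖ + ‖b‖) := by
    rw [← Real.exp_nat_mul, ← mul_assoc, mul_inv_cancel₀ (Nat.cast_ne_zero.2 hn), one_mul]
  calc _ = ‖(exp (s • a) * exp (s • b)) ^ n - exp (s • (a + b)) ^ n‖ := by
        rw [exp_inv_smul_pow hn]
    _ ≤ n * c ^ n * ‖exp (s • a) * exp (s • b) - exp (s • (a + b))‖ :=
        norm_pow_sub_pow_le (Real.one_le_exp (by positivity)) mul_le add_le n
    _ = _ := by
        rw [c_pow]
        ring

end LieProductFormula

section GoldenThompson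

variable {m : Type*} [Fintype m]

theorem trace_transpose_mul_self_nonneg (M : Matrix m m ℝ) : 0 ≤ (Mᵀ * M).trace := by
  simpa [conjTranspose_eq_transpose_of_trivial] using
    (posSemidef_conjTranspose_mul_self M).trace_nonneg

theorem two_mul_trace_transpose_mul_le (P Q : Matrix m m ℝ) :
    2 * (Pᵀ * Q).trace ≤ (Pᵀ * P).trace + (Qᵀ * Q).trace := by
  have sq_nonneg := trace_transpose_mul_self_nonneg (P - Q)
  have symm : (Qᵀ * P).trace = (Pᵀ * Q).trace := by
    rw [← trace_transpose, transpose_mul, transpose_transpose]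
  simp only [transpose_sub, Matrix.sub_mul, Matrix.mul_sub, trace_sub] at sq_nonneg
  linarith

variable [DecidableEq m]

theorem trace_mul_pow_comm (X Y : Matrix m m ℝ) (k : ℕ) :
    ((X * Y) ^ k).trace = ((Y * X) ^ k).trace := by
  cases k with
  | zero => simp
  | succ k =>
    rw [pow_succ, ← Matrix.mul_assoc, mul_pow_mul, Matrix.mul_assoc, trace_mul_comm,
      Matrix.mul_assoc, ← pow_succ]

-- The two bounds are proved together: each one feeds the next instance of the other.
theorem trace_pow_two_pow_le (k : ℕ) :
    (∀ M : Matrix m m ℝ, (M ^ 2 ^ (k + 1)).trace ≤ ((Mᵀ * M) ^ 2 ^ k).trace) ∧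
    (∀ P Q : Matrix m m ℝ, P.IsSymm → Q.IsSymm →
      ((P * Q) ^ 2 ^ k).trace ≤ (P ^ 2 ^ k * Q ^ 2 ^ k).trace) := by
  induction k with
  | zero =>
    refine ⟨fun M => ?_, fun P Q _ _ => by simp⟩
    have h := two_mul_trace_transpose_mul_le Mᵀ M
    rw [transpose_transpose, trace_mul_comm M Mᵀ] at h
    simp only [zero_add, pow_one, pow_zero, sq]
    linarith
  | succ k ih =>
    obtain ⟨ih_sq, ih_mul⟩ := ih
    refine ⟨fun M => ?_, fun P Q hP hQ => ?_⟩
    · have cauchy_schwarz :=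
        two_mul_trace_transpose_mul_le ((Mᵀ * M) ^ 2 ^ k) ((M * Mᵀ) ^ 2 ^ k)
      rw [transpose_pow, transpose_pow, transpose_mul, transpose_mul, transpose_transpose,
        ← pow_add, ← pow_add, trace_mul_pow_comm M Mᵀ, ← two_mul (2 ^ k),
        ← pow_succ'] at cauchy_schwarz
      have regroup : (M ^ 2)ᵀ * M ^ 2 = Mᵀ * (Mᵀ * M * M) := by
        simp only [sq, transpose_mul, Matrix.mul_assoc]
      calc (M ^ 2 ^ (k + 1 + 1)).trace = ((M ^ 2) ^ 2 ^ (k + 1)).trace := by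
            rw [← pow_mul, ← pow_succ']
        _ ≤ (((M ^ 2)ᵀ * M ^ 2) ^ 2 ^ k).trace := ih_sq _
        _ = ((Mᵀ * M * (M * Mᵀ)) ^ 2 ^ k).trace := by
            rw [regroup, trace_mul_pow_comm]
            simp only [Matrix.mul_assoc]
        _ ≤ ((Mᵀ * M) ^ 2 ^ k * (M * Mᵀ) ^ 2 ^ k).trace :=
            ih_mul _ _ (isSymm_transpose_mul_self M) (isSymm_mul_transpose_self M)
        _ ≤ ((Mᵀ * M) ^ 2 ^ (k + 1)).trace := by linarith
    · have regroup : (P * Q)ᵀ * (P * Q) = Q * (P ^ 2 * Q) := by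
        rw [transpose_mul, hP.eq, hQ.eq, sq]
        simp only [Matrix.mul_assoc]
      calc ((P * Q) ^ 2 ^ (k + 1)).trace ≤ (((P * Q)ᵀ * (P * Q)) ^ 2 ^ k).trace := ih_sq _
        _ = ((P ^ 2 * Q ^ 2) ^ 2 ^ k).trace := by
            rw [regroup, trace_mul_pow_comm, Matrix.mul_assoc, ← sq]
        _ ≤ ((P ^ 2) ^ 2 ^ k * (Q ^ 2) ^ 2 ^ k).trace := ih_mul _ _ (hP.pow 2) (hQ.pow 2)
        _ = (P ^ 2 ^ (k + 1) * Q ^ 2 ^ (k + 1)).trace := by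
            rw [← pow_mul, ← pow_mul, ← pow_succ']

/-- The Golden–Thompson inequality for real matrices. -/
theorem trace_exp_add_le {A B : Matrix m m ℝ} (hA : A.IsSymm) (hB : B.IsSymm) :
    (exp (A + B)).trace ≤ (exp A * exp B).trace := by
  cases isEmpty_or_nonempty m with
  | inl h => simp [trace]
  | inr h =>
    have trace_tendsto := ((continuous_id.matrix_trace.tendsto _).comp
      (tendsto_exp_mul_exp_pow A B)).comp (tendsto_pow_atTop_atTop_of_one_lt one_lt_two)
    refine le_of_tendsto trace_tendsto (.of_forall fun k => ?_)
    set s := ((2 ^ k : ℕ) : ℝ)⁻¹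
    have trace_le := (trace_pow_two_pow_le k).2 (exp (s • A)) (exp (s • B)) (hA.smul s).exp
      (hB.smul s).exp
    rwa [exp_inv_smul_pow (by positivity), exp_inv_smul_pow (by positivity)] at trace_le

end GoldenThompson

section TraceExp

variable {m : Type*} [Fintype m] [DecidableEq m]

theorem exp_half_smul_mul_self (A : Matrix m m ℝ) :
    exp ((2 : ℝ)⁻¹ • A) * exp ((2 : ℝ)⁻¹ • A) = exp A := by
  rw [← sq]
  exact_mod_cast exp_inv_smul_pow two_ne_zero A

theorem posSemidef_exp {A : Matrix m m ℝ} (hA : A.IsSymm) : (exp A).PosSemidef := by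
  rw [← exp_half_smul_mul_self]
  nth_rewrite 1 [← (hA.smul (2 : ℝ)⁻¹).exp.eq]
  exact posSemidef_conjTranspose_mul_self _

theorem exists_eigenvalues {A : Matrix m m ℝ} (hA : A.IsSymm) :
    ∃ (U : Matrix m m ℝ) (w : m → ℝ), U * Uᵀ = 1 ∧ A = U * diagonal w * Uᵀ ∧
      (exp A).trace = ∑ i, Real.exp (w i) := by
  have hA' : A.IsHermitian := by
    rw [IsHermitian, conjTranspose_eq_transpose_of_trivial, hA.eq]
  set U : Matrix m m ℝ := hA'.eigenvectorUnitary.1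
  have hUU : U * Uᵀ = 1 := by
    simpa [star_eq_conjTranspose, conjTranspose_eq_transpose_of_trivial] using
      mem_unitaryGroup_iff.1 hA'.eigenvectorUnitary.2
  have inv_U : U⁻¹ = Uᵀ := inv_eq_right_inv hUU
  have spectral : A = U * diagonal hA'.eigenvalues * Uᵀ := by
    simpa [Unitary.conjStarAlgAut_apply, star_eq_conjTranspose,
      conjTranspose_eq_transpose_of_trivial, Function.comp_def] using hA'.spectral_theorem
  refine ⟨U, hA'.eigenvalues, hUU, spectral, ?_⟩
  conv_lhs => rw [spectral, ← inv_U, exp_conj U _ (.of_mul_eq_one _ hUU), trace_mul_comm,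
    ← Matrix.mul_assoc, inv_U, mul_eq_one_comm.1 hUU, Matrix.one_mul, exp_diagonal, trace_diagonal]
  simp [Pi.coe_exp, Real.exp_eq_exp_ℝ]

theorem trace_exp_pos [Nonempty m] {A : Matrix m m ℝ} (hA : A.IsSymm) : 0 < (exp A).trace := by
  obtain ⟨U, w, -, -, trace_eq⟩ := exists_eigenvalues hA
  rw [trace_eq]
  exact Finset.sum_pos (fun i _ => Real.exp_pos _) Finset.univ_nonempty

theorem dotProduct_mulVec_le_log_trace_exp {A : Matrix m m ℝ} (hA : A.IsSymm) (x : m → ℝ) :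
    x ⬝ᵥ A *ᵥ x ≤ Real.log (exp A).trace * (x ⬝ᵥ x) := by
  obtain ⟨U, w, hUU, spectral, trace_eq⟩ := exists_eigenvalues hA
  have eigenvalue_le : ∀ i, w i ≤ Real.log (exp A).trace := fun i => by
    rw [trace_eq, ← Real.log_exp (w i)]
    exact Real.log_le_log (Real.exp_pos _) (Finset.single_le_sum (f := fun i => Real.exp (w i))
      (fun i _ => (Real.exp_pos _).le) (Finset.mem_univ i))
  set y := Uᵀ *ᵥ x
  have x_eq : x ⬝ᵥ x = y ⬝ᵥ y := by
    rw [dotProduct_mulVec, vecMul_mulVec, transpose_transpose, hUU, vecMul_one]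
  have quadratic_form : x ⬝ᵥ A *ᵥ x = ∑ i, w i * (y i * y i) := by
    conv_lhs => rw [spectral, dotProduct_mulVec_mul_mul]
    simp only [dotProduct, mulVec_diagonal]
    exact Finset.sum_congr rfl fun i _ => mul_left_comm _ _ _
  rw [quadratic_form, x_eq, dotProduct, Finset.mul_sum]
  exact Finset.sum_le_sum fun i _ =>
    mul_le_mul_of_nonneg_right (eigenvalue_le i) (mul_self_nonneg _)

end TraceExp

end QMC

/-! ### Hermitian dilation -/

namespace QMC

open Matrix NormedSpace
open scoped Matrix.Norms.L2Operator

theorem exp_smul_of_mul_mul_self {𝔸 : Type*} [NormedRing 𝔸] [NormedAlgebra ℝ 𝔸]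
    [CompleteSpace 𝔸] {h : 𝔸} (hh : h * h * h = h) (c : ℝ) :
    exp (c • h) = 1 + (Real.cosh c - 1) • (h * h) + Real.sinh c • h := by
  have pow_odd : ∀ n : ℕ, h ^ (2 * n + 1) = h := fun n => by
    induction n with
    | zero => simp
    | succ n ih => rw [mul_add_one, add_right_comm, pow_add, ih, sq, ← mul_assoc, hh]
  have pow_even : ∀ n : ℕ, h ^ (2 * n) = h * h + if n = 0 then 1 - h * h else 0 := fun n => by
    cases n with
    | zero => simp
    | succ n => rw [mul_add_one, pow_succ, pow_odd, if_neg n.succ_ne_zero, add_zero]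
  have even_sum : HasSum (fun n : ℕ => ((2 * n).factorial : ℝ)⁻¹ • (c • h) ^ (2 * n))
      (Real.cosh c • (h * h) + (1 - h * h)) := by
    convert ((Real.hasSum_cosh c).smul_const (h * h)).add (hasSum_ite_eq 0 (1 - h * h)) using 2
      with n
    rw [smul_pow, pow_even, smul_smul, smul_add, ← div_eq_inv_mul]
    split_ifs with hn <;> simp [hn]
  have odd_sum : HasSum (fun n : ℕ => ((2 * n + 1).factorial : ℝ)⁻¹ • (c • h) ^ (2 * n + 1))
      (Real.sinh c • h) := by
    convert (Real.hasSum_sinh c).smul_const h using 2 with n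
    rw [smul_pow, pow_odd, smul_smul, ← div_eq_inv_mul]
  rw [(exp_series_hasSum_exp' (𝕂 := ℝ) (c • h)).unique (even_sum.even_add_odd odd_sum), sub_smul,
    one_smul]
  abel

theorem l2_opNorm_le_one_of_mul_mul_self {m : Type*} [Fintype m] [DecidableEq m]
    {h : Matrix m m ℝ} (symm : h.IsSymm) (hh : h * h * h = h) : ‖h‖ ≤ 1 := by
  have cstar : ∀ {a : Matrix m m ℝ}, a.IsSymm → ‖a * a‖ = ‖a‖ * ‖a‖ := fun {a} ha => by
    simpa [conjTranspose_eq_transpose_of_trivial, ha.eq] using l2_opNorm_conjTranspose_mul_self a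
  have sq_idempotent : h * h * (h * h) = h * h := by rw [← mul_assoc, hh]
  have sq_symm : (h * h).IsSymm := by rw [← sq]; exact symm.pow 2
  have norm_sq := cstar sq_symm
  rw [sq_idempotent, cstar symm] at norm_sq
  by_contra! one_lt
  nlinarith [mul_lt_mul'' one_lt one_lt zero_le_one zero_le_one]

variable {d : ℕ}

/-- The symmetric dilation of a square matrix, whose eigenvalues are the singular values of the
matrix with both signs. It reduces operator norm bounds to bounds on largest eigenvalues. -/
def dilation (A : Matrix (Fin d) (Fin d) ℝ) : Matrix (Fin d ⊕ Fin d) (Fin d ⊕ Fin d) ℝ :=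
  fromBlocks 0 A Aᵀ 0

theorem isSymm_dilation (A : Matrix (Fin d) (Fin d) ℝ) : (dilation A).IsSymm := by
  simp [IsSymm, dilation, fromBlocks_transpose]

theorem dilation_smul (c : ℝ) (A : Matrix (Fin d) (Fin d) ℝ) :
    dilation (c • A) = c • dilation A := by
  simp [dilation, fromBlocks_smul]

theorem dilation_sum {ι : Type*} (s : Finset ι) (A : ι → Matrix (Fin d) (Fin d) ℝ) :
    dilation (∑ i ∈ s, A i) = ∑ i ∈ s, dilation (A i) := by
  classical
  induction s using Finset.induction_on with
  | empty => simp [dilation]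
  | insert a t ha ih =>
    rw [Finset.sum_insert ha, Finset.sum_insert ha, ← ih]
    simp [dilation, fromBlocks_add]

theorem dotProduct_dilation (A : Matrix (Fin d) (Fin d) ℝ) (x y : Fin d → ℝ) :
    Sum.elim x y ⬝ᵥ dilation A *ᵥ Sum.elim x y = 2 * (x ⬝ᵥ A *ᵥ y) := by
  rw [dilation, fromBlocks_mulVec, sumElim_dotProduct_sumElim]
  simp only [Sum.elim_comp_inl, Sum.elim_comp_inr, zero_mulVec, zero_add, add_zero]
  rw [dotProduct_mulVec y, vecMul_transpose, dotProduct_comm (A *ᵥ y), two_mul]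

theorem l2_opNorm_le_log_trace_exp_dilation [NeZero d] (A : Matrix (Fin d) (Fin d) ℝ) :
    ‖A‖ ≤ Real.log (exp (dilation A)).trace := by
  have form_le : ∀ x y : Fin d → ℝ,
      2 * (x ⬝ᵥ A *ᵥ y) ≤ Real.log (exp (dilation A)).trace * (x ⬝ᵥ x + y ⬝ᵥ y) := fun x y => by
    simpa only [dotProduct_dilation, sumElim_dotProduct_sumElim] using
      dotProduct_mulVec_le_log_trace_exp (isSymm_dilation A) (Sum.elim x y)
  refine l2_opNorm_le_of_two_mul_dotProduct_le ?_ form_le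
  simpa using form_le (Pi.single 0 1) 0

theorem l2_opNorm_le_of_trace_exp_dilation_le [NeZero d] {A : Matrix (Fin d) (Fin d) ℝ} {t : ℝ}
    (h : (exp (dilation A)).trace ≤ Real.exp t) : ‖A‖ ≤ t :=
  (l2_opNorm_le_log_trace_exp_dilation A).trans
    ((Real.log_le_iff_le_exp (trace_exp_pos (isSymm_dilation A))).2 h)

theorem dilation_design_sq (p : Fin d × Fin d) :
    dilation (design p) * dilation (design p) =
      fromBlocks (single p.1 p.1 1) 0 0 (single p.2 p.2 1) := by
  simp [dilation, design, fromBlocks_multiply]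

theorem dilation_design_cube (p : Fin d × Fin d) :
    dilation (design p) * dilation (design p) * dilation (design p) = dilation (design p) := by
  rw [dilation_design_sq]
  simp [dilation, design, fromBlocks_multiply]

theorem matInner_design (p : Fin d × Fin d) (A : Matrix (Fin d) (Fin d) ℝ) :
    matInner (design p) A = A p.1 p.2 := by
  rw [matInner_comm, matInner, design, trace_mul_single]
  simp

theorem dotProduct_single_mulVec (i j : Fin d) (x y : Fin d → ℝ) :
    x ⬝ᵥ single i j (1 : ℝ) *ᵥ y = x i * y j := by
  rw [single_mulVec, one_mul]
  exact dotProduct_single x (y j) i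

theorem dotProduct_exp_smul_dilation_design (p : Fin d × Fin d) (c : ℝ) (x y : Fin d → ℝ) :
    Sum.elim x y ⬝ᵥ exp (c • dilation (design p)) *ᵥ Sum.elim x y =
      (x ⬝ᵥ x + y ⬝ᵥ y) + (Real.cosh c - 1) * (x p.1 ^ 2 + y p.2 ^ 2) +
        Real.sinh c * (2 * (x p.1 * y p.2)) := by
  rw [exp_smul_of_mul_mul_self (dilation_design_cube p), dilation_design_sq]
  simp only [add_mulVec, one_mulVec, smul_mulVec, dotProduct_add, dotProduct_smul,
    dotProduct_dilation, fromBlocks_mulVec, sumElim_dotProduct_sumElim, design,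
    dotProduct_single_mulVec, Sum.elim_comp_inl, Sum.elim_comp_inr, zero_mulVec, zero_add,
    add_zero, smul_eq_mul, sq]

/-! ### Trace exponential moments of independent sums -/

theorem isSymm_sum {ι m : Type*} (s : Finset ι) {A : ι → Matrix m m ℝ}
    (hA : ∀ i, (A i).IsSymm) : (∑ i ∈ s, A i).IsSymm := by
  simp only [IsSymm, transpose_sum, (hA _).eq]

theorem measurable_ofReal_trace {m T : Type*} [Fintype m] [MeasurableSpace T]
    {F : T → Matrix m m ℝ} (hF : StronglyMeasurable F) :
    Measurable fun t => ENNReal.ofReal (F t).trace :=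
  (continuous_id.matrix_trace.comp_stronglyMeasurable hF).measurable.ennreal_ofReal

section TraceExp

variable {m : Type*} [Fintype m] [DecidableEq m]

theorem trace_mul_exp_le {E S : Matrix m m ℝ} {b : ℝ} (hE : ∀ v, v ⬝ᵥ E *ᵥ v ≤ b * (v ⬝ᵥ v))
    (hS : S.IsSymm) : (E * exp S).trace ≤ b * (exp S).trace := by
  set R := exp ((2 : ℝ)⁻¹ • S)
  have trace_eq : ∀ M : Matrix m m ℝ,
      (M * exp S).trace = ∑ i, R *ᵥ Pi.single i 1 ⬝ᵥ M *ᵥ (R *ᵥ Pi.single i 1) := fun M => by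
    rw [← exp_half_smul_mul_self, ← Matrix.mul_assoc, trace_mul_comm, ← Matrix.mul_assoc, trace]
    refine Finset.sum_congr rfl fun i _ => ?_
    have form_eq := dotProduct_mulVec_mul_mul R M R (Pi.single i 1) (Pi.single i 1)
    rw [(hS.smul (2 : ℝ)⁻¹).exp.eq] at form_eq
    rw [← form_eq]
    simp [R]
  have trace_exp_eq := trace_eq 1
  simp only [Matrix.one_mul, one_mulVec] at trace_exp_eq
  rw [trace_eq, trace_exp_eq, Finset.mul_sum]
  exact Finset.sum_le_sum fun i _ => hE _

theorem trace_exp_nonneg {A : Matrix m m ℝ} (hA : A.IsSymm) : 0 ≤ (exp A).trace :=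
  (posSemidef_exp hA).trace_nonneg

variable {T : Type*} [MeasurableSpace T] {F : T → Matrix m m ℝ} {b : ℝ}

theorem stronglyMeasurable_exp (hF : StronglyMeasurable F) :
    StronglyMeasurable fun t => exp (F t) := by
  let _ := NormedAlgebra.restrictScalars ℚ ℝ (Matrix m m ℝ)
  exact exp_continuous.comp_stronglyMeasurable hF

theorem lintegral_trace_exp_mul_exp_le (hsymm : ∀ t, (F t).IsSymm) {ν : Measure T}
    (hint : Integrable (fun t => exp (F t)) ν) (hb : 0 ≤ b)
    (h : ∀ v, ∫ t, v ⬝ᵥ exp (F t) *ᵥ v ∂ν ≤ b * (v ⬝ᵥ v)) {S : Matrix m m ℝ} (hS : S.IsSymm) :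
    ∫⁻ t, ENNReal.ofReal (exp (F t) * exp S).trace ∂ν ≤
      ENNReal.ofReal b * ENNReal.ofReal (exp S).trace := by
  have integral_comm : ∀ L : Matrix m m ℝ →ₗ[ℝ] ℝ,
      ∫ t, L (exp (F t)) ∂ν = L (∫ t, exp (F t) ∂ν) := fun L =>
    L.toContinuousLinearMap.integral_comp_comm hint
  have mean_form_le : ∀ v, v ⬝ᵥ (∫ t, exp (F t) ∂ν) *ᵥ v ≤ b * (v ⬝ᵥ v) := fun v =>
    (integral_comm (dotProductBilin ℝ ℝ v ∘ₗ (mulVecBilin ℝ ℝ).flip v)).symm.trans_le (h v)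
  let traceMul := traceLinearMap m ℝ ℝ ∘ₗ LinearMap.mulRight ℝ (exp S)
  have traceMul_nonneg : ∀ t, 0 ≤ traceMul (exp (F t)) := fun t =>
    (trace_exp_nonneg ((hsymm t).add hS)).trans (trace_exp_add_le (hsymm t) hS)
  calc ∫⁻ t, ENNReal.ofReal (traceMul (exp (F t))) ∂ν
      = ENNReal.ofReal (∫ t, traceMul (exp (F t)) ∂ν) :=
        (ofReal_integral_eq_lintegral_ofReal
          (traceMul.toContinuousLinearMap.integrable_comp hint)
          (Filter.Eventually.of_forall traceMul_nonneg)).symm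
    _ ≤ ENNReal.ofReal (b * (exp S).trace) := by
        rw [integral_comm]
        exact ENNReal.ofReal_le_ofReal (trace_mul_exp_le mean_form_le hS)
    _ = ENNReal.ofReal b * ENNReal.ofReal (exp S).trace := ENNReal.ofReal_mul hb

theorem lintegral_trace_exp_sum_le (hsymm : ∀ t, (F t).IsSymm) (hF : StronglyMeasurable F)
    (hb : 0 ≤ b) {n : ℕ} (ν : Fin n → Measure T) [∀ k, SigmaFinite (ν k)]
    (hint : ∀ k, Integrable (fun t => exp (F t)) (ν k))
    (h : ∀ k v, ∫ t, v ⬝ᵥ exp (F t) *ᵥ v ∂ν k ≤ b * (v ⬝ᵥ v)) :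
    ∫⁻ z, ENNReal.ofReal (exp (∑ k, F (z k))).trace ∂Measure.pi ν ≤
      ENNReal.ofReal (b ^ n * Fintype.card m) := by
  induction n with
  | zero => simp
  | succ n ih =>
    set G : (Fin n → T) → Matrix m m ℝ := fun z => ∑ k, F (z k)
    have G_symm : ∀ z, (G z).IsSymm := fun z => isSymm_sum _ fun k => hsymm _
    have G_measurable : StronglyMeasurable G :=
      Finset.stronglyMeasurable_fun_sum _ fun k _ => hF.comp_measurable (measurable_pi_apply k)
    have trace_measurable : Measurable fun w : T × (Fin n → T) =>
        ENNReal.ofReal (exp (F w.1) * exp (G w.2)).trace :=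
      measurable_ofReal_trace ((stronglyMeasurable_exp (hF.comp_measurable measurable_fst)).mul
        (stronglyMeasurable_exp (G_measurable.comp_measurable measurable_snd)))
    rw [← ((measurePreserving_piFinSuccAbove ν 0).symm).lintegral_comp_emb
      (MeasurableEquiv.measurableEmbedding _)]
    calc _ ≤ ∫⁻ w : T × (Fin n → T), ENNReal.ofReal (exp (F w.1) * exp (G w.2)).trace
            ∂(ν 0).prod (Measure.pi fun k => ν (Fin.succAbove 0 k)) := by
          refine lintegral_mono fun w => ENNReal.ofReal_le_ofReal ?_
          rw [Fin.sum_univ_succ]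
          exact trace_exp_add_le (hsymm w.1) (G_symm w.2)
      _ = ∫⁻ z, ∫⁻ t, ENNReal.ofReal (exp (F t) * exp (G z)).trace ∂ν 0
            ∂Measure.pi fun k => ν (Fin.succAbove 0 k) :=
          lintegral_prod_symm _ trace_measurable.aemeasurable
      _ ≤ ENNReal.ofReal b * ∫⁻ z, ENNReal.ofReal (exp (G z)).trace
            ∂Measure.pi fun k => ν (Fin.succAbove 0 k) := by
          rw [← lintegral_const_mul' _ _ ENNReal.ofReal_ne_top]
          exact lintegral_mono fun z =>
            lintegral_trace_exp_mul_exp_le hsymm (hint 0) hb (h 0) (G_symm z)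
      _ ≤ ENNReal.ofReal b * ENNReal.ofReal (b ^ n * Fintype.card m) := by
          gcongr
          exact ih _ (fun k => hint _) fun k => h _
      _ = ENNReal.ofReal (b ^ (n + 1) * Fintype.card m) := by
          rw [← ENNReal.ofReal_mul hb, pow_succ', mul_assoc]

open scoped BigOperators in
theorem expect_trace_exp_sum_le {T : Type*} [Fintype T] [Nonempty T] {F : T → Matrix m m ℝ}
    (hsymm : ∀ t, (F t).IsSymm) (hb : 0 ≤ b)
    (h : ∀ v, 𝔼 t, v ⬝ᵥ exp (F t) *ᵥ v ≤ b * (v ⬝ᵥ v)) (n : ℕ) :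
    𝔼 z : Fin n → T, (exp (∑ k, F (z k))).trace ≤ b ^ n * Fintype.card m := by
  let _ : MeasurableSpace T := ⊤
  have card_pos : (0 : ℝ) < Fintype.card T := Nat.cast_pos.2 Fintype.card_pos
  have sum_le : ∀ v, ∑ t, v ⬝ᵥ exp (F t) *ᵥ v ≤ b * Fintype.card T * (v ⬝ᵥ v) := fun v => by
    have hv := h v
    rw [Fintype.expect_eq_sum_div_card, div_le_iff₀ card_pos] at hv
    linarith
  have lintegral_le := lintegral_trace_exp_sum_le hsymm .of_discrete (b := b * Fintype.card T)
    (by positivity) (fun _ : Fin n => Measure.count) (fun _ => .of_finite) fun _ v => by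
      simpa only [integral_count] using sum_le v
  simp only [lintegral_fintype, Measure.pi_singleton, Measure.count_singleton,
    Finset.prod_const_one, mul_one] at lintegral_le
  rw [← ENNReal.ofReal_sum_of_nonneg fun z _ => trace_exp_nonneg (isSymm_sum _ fun k => hsymm _),
    ENNReal.ofReal_le_ofReal_iff (by positivity)] at lintegral_le
  rw [Fintype.expect_eq_sum_div_card, Fintype.card_fun, Fintype.card_fin, Nat.cast_pow,
    div_le_iff₀ (by positivity)]
  linarith [mul_pow b (Fintype.card T : ℝ) n ▸ lintegral_le]

end TraceExp

end QMC

/-! ### Symmetrization and contraction -/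

namespace QMC

open scoped BigOperators

theorem exp_add_exp_le_of_add_le {p q a b : ℝ} (h : p + q ≤ a + b) (hp : p ≤ a) (hq : q ≤ a) :
    Real.exp p + Real.exp q ≤ Real.exp a + Real.exp b := by
  rcases le_total p b with hpb | hbp
  · rw [add_comm]
    exact add_le_add (Real.exp_le_exp.2 hq) (Real.exp_le_exp.2 hpb)
  · have mul_le : Real.exp p * Real.exp q ≤ Real.exp a * Real.exp b := by
      rw [← Real.exp_add, ← Real.exp_add]
      exact Real.exp_le_exp.2 h
    have nonneg : 0 ≤ (Real.exp a - Real.exp p) * (Real.exp p - Real.exp b) :=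
      mul_nonneg (sub_nonneg.2 (Real.exp_le_exp.2 hp)) (sub_nonneg.2 (Real.exp_le_exp.2 hbp))
    exact le_of_mul_le_mul_left (by linarith) (Real.exp_pos p)

section FiniteSuprema

variable {ι : Type*} [Finite ι] [Nonempty ι]

theorem iSup_add_le_max (g : ι → ℝ) {s t : ι → ℝ} (h : ∀ i, |s i| ≤ |t i|) :
    ⨆ i, (g i + s i) ≤ max (⨆ i, (g i + t i)) (⨆ i, (g i - t i)) := by
  refine ciSup_le fun i => ?_
  have s_le := (le_abs_self _).trans (h i)
  rcases abs_choice (t i) with ht | ht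
  · exact le_max_of_le_left
      ((by linarith : _ ≤ g i + t i).trans (Finite.le_ciSup (fun i => g i + t i) i))
  · exact le_max_of_le_right
      ((by linarith : _ ≤ g i - t i).trans (Finite.le_ciSup (fun i => g i - t i) i))

theorem iSup_add_add_iSup_sub_le (g : ι → ℝ) {s t : ι → ℝ}
    (h : ∀ i j, |s i - s j| ≤ |t i - t j|) :
    (⨆ i, (g i + s i)) + ⨆ i, (g i - s i) ≤ (⨆ i, (g i + t i)) + ⨆ i, (g i - t i) := by
  refine ciSup_add_ciSup_le fun i j => ?_
  have s_sub_le := (le_abs_self _).trans (h i j)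
  have add_le := Finite.le_ciSup fun i => g i + t i
  have sub_le := Finite.le_ciSup fun i => g i - t i
  rcases abs_choice (t i - t j) with ht | ht
  · linarith [add_le i, sub_le j]
  · linarith [add_le j, sub_le i]

theorem exp_iSup_contraction (g : ι → ℝ) {s t : ι → ℝ}
    (hsub : ∀ i j, |s i - s j| ≤ |t i - t j|) (habs : ∀ i, |s i| ≤ |t i|) :
    Real.exp (⨆ i, (g i + s i)) + Real.exp (⨆ i, (g i - s i)) ≤
      Real.exp (⨆ i, (g i + t i)) + Real.exp (⨆ i, (g i - t i)) := by
  have sum_le := iSup_add_add_iSup_sub_le g hsub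
  have add_le := iSup_add_le_max g habs
  have sub_le : ⨆ i, (g i - s i) ≤ _ :=
    iSup_add_le_max g (s := -s) (t := t) fun i => by simpa using habs i
  rcases le_total (⨆ i, (g i - t i)) (⨆ i, (g i + t i)) with hle | hle
  · rw [max_eq_left hle] at add_le sub_le
    exact exp_add_exp_le_of_add_le sum_le add_le sub_le
  · rw [max_eq_right hle] at add_le sub_le
    rw [add_comm (Real.exp (⨆ i, (g i + t i)))]
    exact exp_add_exp_le_of_add_le (by linarith) add_le sub_le

/-- The sign `±1` attached to a Boolean; the signs of a uniform Boolean vector are independent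
Rademacher variables. -/
def sgn (b : Bool) : ℝ := if b then 1 else -1

theorem sgn_true : sgn true = 1 := rfl

theorem sgn_false : sgn false = -1 := rfl

theorem expect_bool (f : Bool → ℝ) : 𝔼 b, f b = (f true + f false) / 2 := by
  rw [Fintype.expect_eq_sum_div_card, Fintype.sum_bool, Fintype.card_bool, Nat.cast_ofNat]

theorem expect_fin_succ {α : Type*} [Fintype α] {n : ℕ} (f : (Fin (n + 1) → α) → ℝ) :
    𝔼 e, f e = 𝔼 a, 𝔼 e : Fin n → α, f (Fin.cons a e) := by
  rw [← Fintype.expect_equiv (Fin.consEquiv fun _ => α) (fun q => f (Fin.cons q.1 q.2)) f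
    fun _ => rfl, ← Finset.univ_product_univ, Finset.expect_product]

theorem expect_exp_iSup_contraction {n : ℕ} (g : ι → ℝ) (s t : Fin n → ι → ℝ)
    (hsub : ∀ k i j, |s k i - s k j| ≤ |t k i - t k j|) (habs : ∀ k i, |s k i| ≤ |t k i|) :
    𝔼 e : Fin n → Bool, Real.exp (⨆ i, (g i + ∑ k, sgn (e k) * s k i)) ≤
      𝔼 e : Fin n → Bool, Real.exp (⨆ i, (g i + ∑ k, sgn (e k) * t k i)) := by
  induction n generalizing g with
  | zero => simp
  | succ n ih =>
    have contract_first : ∀ e : Fin n → Bool,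
        𝔼 b, Real.exp (⨆ i, (g i + (sgn b * s 0 i + ∑ k, sgn (e k) * s k.succ i))) ≤
          𝔼 b, Real.exp (⨆ i, ((g i + sgn b * t 0 i) + ∑ k, sgn (e k) * s k.succ i)) := by
      intro e
      have h := exp_iSup_contraction (fun i => g i + ∑ k : Fin n, sgn (e k) * s k.succ i)
        (hsub 0) (habs 0)
      simp only [expect_bool, sgn_true, sgn_false, one_mul, neg_one_mul, ← sub_eq_add_neg]
      simp only [add_right_comm (g _), sub_eq_add_neg, ← add_assoc] at h ⊢
      linarith
    rw [expect_fin_succ, expect_fin_succ, Finset.expect_comm]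
    simp only [Fin.sum_univ_succ, Fin.cons_zero, Fin.cons_succ]
    refine (Finset.expect_le_expect fun e _ => contract_first e).trans ?_
    rw [Finset.expect_comm]
    refine Finset.expect_le_expect fun b _ => ?_
    simpa only [add_assoc] using ih (fun i => g i + sgn b * t 0 i) (fun k => s k.succ)
      (fun k => t k.succ) (fun k => hsub k.succ) (fun k => habs k.succ)

theorem exp_expect_le {κ : Type*} [Fintype κ] [Nonempty κ] (f : κ → ℝ) :
    Real.exp (𝔼 j, f j) ≤ 𝔼 j, Real.exp (f j) := by
  have h := convexOn_exp.map_centerMass_le (t := Finset.univ) (w := fun _ : κ => (1 : ℝ)) (p := f)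
    (fun _ _ => zero_le_one) (by simp [Fintype.card_pos]) fun _ _ => Set.mem_univ _
  simpa [Finset.centerMass, Fintype.expect_eq_sum_div_card, div_eq_inv_mul] using h

theorem exp_iSup_expect_le {κ : Type*} [Fintype κ] [Nonempty κ] (f : ι → κ → ℝ) :
    Real.exp (⨆ i, 𝔼 j, f i j) ≤ 𝔼 j, Real.exp (⨆ i, f i j) := by
  refine (Real.exp_le_exp.2 (ciSup_le fun i => ?_)).trans (exp_expect_le _)
  exact Finset.expect_le_expect fun j _ => Finite.le_ciSup (fun i => f i j) i

theorem exp_iSup_add_le (f g : ι → ℝ) :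
    Real.exp (⨆ i, (f i + g i)) ≤
      (Real.exp (⨆ i, 2 * f i) + Real.exp (⨆ i, 2 * g i)) / 2 := by
  have h := exp_iSup_expect_le fun i (b : Bool) => 2 * (if b then f i else g i)
  simpa only [expect_bool, if_true, Bool.false_eq_true, if_false, ← mul_add,
    mul_div_cancel_left₀ _ (two_ne_zero' ℝ)] using h

theorem exp_iSup_sum_swap_sub_le {P : Type*} {n : ℕ} (f : ι → P → ℝ)
    (e : Fin n → Bool) (J J' : Fin n → P) :
    Real.exp (⨆ i, ∑ k, (f i (if e k then J' k else J k) - f i (if e k then J k else J' k))) ≤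
      (Real.exp (⨆ i, ∑ k, sgn (e k) * (2 * f i (J' k))) +
        Real.exp (⨆ i, ∑ k, sgn (!e k) * (2 * f i (J k)))) / 2 := by
  have swap_sub : ∀ i, ∑ k, (f i (if e k then J' k else J k) - f i (if e k then J k else J' k)) =
      ∑ k, sgn (e k) * f i (J' k) + ∑ k, sgn (!e k) * f i (J k) := by
    intro i
    rw [← Finset.sum_add_distrib]
    refine Finset.sum_congr rfl fun k _ => ?_
    cases e k <;> simp [sgn] <;> ring
  simpa only [swap_sub, Finset.mul_sum, mul_left_comm] using
    exp_iSup_add_le (fun i => ∑ k, sgn (e k) * f i (J' k)) (fun i => ∑ k, sgn (!e k) * f i (J k))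

section Symmetrization

variable {P : Type*} [Fintype P] {n : ℕ}

theorem expect_apply [Nonempty P] (f : P → ℝ) (k : Fin n) :
    𝔼 J : Fin n → P, f (J k) = 𝔼 p, f p := by
  obtain ⟨m, rfl⟩ : ∃ m, n = m + 1 := Nat.exists_eq_succ_of_ne_zero (Fin.pos k).ne'
  have h := Fintype.sum_piFinset_apply f (Finset.univ : Finset P) k
  rw [Fintype.piFinset_univ] at h
  have card_ne : (Fintype.card P : ℝ) ≠ 0 := Nat.cast_ne_zero.2 Fintype.card_ne_zero
  rw [Fintype.expect_eq_sum_div_card, Fintype.expect_eq_sum_div_card, h]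
  simp [pow_succ]
  field_simp

theorem expect_sum_sub_apply [Nonempty P] (f : P → ℝ) (J : Fin n → P) :
    𝔼 J' : Fin n → P, ∑ k, (f (J' k) - f (J k)) = n * 𝔼 p, f p - ∑ k, f (J k) := by
  simp only [Finset.sum_sub_distrib, Finset.expect_sub_distrib, Finset.expect_sum_comm,
    expect_apply, Fintype.expect_const, Finset.sum_const, Finset.card_univ, Fintype.card_fin,
    nsmul_eq_mul]

theorem expect_expect_swap (e : Fin n → Bool) (Φ : (Fin n → P) → (Fin n → P) → ℝ) :
    𝔼 J, 𝔼 J', Φ J J' =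
      𝔼 J : Fin n → P, 𝔼 J' : Fin n → P,
        Φ (fun k => if e k then J k else J' k) (fun k => if e k then J' k else J k) := by
  let swap : (Fin n → P) × (Fin n → P) → (Fin n → P) × (Fin n → P) := fun q =>
    (fun k => if e k then q.1 k else q.2 k, fun k => if e k then q.2 k else q.1 k)
  have swap_involutive : Function.Involutive swap := by
    intro q
    refine Prod.ext (funext fun k => ?_) (funext fun k => ?_) <;>
      by_cases h : e k <;> simp [swap, h]
  rw [← Finset.expect_product', ← Finset.expect_product', Finset.univ_product_univ]
  exact (Fintype.expect_equiv swap_involutive.toPerm _ (fun q => Φ q.1 q.2) fun _ => rfl).symm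

theorem expect_comp_not (F : (Fin n → Bool) → ℝ) :
    𝔼 e : Fin n → Bool, F (fun k => !e k) = 𝔼 e, F e :=
  Fintype.expect_equiv (Equiv.arrowCongr (Equiv.refl (Fin n)) Equiv.boolNot) _ _ fun _ => rfl

theorem expect_exp_iSup_sub_le_rademacher [Nonempty P] (f : ι → P → ℝ) :
    𝔼 J : Fin n → P, Real.exp (⨆ i, (n * 𝔼 p, f i p - ∑ k, f i (J k))) ≤
      𝔼 J : Fin n → P, 𝔼 e : Fin n → Bool, Real.exp (⨆ i, ∑ k, sgn (e k) * (2 * f i (J k))) := by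
  set Z := 𝔼 J : Fin n → P, 𝔼 J' : Fin n → P, Real.exp (⨆ i, ∑ k, (f i (J' k) - f i (J k)))
  set R : (Fin n → Bool) → ℝ := fun e =>
    𝔼 J : Fin n → P, Real.exp (⨆ i, ∑ k, sgn (e k) * (2 * f i (J k)))
  have le_Z : 𝔼 J : Fin n → P, Real.exp (⨆ i, (n * 𝔼 p, f i p - ∑ k, f i (J k))) ≤ Z := by
    refine Finset.expect_le_expect fun J _ => ?_
    simpa only [expect_sum_sub_apply] using
      exp_iSup_expect_le fun i (J' : Fin n → P) => ∑ k, (f i (J' k) - f i (J k))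
  have Z_le : ∀ e, Z ≤ (R e + R fun k => !e k) / 2 := by
    intro e
    calc Z = _ := expect_expect_swap e _
      _ ≤ _ := Finset.expect_le_expect fun J _ => Finset.expect_le_expect fun J' _ =>
        exp_iSup_sum_swap_sub_le f e J J'
      _ = (R e + R fun k => !e k) / 2 := by
        simp only [← Finset.expect_div, Finset.expect_add_distrib, Fintype.expect_const, R]
  calc _ ≤ Z := le_Z
    _ = 𝔼 _e : Fin n → Bool, Z := (Fintype.expect_const Z).symm
    _ ≤ 𝔼 e, (R e + R fun k => !e k) / 2 := Finset.expect_le_expect fun e _ => Z_le e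
    _ = 𝔼 e, R e := by
      rw [← Finset.expect_div, Finset.expect_add_distrib, expect_comp_not R]
      ring
    _ = _ := Finset.expect_comm _ _ _

end Symmetrization

end FiniteSuprema

end QMC

/-! ### Restricted convexity of the sampling operator -/

namespace QMC

open Matrix NormedSpace
open scoped BigOperators Matrix.Norms.L2Operator

variable {d n : ℕ}

theorem cosh_sub_one_le_sq {x : ℝ} (hx : |x| ≤ 1) : Real.cosh x - 1 ≤ x ^ 2 := by
  have exp_le := (abs_le.1 (Real.abs_exp_sub_one_sub_id_le hx)).2
  have exp_neg_le := (abs_le.1 (Real.abs_exp_sub_one_sub_id_le (x := -x) (by rwa [abs_neg]))).2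
  rw [Real.cosh_eq]
  linarith [neg_sq x]

theorem expect_design_sq [NeZero d] (x y : Fin d → ℝ) :
    𝔼 p : Fin d × Fin d, (x p.1 ^ 2 + y p.2 ^ 2) = (x ⬝ᵥ x + y ⬝ᵥ y) / d := by
  rw [Finset.expect_add_distrib, ← Finset.univ_product_univ,
    Finset.expect_product' _ _ fun i _ => x i ^ 2, Finset.expect_product' _ _ fun _ j => y j ^ 2,
    Fintype.expect_const]
  simp only [Fintype.expect_const]
  simp only [Fintype.expect_eq_sum_div_card, Fintype.card_fin, dotProduct, sq, add_div]

theorem expect_dotProduct_exp_rademacher_le [NeZero d] {κ : ℝ} (hκ : |κ| ≤ 1)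
    (v : Fin d ⊕ Fin d → ℝ) :
    𝔼 z : (Fin d × Fin d) × Bool, v ⬝ᵥ exp ((κ * sgn z.2) • dilation (design z.1)) *ᵥ v ≤
      Real.exp (κ ^ 2 / d) * (v ⬝ᵥ v) := by
  obtain ⟨x, y, rfl⟩ : ∃ x y, v = Sum.elim x y := ⟨_, _, (Sum.elim_comp_inl_inr v).symm⟩
  rw [← Finset.univ_product_univ, Finset.expect_product]
  simp only [dotProduct_exp_smul_dilation_design, sumElim_dotProduct_sumElim, expect_bool,
    sgn_true, sgn_false, mul_one, mul_neg, Real.cosh_neg, Real.sinh_neg]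
  set s := x ⬝ᵥ x + y ⬝ᵥ y
  have hs : 0 ≤ s := add_nonneg (dotProduct_self_nonneg x) (dotProduct_self_nonneg y)
  calc _ = 𝔼 p : Fin d × Fin d, (s + (Real.cosh κ - 1) * (x p.1 ^ 2 + y p.2 ^ 2)) :=
        Finset.expect_congr rfl fun p _ => by ring
    _ = (1 + (Real.cosh κ - 1) / d) * s := by
      rw [Finset.expect_add_distrib, ← Finset.mul_expect, expect_design_sq, Fintype.expect_const]
      ring
    _ ≤ (κ ^ 2 / d + 1) * s := by
      rw [add_comm]
      gcongr
      exact cosh_sub_one_le_sq hκ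
    _ ≤ Real.exp (κ ^ 2 / d) * s := by
      gcongr
      exact Real.add_one_le_exp _

theorem expect_trace_exp_rademacher_le [NeZero d] {κ : ℝ} (hκ : |κ| ≤ 1) :
    𝔼 J : Fin n → Fin d × Fin d, 𝔼 e : Fin n → Bool,
      (exp (dilation (∑ k, (κ * sgn (e k)) • design (J k)))).trace ≤
      2 * d * Real.exp (n * κ ^ 2 / d) := by
  have h := expect_trace_exp_sum_le
    (fun z : (Fin d × Fin d) × Bool => (isSymm_dilation (design z.1)).smul (κ * sgn z.2))
    (Real.exp_pos _).le (expect_dotProduct_exp_rademacher_le hκ) n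
  rw [← Fintype.expect_equiv (Equiv.arrowProdEquivProdArrow (Fin n) (fun _ => Fin d × Fin d)
    fun _ => Bool).symm _ _ fun _ => rfl, ← Finset.univ_product_univ, Finset.expect_product,
    ← Real.exp_nat_mul, mul_comm, Fintype.card_sum, Fintype.card_fin, Nat.cast_add, ← two_mul,
    ← mul_div_assoc] at h
  simpa only [dilation_sum, dilation_smul, Equiv.arrowProdEquivProdArrow_symm_apply] using h

/-- How far the empirical quadratic form of `D` at the positions `J` falls short of its mean. -/
noncomputable def samplingDeficit (J : Fin n → Fin d × Fin d) (D : Matrix (Fin d) (Fin d) ℝ) : ℝ :=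
  n * (frobNorm D ^ 2 / (d : ℝ) ^ 2) - ∑ k, D (J k).1 (J k).2 ^ 2

theorem mul_expect_sub_sum_eq_mul_samplingDeficit (θ : ℝ) (J : Fin n → Fin d × Fin d)
    (D : Matrix (Fin d) (Fin d) ℝ) :
    n * 𝔼 p : Fin d × Fin d, θ * D p.1 p.2 ^ 2 - ∑ k, θ * D (J k).1 (J k).2 ^ 2 =
      θ * samplingDeficit J D := by
  rw [samplingDeficit, frobNorm_sq, matInner_eq_sum, ← Finset.mul_expect, ← Finset.mul_sum,
    Fintype.expect_eq_sum_div_card, Fintype.sum_prod_type, Fintype.card_prod, Fintype.card_fin]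
  push_cast
  simp only [sq]
  ring

theorem abs_sq_sub_sq_le {a x y : ℝ} (hx : |x| ≤ a) (hy : |y| ≤ a) :
    |x ^ 2 - y ^ 2| ≤ |2 * a * x - 2 * a * y| := by
  have ha : 0 ≤ a := (abs_nonneg x).trans hx
  rw [sq_sub_sq, ← mul_sub, abs_mul, abs_mul, abs_of_nonneg (mul_nonneg zero_le_two ha)]
  exact mul_le_mul_of_nonneg_right ((abs_add_le x y).trans (by linarith)) (abs_nonneg _)

theorem exp_iSup_rademacher_le [NeZero d] {ι : Type*} [Nonempty ι] {a ρ κ : ℝ} (ha : 0 < a)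
    (hρ : 0 < ρ) {D : ι → Matrix (Fin d) (Fin d) ℝ}
    (hDρ : ∀ i, nuclearNorm (D i) ≤ ρ) (J : Fin n → Fin d × Fin d) (e : Fin n → Bool) :
    Real.exp (⨆ i, ∑ k, sgn (e k) * (4 * a * (κ / (4 * a * ρ)) * D i (J k).1 (J k).2)) ≤
      (exp (dilation (∑ k, (κ * sgn (e k)) • design (J k)))).trace := by
  set M : Matrix (Fin d) (Fin d) ℝ := ∑ k, (κ * sgn (e k)) • design (J k)
  rw [← Real.le_log_iff_exp_le (trace_exp_pos (isSymm_dilation M))]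
  refine (ciSup_le fun i => ?_ : _ ≤ ‖M‖).trans (l2_opNorm_le_log_trace_exp_dilation M)
  have inner_eq : matInner M (D i) =
      ρ * ∑ k, sgn (e k) * (4 * a * (κ / (4 * a * ρ)) * D i (J k).1 (J k).2) := by
    rw [matInner_sum_left, Finset.mul_sum]
    refine Finset.sum_congr rfl fun k _ => ?_
    rw [matInner_smul_left, matInner_design]
    field_simp
  refine le_of_mul_le_mul_left ?_ hρ
  rw [← inner_eq, mul_comm]
  exact (matInner_le_l2_opNorm_mul_nuclearNorm M (D i)).trans
    (mul_le_mul_of_nonneg_left (hDρ i) (norm_nonneg M))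

section Class

variable {ι : Type*} [Finite ι] [Nonempty ι] {a ρ : ℝ} {D : ι → Matrix (Fin d) (Fin d) ℝ}

theorem expect_exp_iSup_sq_contraction {θ : ℝ} (ha : 0 ≤ a)
    (hDa : ∀ i p q, |D i p q| ≤ a) (J : Fin n → Fin d × Fin d) :
    𝔼 e : Fin n → Bool,
      Real.exp (⨆ i, ∑ k, sgn (e k) * (2 * (θ * D i (J k).1 (J k).2 ^ 2))) ≤
    𝔼 e : Fin n → Bool,
      Real.exp (⨆ i, ∑ k, sgn (e k) * (4 * a * θ * D i (J k).1 (J k).2)) := by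
  have abs_sub_le : ∀ {x y : ℝ}, |x| ≤ a → |y| ≤ a →
      |2 * (θ * x ^ 2) - 2 * (θ * y ^ 2)| ≤ |4 * a * θ * x - 4 * a * θ * y| := by
    intro x y hx hy
    have h := mul_le_mul_of_nonneg_left (abs_sq_sub_sq_le hx hy) (abs_nonneg (2 * θ))
    rw [← abs_mul, ← abs_mul] at h
    exact (congrArg abs (by ring)).trans_le (h.trans_eq (congrArg abs (by ring)))
  have h := expect_exp_iSup_contraction (fun _ : ι => 0)
    (fun k i => 2 * (θ * D i (J k).1 (J k).2 ^ 2)) (fun k i => 4 * a * θ * D i (J k).1 (J k).2)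
    (fun k i j => abs_sub_le (hDa i _ _) (hDa j _ _)) fun k i => by
      simpa using abs_sub_le (hDa i (J k).1 (J k).2) (y := 0) (by simpa using ha)
  simpa only [zero_add] using h

theorem expect_exp_iSup_samplingDeficit_le [NeZero d] {κ : ℝ} (ha : 0 < a) (hρ : 0 < ρ)
    (hκ0 : 0 ≤ κ) (hκ : κ ≤ 1) (hDa : ∀ i p q, |D i p q| ≤ a)
    (hDρ : ∀ i, nuclearNorm (D i) ≤ ρ) :
    𝔼 J : Fin n → Fin d × Fin d,
      Real.exp (⨆ i, κ / (4 * a * ρ) * samplingDeficit J (D i)) ≤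
      2 * d * Real.exp (n * κ ^ 2 / d) := by
  have symmetrize := expect_exp_iSup_sub_le_rademacher (n := n)
    fun (i : ι) (p : Fin d × Fin d) => κ / (4 * a * ρ) * D i p.1 p.2 ^ 2
  simp only [mul_expect_sub_sum_eq_mul_samplingDeficit] at symmetrize
  refine symmetrize.trans (le_trans (Finset.expect_le_expect fun J _ => ?_)
    (expect_trace_exp_rademacher_le (by rwa [abs_of_nonneg hκ0])))
  exact (expect_exp_iSup_sq_contraction ha.le hDa J).trans
    (Finset.expect_le_expect fun e _ => exp_iSup_rademacher_le ha hρ hDρ J e)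

end Class

/-- The sample positions at which restricted convexity fails by `u`: some matrix with entries
bounded by `a` and nuclear norm at most `ρ` has deficit at least `u`. -/
def convexityFailures (d n : ℕ) (a ρ u : ℝ) : Set (Fin n → Fin d × Fin d) :=
  {J | ∃ D : Matrix (Fin d) (Fin d) ℝ, (∀ p q, |D p q| ≤ a) ∧ nuclearNorm D ≤ ρ ∧
    u ≤ samplingDeficit J D}

theorem expect_indicator_convexityFailures_le [NeZero d] {a ρ κ : ℝ} (ha : 0 < a) (hρ : 0 < ρ)
    (hκ0 : 0 ≤ κ) (hκ : κ ≤ 1) (u : ℝ) :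
    𝔼 J : Fin n → Fin d × Fin d, (convexityFailures d n a ρ u).indicator 1 J ≤
      2 * d * Real.exp (n * κ ^ 2 / d - κ / (4 * a * ρ) * u) := by
  have exists_maximal_violation : ∀ J : Fin n → Fin d × Fin d, ∃ D : Matrix (Fin d) (Fin d) ℝ,
      (∀ p q, |D p q| ≤ a) ∧ nuclearNorm D ≤ ρ ∧
      (J ∈ convexityFailures d n a ρ u → u ≤ samplingDeficit J D) := by
    intro J
    by_cases hJ : J ∈ convexityFailures d n a ρ u
    · obtain ⟨D, hDa, hDρ, hu⟩ := hJ
      exact ⟨D, hDa, hDρ, fun _ => hu⟩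
    · exact ⟨0, by simpa using ha.le, by simpa [nuclearNorm_zero] using hρ.le, fun h => absurd h hJ⟩
  choose D hDa hDρ hu using exists_maximal_violation
  set θ := κ / (4 * a * ρ)
  have hθ : 0 ≤ θ := by positivity
  have indicator_le : ∀ J, (convexityFailures d n a ρ u).indicator 1 J ≤
      Real.exp (⨆ J', θ * samplingDeficit J (D J')) * Real.exp (-(θ * u)) := by
    intro J
    by_cases hJ : J ∈ convexityFailures d n a ρ u
    · rw [Set.indicator_of_mem hJ, Pi.one_apply, ← Real.exp_add, Real.one_le_exp_iff]
      have h := Finite.le_ciSup (fun J' => θ * samplingDeficit J (D J')) J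
      linarith [mul_le_mul_of_nonneg_left (hu J hJ) hθ]
    · rw [Set.indicator_of_notMem hJ]
      positivity
  refine (Finset.expect_le_expect fun J _ => indicator_le J).trans ?_
  rw [← Finset.expect_mul, sub_eq_add_neg, Real.exp_add, ← mul_assoc]
  gcongr
  exact expect_exp_iSup_samplingDeficit_le ha hρ hκ0 hκ hDa hDρ

section Probability

variable {Ω : Type*} [MeasurableSpace Ω] {μ : Measure Ω} [IsProbabilityMeasure μ] {σ Δ : ℝ}
  {J : Fin n → Ω → Fin d × Fin d} {ε τ : Fin n → Ω → ℝ}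

theorem IsModel.measure_positions_eq [NeZero d] (h : IsModel μ σ Δ J ε τ)
    (B : Set (Fin n → Fin d × Fin d)) :
    μ {ω | (fun k => J k ω) ∈ B} = ENNReal.ofReal (𝔼 j, B.indicator 1 j) := by
  have indep : iIndepFun J μ := h.indep_samples.comp (fun _ z => z.1) fun _ => measurable_fst
  have ae_meas : ∀ k, AEMeasurable (J k) μ := fun k => (h.position_law k).aemeasurable
  have law : μ.map (fun ω k => J k ω) = Measure.pi fun _ => uniformOn univ := by
    rw [(iIndepFun_iff_map_fun_eq_pi_map ae_meas).1 indep]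
    simp only [(h.position_law _).map_eq]
  have hd : (0 : ℝ) < d := Nat.cast_pos.2 (NeZero.pos d)
  calc μ {ω | (fun k => J k ω) ∈ B}
      = ∫⁻ j, B.indicator 1 j ∂Measure.pi fun _ : Fin n => uniformOn univ := by
        rw [lintegral_indicator_one .of_discrete, ← law,
          Measure.map_apply_of_aemeasurable (aemeasurable_pi_lambda _ ae_meas) .of_discrete]
        rfl
    _ = ∑ j, B.indicator 1 j * (((d : ℝ≥0∞) ^ 2) ^ n)⁻¹ := by
      simp [lintegral_fintype, Measure.pi_singleton, uniformOn_univ, sq, ENNReal.inv_pow]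
    _ = ENNReal.ofReal (𝔼 j, B.indicator 1 j) := by
      rw [Fintype.expect_eq_sum_div_card, ENNReal.ofReal_div_of_pos (by positivity),
        ENNReal.ofReal_sum_of_nonneg, div_eq_mul_inv, Finset.sum_mul]
      · refine Finset.sum_congr rfl fun j _ => ?_
        by_cases hj : j ∈ B <;>
        simp [hj, sq, ENNReal.ofReal_pow (mul_nonneg hd.le hd.le),
          ENNReal.ofReal_mul hd.le]
      · exact fun j _ => Set.indicator_nonneg (fun _ _ => zero_le_one) j

end Probability

end QMC

/-! ### Dithered quantization -/

namespace QMC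

theorem measurable_quantize (Δ : ℝ) : Measurable (quantize Δ) := by
  unfold quantize
  split_ifs
  · exact measurable_id
  · fun_prop

theorem abs_quantize_sub_le {Δ : ℝ} (hΔ : 0 ≤ Δ) (a : ℝ) : |quantize Δ a - a| ≤ Δ / 2 := by
  rcases hΔ.eq_or_lt with rfl | hpos
  · simp [quantize]
  · have floor_le := (le_div_iff₀ hpos).1 (Int.floor_le (a / Δ))
    have lt_floor := (div_lt_iff₀ hpos).1 (Int.lt_floor_add_one (a / Δ))
    rw [quantize, if_neg hpos.ne', abs_le]
    constructor <;> linarith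

theorem ae_abs_le_uniformDither (Δ : ℝ) : ∀ᵐ t ∂uniformDither Δ, |t| ≤ Δ / 2 := by
  unfold uniformDither
  split_ifs with h
  · rw [ae_dirac_iff (measurableSet_le (by fun_prop) (by fun_prop))]
    simp [h]
  · refine Measure.ae_smul_measure ?_ _
    filter_upwards [ae_restrict_mem measurableSet_Icc] with t ht
    exact abs_le.2 ht

theorem ae_abs_quantize_add_sub_le {Δ : ℝ} (hΔ : 0 ≤ Δ) :
    ∀ᵐ t ∂uniformDither Δ, ∀ a, |quantize Δ (a + t) - a| ≤ Δ := by
  filter_upwards [ae_abs_le_uniformDither Δ] with t ht a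
  calc |quantize Δ (a + t) - a| = |(quantize Δ (a + t) - (a + t)) + t| := by ring_nf
    _ ≤ Δ / 2 + Δ / 2 := (abs_add_le _ _).trans (add_le_add (abs_quantize_sub_le hΔ _) ht)
    _ = Δ := add_halves Δ

theorem intervalIntegrable_fract (a b : ℝ) : IntervalIntegrable Int.fract volume a b := by
  have floor_mono : Monotone fun u : ℝ => (⌊u⌋ : ℝ) := fun x y hxy =>
    Int.cast_le.2 (Int.floor_mono hxy)
  exact intervalIntegral.intervalIntegrable_id.sub floor_mono.intervalIntegrable

theorem intervalIntegral_fract (a : ℝ) : ∫ u in a..a + 1, Int.fract u = 1 / 2 := by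
  have periodic : Function.Periodic (Int.fract : ℝ → ℝ) 1 := Int.fract_add_one
  calc ∫ u in a..a + 1, Int.fract u = ∫ u in Ioo (0 : ℝ) 1, Int.fract u := by
        rw [periodic.intervalIntegral_add_eq a 0, zero_add,
          intervalIntegral.integral_of_le zero_le_one, integral_Ioc_eq_integral_Ioo]
    _ = ∫ u in Ioo (0 : ℝ) 1, u :=
        setIntegral_congr_fun measurableSet_Ioo fun u hu => Int.fract_eq_self.2 ⟨hu.1.le, hu.2⟩
    _ = 1 / 2 := by
        rw [← integral_Ioc_eq_integral_Ioo, ← intervalIntegral.integral_of_le zero_le_one,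
          integral_id]
        norm_num

theorem intervalIntegral_floor_add_half (c : ℝ) :
    ∫ u in (c - 1 / 2)..(c + 1 / 2), ((⌊u⌋ : ℝ) + 1 / 2) = c := by
  have fract_integral := intervalIntegral_fract (c - 1 / 2)
  rw [show c - 1 / 2 + 1 = c + 1 / 2 by ring] at fract_integral
  have floor_eq : ∀ u : ℝ, (⌊u⌋ : ℝ) + 1 / 2 = u + 1 / 2 - Int.fract u := fun u => by
    rw [← Int.self_sub_fract]
    ring
  simp only [floor_eq]
  rw [intervalIntegral.integral_sub (Continuous.intervalIntegrable (by fun_prop) _ _)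
    (intervalIntegrable_fract _ _), fract_integral, intervalIntegral.integral_add
    intervalIntegral.intervalIntegrable_id intervalIntegrable_const, integral_id,
    intervalIntegral.integral_const, smul_eq_mul]
  ring

theorem integral_quantize_add {Δ : ℝ} (hΔ : 0 ≤ Δ) (a : ℝ) :
    ∫ t, quantize Δ (a + t) ∂uniformDither Δ = a := by
  rcases hΔ.eq_or_lt with rfl | hpos
  · simp [uniformDither, quantize]
  have quantize_eq : ∀ t, quantize Δ (a + t) =
      (fun u : ℝ => Δ * ((⌊u⌋ : ℝ) + 1 / 2)) (a / Δ + t / Δ) := fun t => by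
    rw [quantize, if_neg hpos.ne', add_div]
  have interval_integral : ∫ t in -(Δ / 2)..Δ / 2, quantize Δ (a + t) = Δ * a := by
    simp only [quantize_eq]
    rw [intervalIntegral.integral_comp_add_div (fun u : ℝ => Δ * ((⌊u⌋ : ℝ) + 1 / 2)) hpos.ne',
      intervalIntegral.integral_const_mul,
      show a / Δ + -(Δ / 2) / Δ = a / Δ - 1 / 2 by field_simp; ring,
      show a / Δ + Δ / 2 / Δ = a / Δ + 1 / 2 by field_simp, intervalIntegral_floor_add_half,
      smul_eq_mul]
    field_simp
  rw [uniformDither, if_neg hpos.ne', ProbabilityTheory.cond, integral_smul_measure,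
    integral_Icc_eq_integral_Ioc, ← intervalIntegral.integral_of_le (by linarith),
    interval_integral, Real.volume_Icc, sub_neg_eq_add, add_halves, ENNReal.toReal_inv,
    ENNReal.toReal_ofReal hΔ, smul_eq_mul, inv_mul_cancel_left₀ hpos.ne']

section Independent

variable {Ω : Type*} [MeasurableSpace Ω] {μ : Measure Ω} {Δ : ℝ}

theorem integrable_quantize_add_sub_mul {T a g : Ω → ℝ} (hΔ : 0 ≤ Δ)
    (hT : HasLaw T (uniformDither Δ) μ) (ha : AEMeasurable a μ) (hg : Integrable g μ) :
    Integrable (fun ω => (quantize Δ (a ω + T ω) - a ω) * g ω) μ := by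
  have measurable_error : AEMeasurable (fun ω => quantize Δ (a ω + T ω) - a ω) μ :=
    ((measurable_quantize Δ).comp_aemeasurable (ha.add hT.aemeasurable)).sub ha
  refine hg.bdd_mul (c := Δ) measurable_error.aestronglyMeasurable ?_
  filter_upwards [ae_of_ae_map hT.aemeasurable (hT.map_eq ▸ ae_abs_quantize_add_sub_le hΔ)]
    with ω hω
  exact hω (a ω)

theorem integral_quantize_add_sub_mul [IsProbabilityMeasure μ] {α : Type*} [MeasurableSpace α]
    {X : Ω → α} {T : Ω → ℝ} {a g : α → ℝ} (hΔ : 0 ≤ Δ) (hX : AEMeasurable X μ)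
    (hT : HasLaw T (uniformDither Δ) μ) (hindep : IndepFun X T μ) (ha : Measurable a)
    (hg : Measurable g) (hgX : Integrable (fun ω => g (X ω)) μ) :
    ∫ ω, (quantize Δ (a (X ω) + T ω) - a (X ω)) * g (X ω) ∂μ = 0 := by
  have : IsProbabilityMeasure (uniformDither Δ) := hT.isProbabilityMeasure_iff.1 inferInstance
  have law : μ.map (fun ω => (X ω, T ω)) = (μ.map X).prod (uniformDither Δ) := by
    rw [(indepFun_iff_map_prod_eq_prod_map_map hX hT.aemeasurable).1 hindep, hT.map_eq]
  set Φ : α × ℝ → ℝ := fun q => (quantize Δ (a q.1 + q.2) - a q.1) * g q.1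
  have Φ_measurable : Measurable Φ :=
    (((measurable_quantize Δ).comp (by fun_prop)).sub (by fun_prop)).mul (by fun_prop)
  have Φ_integrable : Integrable Φ (μ.map fun ω => (X ω, T ω)) :=
    (integrable_map_measure Φ_measurable.aestronglyMeasurable (hX.prodMk hT.aemeasurable)).2
      (integrable_quantize_add_sub_mul hΔ hT (ha.comp_aemeasurable hX) hgX)
  have mean_error : ∀ b, ∫ t, (quantize Δ (b + t) - b) ∂uniformDither Δ = 0 := fun b => by
    have error_integrable : Integrable (fun t => quantize Δ (b + t) - b) (uniformDither Δ) := by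
      simpa using integrable_quantize_add_sub_mul (a := fun _ => b) hΔ
        (HasLaw.id (μ := uniformDither Δ)) aemeasurable_const (integrable_const (1 : ℝ))
    have quantize_integrable : Integrable (fun t => quantize Δ (b + t)) (uniformDither Δ) := by
      simpa only [Pi.add_def, sub_add_cancel] using error_integrable.add (integrable_const b)
    rw [integral_sub quantize_integrable (integrable_const b), integral_quantize_add hΔ]
    simp
  calc ∫ ω, Φ (X ω, T ω) ∂μ = ∫ q, Φ q ∂(μ.map fun ω => (X ω, T ω)) :=
        (integral_map (hX.prodMk hT.aemeasurable) Φ_measurable.aestronglyMeasurable).symm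
    _ = ∫ x, (∫ t, (quantize Δ (a x + t) - a x) ∂uniformDither Δ) * g x ∂(μ.map X) := by
        rw [law, integral_prod _ (law ▸ Φ_integrable)]
        simp only [Φ, integral_mul_const]
    _ = 0 := by simp [mean_error]

end Independent

/-! ### Moments of the noise -/

section SubExponential

variable {Ω : Type*} [MeasurableSpace Ω] {μ : Measure Ω} {Z : Ω → ℝ} {σ s : ℝ}

theorem lintegral_exp_le_two_of_psi1Norm_lt (h : psi1Norm μ Z < ENNReal.ofReal s) :
    ∫⁻ ω, ENNReal.ofReal (Real.exp (|Z ω| / s)) ∂μ ≤ 2 := by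
  simp only [psi1Norm, iInf_lt_iff] at h
  obtain ⟨t, ⟨ht, lintegral_le⟩, hts⟩ := h
  have hts' : t < s := lt_of_not_ge fun hst => hts.not_ge (ENNReal.ofReal_le_ofReal hst)
  refine (lintegral_mono fun ω => ENNReal.ofReal_le_ofReal ?_).trans lintegral_le
  gcongr

theorem aemeasurable_exp_abs_div (hZ : AEMeasurable Z μ) (s : ℝ) :
    AEMeasurable (fun ω => Real.exp (|Z ω| / s)) μ :=
  Real.measurable_exp.comp_aemeasurable ((measurable_norm.comp_aemeasurable hZ).div_const s)

theorem integrable_exp_of_psi1Norm_lt (hZ : AEMeasurable Z μ)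
    (h : psi1Norm μ Z < ENNReal.ofReal s) : Integrable (fun ω => Real.exp (|Z ω| / s)) μ := by
  rw [← lintegral_ofReal_ne_top_iff_integrable (aemeasurable_exp_abs_div hZ s).aestronglyMeasurable
    (.of_forall fun ω => (Real.exp_pos _).le)]
  exact ne_top_of_le_ne_top ENNReal.ofNat_ne_top (lintegral_exp_le_two_of_psi1Norm_lt h)

theorem integral_exp_le_two_of_psi1Norm_lt (hZ : AEMeasurable Z μ)
    (h : psi1Norm μ Z < ENNReal.ofReal s) : ∫ ω, Real.exp (|Z ω| / s) ∂μ ≤ 2 := by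
  rw [integral_eq_lintegral_of_nonneg_ae (.of_forall fun ω => (Real.exp_pos _).le)
    (aemeasurable_exp_abs_div hZ s).aestronglyMeasurable]
  exact (ENNReal.toReal_mono ENNReal.ofNat_ne_top
    (lintegral_exp_le_two_of_psi1Norm_lt h)).trans (by simp)

theorem integrable_of_integrable_exp_abs_div (hZ : AEMeasurable Z μ) (hs : 0 < s)
    (h : Integrable (fun ω => Real.exp (|Z ω| / s)) μ) : Integrable Z μ := by
  refine (h.const_mul s).mono' hZ.aestronglyMeasurable (.of_forall fun ω => ?_)
  have abs_div_le : |Z ω| / s ≤ Real.exp (|Z ω| / s) := by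
    linarith [Real.add_one_le_exp (|Z ω| / s)]
  rwa [div_le_iff₀' hs] at abs_div_le

theorem integrable_of_psi1Norm_le (hZ : AEMeasurable Z μ) (h : psi1Norm μ Z ≤ ENNReal.ofReal σ) :
    Integrable Z μ := by
  have hσ : 0 < |σ| + 1 := by positivity
  exact integrable_of_integrable_exp_abs_div hZ hσ <| integrable_exp_of_psi1Norm_lt hZ <|
    h.trans_lt <| (ENNReal.ofReal_lt_ofReal_iff hσ).2 (by linarith [le_abs_self σ])

end SubExponential

theorem exp_sub_one_sub_le {c : ℝ} (hc : 0 ≤ c) : Real.exp c - 1 - c ≤ c ^ 2 * Real.exp c := by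
  have exp_sub_one_le : Real.exp c - 1 ≤ c * Real.exp c := by
    have h := mul_le_mul_of_nonneg_right (Real.add_one_le_exp (-c)) (Real.exp_pos c).le
    rw [← Real.exp_add, neg_add_cancel, Real.exp_zero] at h
    linarith
  nlinarith [mul_le_mul_of_nonneg_left exp_sub_one_le hc]

theorem cosh_sub_one_add_abs_sinh_sub_le {κ : ℝ} (hκ0 : 0 ≤ κ) (hκ : κ ≤ 1 / 2) (z : ℝ) :
    Real.cosh (κ * z) - 1 + |Real.sinh (κ * z) - κ * z| ≤ 8 * κ ^ 2 * Real.exp |z| := by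
  wlog hz : 0 ≤ z generalizing z
  · have := this (-z) (by linarith)
    rw [mul_neg, Real.cosh_neg, Real.sinh_neg, abs_neg] at this
    rwa [show -Real.sinh (κ * z) - -(κ * z) = -(Real.sinh (κ * z) - κ * z) by ring, abs_neg] at this
  have self_le_sinh : κ * z ≤ Real.sinh (κ * z) := Real.self_le_sinh_iff.2 (by positivity)
  have sq_le : (z / 2) ^ 2 / 2 ≤ Real.exp (z / 2) := by
    linarith [Real.quadratic_le_exp_of_nonneg (x := z / 2) (by linarith)]
  rw [abs_of_nonneg (by linarith), abs_of_nonneg hz]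
  calc Real.cosh (κ * z) - 1 + (Real.sinh (κ * z) - κ * z) = Real.exp (κ * z) - 1 - κ * z := by
        rw [← Real.cosh_add_sinh]
        ring
    _ ≤ (κ * z) ^ 2 * Real.exp (κ * z) := exp_sub_one_sub_le (by positivity)
    _ ≤ (κ * z) ^ 2 * Real.exp (z / 2) := by
        gcongr
        nlinarith
    _ = 8 * κ ^ 2 * ((z / 2) ^ 2 / 2 * Real.exp (z / 2)) := by ring
    _ ≤ 8 * κ ^ 2 * (Real.exp (z / 2) * Real.exp (z / 2)) := by gcongr
    _ = 8 * κ ^ 2 * Real.exp z := by rw [← Real.exp_add, add_halves]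

section Sample

open scoped BigOperators

variable {d n : ℕ}

/-- The deviation of the observation of one sample from the entry of `Θ` it observes, as a function
of the position, the noise and the dither of that sample. -/
noncomputable def noiseTerm (Δ : ℝ) (Θ : Matrix (Fin d) (Fin d) ℝ)
    (z : (Fin d × Fin d) × ℝ × ℝ) : ℝ :=
  quantizedObs Δ Θ z.1 z.2.1 z.2.2 - Θ z.1.1 z.1.2

theorem noiseTerm_eq (Δ : ℝ) (Θ : Matrix (Fin d) (Fin d) ℝ) (p : Fin d × Fin d) (e t : ℝ) :
    noiseTerm Δ Θ (p, e, t) =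
      e + (quantize Δ (Θ p.1 p.2 + e + t) - (Θ p.1 p.2 + e)) := by
  rw [noiseTerm, quantizedObs, matInner_design]
  ring

theorem measurable_noiseTerm (Δ : ℝ) (Θ : Matrix (Fin d) (Fin d) ℝ) :
    Measurable (noiseTerm Δ Θ) := by
  have entry : Measurable fun z : (Fin d × Fin d) × ℝ × ℝ => Θ z.1.1 z.1.2 :=
    (Measurable.of_discrete (f := fun p : Fin d × Fin d => Θ p.1 p.2)).comp measurable_fst
  unfold noiseTerm quantizedObs
  simp only [matInner_design]
  exact ((measurable_quantize Δ).comp ((entry.add measurable_snd.fst).add measurable_snd.snd)).sub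
    entry

variable {Ω : Type*} [MeasurableSpace Ω] {μ : Measure Ω} {σ Δ s : ℝ}
  {J : Fin n → Ω → Fin d × Fin d} {ε τ : Fin n → Ω → ℝ}

namespace IsModel

theorem aemeasurable_noise (h : IsModel μ σ Δ J ε τ) (k : Fin n) : AEMeasurable (ε k) μ :=
  (h.noise_identDistrib k k).aemeasurable_fst

theorem aemeasurable_sample (h : IsModel μ σ Δ J ε τ) (k : Fin n) :
    AEMeasurable (fun ω => (J k ω, ε k ω, τ k ω)) μ :=
  (h.position_law k).aemeasurable.prodMk
    ((h.aemeasurable_noise k).prodMk (h.dither_law k).aemeasurable)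

theorem aemeasurable_noiseTerm (h : IsModel μ σ Δ J ε τ) (Θ : Matrix (Fin d) (Fin d) ℝ)
    (k : Fin n) : AEMeasurable (fun ω => noiseTerm Δ Θ (J k ω, ε k ω, τ k ω)) μ :=
  (measurable_noiseTerm Δ Θ).comp_aemeasurable (h.aemeasurable_sample k)

theorem integral_position [IsProbabilityMeasure μ] (h : IsModel μ σ Δ J ε τ) (k : Fin n)
    (g : Fin d × Fin d → ℝ) : ∫ ω, g (J k ω) ∂μ = 𝔼 p, g p := by
  have : IsProbabilityMeasure (uniformOn (Set.univ : Set (Fin d × Fin d))) :=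
    (h.position_law k).isProbabilityMeasure_iff.1 inferInstance
  calc ∫ ω, g (J k ω) ∂μ = ∫ p, g p ∂uniformOn univ :=
        (h.position_law k).integral_comp (Measurable.of_discrete (f := g)).aestronglyMeasurable
    _ = 𝔼 p, g p := by
      rw [integral_fintype Integrable.of_finite, Fintype.expect_eq_sum_div_card, Finset.sum_div]
      refine Finset.sum_congr rfl fun p _ => ?_
      rw [Measure.real, uniformOn_univ, Measure.count_singleton, smul_eq_mul, one_div,
        ENNReal.toReal_inv, ENNReal.toReal_natCast, inv_mul_eq_div]

theorem integrable_position [IsFiniteMeasure μ] (h : IsModel μ σ Δ J ε τ) (k : Fin n)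
    (g : Fin d × Fin d → ℝ) : Integrable (fun ω => g (J k ω)) μ :=
  have := Measure.isFiniteMeasure_map μ (J k)
  (Integrable.of_finite (f := g) (μ := μ.map (J k))).comp_aemeasurable
    (h.position_law k).aemeasurable

theorem integrable_mul_position [IsFiniteMeasure μ] (h : IsModel μ σ Δ J ε τ) {f : Ω → ℝ}
    (hf : Integrable f μ) (k : Fin n) (g : Fin d × Fin d → ℝ) :
    Integrable (fun ω => f ω * g (J k ω)) μ :=
  hf.mul_bdd (c := ∑ p, |g p|) (h.integrable_position k g).aestronglyMeasurable <|
    .of_forall fun _ => Finset.single_le_sum (f := fun p => |g p|) (fun _ _ => abs_nonneg _)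
      (Finset.mem_univ _)

theorem abs_noiseTerm_le (h : IsModel μ σ Δ J ε τ) (hΔ : 0 ≤ Δ)
    (Θ : Matrix (Fin d) (Fin d) ℝ) (k : Fin n) :
    ∀ᵐ ω ∂μ, |noiseTerm Δ Θ (J k ω, ε k ω, τ k ω)| ≤ |ε k ω| + Δ := by
  have hT := h.dither_law k
  filter_upwards [ae_of_ae_map hT.aemeasurable (hT.map_eq ▸ ae_abs_quantize_add_sub_le hΔ)]
    with ω hω
  rw [noiseTerm_eq]
  exact (abs_add_le _ _).trans (add_le_add_right (hω _) _)

/-- Each noise term is the sum of the noise, centered and independent of the position, and the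
quantization error, which the dither centers conditionally on everything else. -/
theorem integral_noiseTerm_mul_position [IsProbabilityMeasure μ] (h : IsModel μ σ Δ J ε τ)
    (hΔ : 0 ≤ Δ) (Θ : Matrix (Fin d) (Fin d) ℝ) (k : Fin n) (g : Fin d × Fin d → ℝ) :
    ∫ ω, noiseTerm Δ Θ (J k ω, ε k ω, τ k ω) * g (J k ω) ∂μ = 0 := by
  have g_measurable : Measurable g := .of_discrete
  have g_integrable := h.integrable_position k g
  have noise_integrable := integrable_of_psi1Norm_le (h.aemeasurable_noise k) (h.noise_psi1 k)
  have indep : IndepFun (ε k) (fun ω => g (J k ω)) μ :=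
    (h.indep_position_noise k).symm.comp measurable_id g_measurable
  have noise_eq_zero : ∫ ω, ε k ω * g (J k ω) ∂μ = 0 := by
    rw [indep.integral_fun_mul_eq_mul_integral noise_integrable.aestronglyMeasurable
      g_integrable.aestronglyMeasurable, h.noise_mean k, zero_mul]
  have entry : Measurable fun q : (Fin d × Fin d) × ℝ => Θ q.1.1 q.1.2 + q.2 :=
    ((Measurable.of_discrete (f := fun p : Fin d × Fin d => Θ p.1 p.2)).comp measurable_fst).add
      measurable_snd
  have pair : AEMeasurable (fun ω => (J k ω, ε k ω)) μ :=
    (h.position_law k).aemeasurable.prodMk (h.aemeasurable_noise k)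
  have error_eq_zero : ∫ ω, (quantize Δ (Θ (J k ω).1 (J k ω).2 + ε k ω + τ k ω) -
      (Θ (J k ω).1 (J k ω).2 + ε k ω)) * g (J k ω) ∂μ = 0 :=
    integral_quantize_add_sub_mul (X := fun ω => (J k ω, ε k ω))
      (a := fun q => Θ q.1.1 q.1.2 + q.2) (g := fun q => g q.1) hΔ pair (h.dither_law k)
      (h.indep_dither k) entry (g_measurable.comp measurable_fst) g_integrable
  have error_integrable : Integrable (fun ω => (quantize Δ (Θ (J k ω).1 (J k ω).2 + ε k ω + τ k ω) -
      (Θ (J k ω).1 (J k ω).2 + ε k ω)) * g (J k ω)) μ :=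
    integrable_quantize_add_sub_mul hΔ (h.dither_law k) (entry.comp_aemeasurable pair) g_integrable
  simp only [noiseTerm_eq, add_mul]
  rw [integral_add (h.integrable_mul_position noise_integrable k g) error_integrable,
    noise_eq_zero, error_eq_zero, zero_add]

theorem psi1Norm_noise_lt (h : IsModel μ σ Δ J ε τ) (hs : 0 < s) (hσs : σ < s) (k : Fin n) :
    psi1Norm μ (ε k) < ENNReal.ofReal s :=
  (h.noise_psi1 k).trans_lt ((ENNReal.ofReal_lt_ofReal_iff hs).2 hσs)

theorem exp_abs_noiseTerm_le (h : IsModel μ σ Δ J ε τ) (hs : 0 < s) (hΔ : 0 ≤ Δ)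
    (hΔs : 2 * Δ ≤ s) (Θ : Matrix (Fin d) (Fin d) ℝ) (k : Fin n) :
    ∀ᵐ ω ∂μ, Real.exp (|noiseTerm Δ Θ (J k ω, ε k ω, τ k ω)| / s) ≤
      2 * Real.exp (|ε k ω| / s) := by
  have exp_half_le : Real.exp (1 / 2) ≤ 2 := by
    have exp_half_sq : Real.exp (1 / 2) ^ 2 = Real.exp 1 := by
      rw [← Real.exp_nat_mul]
      norm_num
    nlinarith [Real.exp_one_lt_d9, Real.exp_pos (1 / 2)]
  filter_upwards [h.abs_noiseTerm_le hΔ Θ k] with ω hω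
  have abs_div_le : |noiseTerm Δ Θ (J k ω, ε k ω, τ k ω)| / s ≤ 1 / 2 + |ε k ω| / s := by
    rw [div_le_iff₀ hs, add_mul, div_mul_cancel₀ _ hs.ne']
    linarith
  refine (Real.exp_le_exp.2 abs_div_le).trans ?_
  rw [Real.exp_add]
  gcongr

theorem integrable_exp_abs_noiseTerm (h : IsModel μ σ Δ J ε τ) (hs : 0 < s) (hσs : σ < s)
    (hΔ : 0 ≤ Δ) (hΔs : 2 * Δ ≤ s) (Θ : Matrix (Fin d) (Fin d) ℝ) (k : Fin n) :
    Integrable (fun ω => Real.exp (|noiseTerm Δ Θ (J k ω, ε k ω, τ k ω)| / s)) μ := by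
  refine ((integrable_exp_of_psi1Norm_lt (h.aemeasurable_noise k)
    (h.psi1Norm_noise_lt hs hσs k)).const_mul 2).mono'
    (aemeasurable_exp_abs_div (h.aemeasurable_noiseTerm Θ k) s).aestronglyMeasurable ?_
  filter_upwards [h.exp_abs_noiseTerm_le hs hΔ hΔs Θ k] with ω hω
  rwa [Real.norm_of_nonneg (Real.exp_pos _).le]

theorem integral_exp_abs_noiseTerm_mul_position_le [IsProbabilityMeasure μ]
    (h : IsModel μ σ Δ J ε τ) (hs : 0 < s) (hσs : σ < s) (hΔ : 0 ≤ Δ) (hΔs : 2 * Δ ≤ s)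
    (Θ : Matrix (Fin d) (Fin d) ℝ) (k : Fin n) {g : Fin d × Fin d → ℝ} (hg : ∀ p, 0 ≤ g p) :
    ∫ ω, Real.exp (|noiseTerm Δ Θ (J k ω, ε k ω, τ k ω)| / s) * g (J k ω) ∂μ ≤ 4 * 𝔼 p, g p := by
  have g_integrable := h.integrable_position k g
  have psi1_lt := h.psi1Norm_noise_lt hs hσs k
  have exp_integrable := integrable_exp_of_psi1Norm_lt (h.aemeasurable_noise k) psi1_lt
  have indep : IndepFun (fun ω => Real.exp (|ε k ω| / s)) (fun ω => g (J k ω)) μ :=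
    (h.indep_position_noise k).symm.comp
      (Real.measurable_exp.comp (measurable_norm.div_const s)) .of_discrete
  calc ∫ ω, Real.exp (|noiseTerm Δ Θ (J k ω, ε k ω, τ k ω)| / s) * g (J k ω) ∂μ
      ≤ ∫ ω, 2 * (Real.exp (|ε k ω| / s) * g (J k ω)) ∂μ := by
        refine integral_mono_ae (h.integrable_mul_position
          (h.integrable_exp_abs_noiseTerm hs hσs hΔ hΔs Θ k) k g)
          ((h.integrable_mul_position exp_integrable k g).const_mul 2) ?_
        filter_upwards [h.exp_abs_noiseTerm_le hs hΔ hΔs Θ k] with ω hω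
        rw [← mul_assoc]
        exact mul_le_mul_of_nonneg_right hω (hg _)
    _ = 2 * ((∫ ω, Real.exp (|ε k ω| / s) ∂μ) * 𝔼 p, g p) := by
        rw [integral_const_mul, indep.integral_fun_mul_eq_mul_integral
          exp_integrable.aestronglyMeasurable g_integrable.aestronglyMeasurable,
          h.integral_position]
    _ ≤ 2 * (2 * 𝔼 p, g p) := by
        gcongr
        · exact Finset.expect_nonneg fun p _ => hg p
        · exact integral_exp_le_two_of_psi1Norm_lt (h.aemeasurable_noise k) psi1_lt
    _ = 4 * 𝔼 p, g p := by ring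

end IsModel

end Sample

end QMC

/-! ### Concentration of the noise -/

namespace QMC

open Matrix NormedSpace
open scoped Matrix.Norms.L2Operator

variable {d n : ℕ}

theorem dotProduct_exp_smul_dilation_design_le {κ : ℝ} (hκ0 : 0 ≤ κ) (hκ : κ ≤ 1 / 2)
    (p : Fin d × Fin d) (w : ℝ) (x y : Fin d → ℝ) :
    Sum.elim x y ⬝ᵥ exp ((κ * w) • dilation (design p)) *ᵥ Sum.elim x y ≤
      (x ⬝ᵥ x + y ⬝ᵥ y) + 2 * κ * (w * (x p.1 * y p.2)) +
        8 * κ ^ 2 * (Real.exp |w| * (x p.1 ^ 2 + y p.2 ^ 2)) := by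
  have two_mul_abs_le : |2 * (x p.1 * y p.2)| ≤ x p.1 ^ 2 + y p.2 ^ 2 :=
    abs_le.2 ⟨by linarith [sq_nonneg (x p.1 + y p.2)], by linarith [sq_nonneg (x p.1 - y p.2)]⟩
  have odd_part_le : (Real.sinh (κ * w) - κ * w) * (2 * (x p.1 * y p.2)) ≤
      |Real.sinh (κ * w) - κ * w| * (x p.1 ^ 2 + y p.2 ^ 2) := by
    refine (le_abs_self _).trans ?_
    rw [abs_mul]
    gcongr
  have scalar_le := mul_le_mul_of_nonneg_right (cosh_sub_one_add_abs_sinh_sub_le hκ0 hκ w)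
    (by positivity : 0 ≤ x p.1 ^ 2 + y p.2 ^ 2)
  rw [dotProduct_exp_smul_dilation_design]
  linarith

/-- The sum of the noise terms of the samples, each placed at the position of its sample. -/
noncomputable def noiseMatrix (Δ : ℝ) (Θ : Matrix (Fin d) (Fin d) ℝ)
    (z : Fin n → (Fin d × Fin d) × ℝ × ℝ) : Matrix (Fin d) (Fin d) ℝ :=
  ∑ k, noiseTerm Δ Θ (z k) • design (z k).1

/-- The dilation of the noise term of one sample, placed at its position and scaled by `c`. -/
noncomputable def noiseDilation (Δ : ℝ) (Θ : Matrix (Fin d) (Fin d) ℝ) (c : ℝ)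
    (z : (Fin d × Fin d) × ℝ × ℝ) : Matrix (Fin d ⊕ Fin d) (Fin d ⊕ Fin d) ℝ :=
  (c * noiseTerm Δ Θ z) • dilation (design z.1)

theorem isSymm_noiseDilation (Δ : ℝ) (Θ : Matrix (Fin d) (Fin d) ℝ) (c : ℝ)
    (z : (Fin d × Fin d) × ℝ × ℝ) : (noiseDilation Δ Θ c z).IsSymm :=
  (isSymm_dilation _).smul _

theorem stronglyMeasurable_noiseDilation (Δ : ℝ) (Θ : Matrix (Fin d) (Fin d) ℝ) (c : ℝ) :
    StronglyMeasurable (noiseDilation Δ Θ c) :=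
  ((measurable_noiseTerm Δ Θ).const_mul c).stronglyMeasurable.smul
    ((StronglyMeasurable.of_discrete (f := fun p : Fin d × Fin d => dilation (design p))
      ).comp_measurable measurable_fst)

theorem norm_noiseDilation_le (Δ : ℝ) (Θ : Matrix (Fin d) (Fin d) ℝ) (c : ℝ)
    (z : (Fin d × Fin d) × ℝ × ℝ) : ‖noiseDilation Δ Θ c z‖ ≤ |c * noiseTerm Δ Θ z| := by
  rw [noiseDilation, norm_smul, Real.norm_eq_abs]
  exact mul_le_of_le_one_right (abs_nonneg _)
    (l2_opNorm_le_one_of_mul_mul_self (isSymm_dilation _) (dilation_design_cube _))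

theorem sum_noiseDilation (Δ : ℝ) (Θ : Matrix (Fin d) (Fin d) ℝ) (c : ℝ)
    (z : Fin n → (Fin d × Fin d) × ℝ × ℝ) :
    ∑ k, noiseDilation Δ Θ c (z k) = dilation (c • noiseMatrix Δ Θ z) := by
  simp only [noiseDilation, noiseMatrix, dilation_smul, dilation_sum, Finset.smul_sum, smul_smul]

theorem dotProduct_exp_noiseDilation_le {s : ℝ} (hs : 0 < s) (Δ : ℝ)
    (Θ : Matrix (Fin d) (Fin d) ℝ) {κ : ℝ} (hκ0 : 0 ≤ κ) (hκ : κ ≤ 1 / 2)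
    (z : (Fin d × Fin d) × ℝ × ℝ) (x y : Fin d → ℝ) :
    Sum.elim x y ⬝ᵥ exp (noiseDilation Δ Θ (κ / s) z) *ᵥ Sum.elim x y ≤
      (x ⬝ᵥ x + y ⬝ᵥ y) + 2 * κ / s * (noiseTerm Δ Θ z * (x z.1.1 * y z.1.2)) +
        8 * κ ^ 2 * (Real.exp (|noiseTerm Δ Θ z| / s) * (x z.1.1 ^ 2 + y z.1.2 ^ 2)) := by
  rw [noiseDilation, div_mul_eq_mul_div, mul_div_assoc]
  refine (dotProduct_exp_smul_dilation_design_le hκ0 hκ _ _ x y).trans_eq ?_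
  simp only [abs_div, abs_of_pos hs]
  ring

section Events

variable {Ω : Type*} [MeasurableSpace Ω] {μ : Measure Ω}

theorem measure_exp_le_le_of_lintegral_le {G : Ω → ℝ≥0∞} (hG : AEMeasurable G μ) {b : ℝ}
    (hGb : ∫⁻ ω, G ω ∂μ ≤ ENNReal.ofReal b) (t : ℝ) :
    μ {ω | ENNReal.ofReal (Real.exp t) ≤ G ω} ≤ ENNReal.ofReal (b * Real.exp (-t)) := by
  refine (meas_ge_le_lintegral_div hG (by simp [Real.exp_pos]) ENNReal.ofReal_ne_top).trans
    ((ENNReal.div_le_div_right hGb _).trans_eq ?_)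
  rw [← ENNReal.ofReal_div_of_pos (Real.exp_pos _), Real.exp_neg, div_eq_mul_inv]

namespace IsModel

variable {σ Δ s : ℝ} {J : Fin n → Ω → Fin d × Fin d} {ε τ : Fin n → Ω → ℝ}

theorem aemeasurable_samples (h : IsModel μ σ Δ J ε τ) :
    AEMeasurable (fun ω k => (J k ω, ε k ω, τ k ω)) μ :=
  aemeasurable_pi_lambda _ h.aemeasurable_sample

theorem integrable_exp_noiseDilation [NeZero d] (h : IsModel μ σ Δ J ε τ) (hs : 0 < s)
    (hσs : σ < s) (hΔ : 0 ≤ Δ) (hΔs : 2 * Δ ≤ s) (Θ : Matrix (Fin d) (Fin d) ℝ) {κ : ℝ}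
    (hκ : |κ| ≤ 1) (k : Fin n) :
    Integrable (fun z => exp (noiseDilation Δ Θ (κ / s) z))
      (μ.map fun ω => (J k ω, ε k ω, τ k ω)) := by
  have measurable := stronglyMeasurable_exp (stronglyMeasurable_noiseDilation Δ Θ (κ / s))
  refine (integrable_map_measure measurable.aestronglyMeasurable (h.aemeasurable_sample k)).2 ?_
  refine (h.integrable_exp_abs_noiseTerm hs hσs hΔ hΔs Θ k).mono'
    (measurable.aestronglyMeasurable.comp_aemeasurable (h.aemeasurable_sample k))
    (.of_forall fun ω => (norm_exp_le_exp_norm _).trans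
      (Real.exp_le_exp.2 ((norm_noiseDilation_le _ _ _ _).trans ?_)))
  rw [div_mul_eq_mul_div, abs_div, abs_mul, abs_of_pos hs]
  gcongr
  exact mul_le_of_le_one_left (abs_nonneg _) hκ

variable [IsProbabilityMeasure μ]

theorem lintegral_samples (h : IsModel μ σ Δ J ε τ)
    {G : (Fin n → (Fin d × Fin d) × ℝ × ℝ) → ℝ≥0∞} (hG : Measurable G) :
    ∫⁻ ω, G (fun k => (J k ω, ε k ω, τ k ω)) ∂μ =
      ∫⁻ z, G z ∂Measure.pi fun k => μ.map fun ω => (J k ω, ε k ω, τ k ω) := by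
  rw [← (iIndepFun_iff_map_fun_eq_pi_map h.aemeasurable_sample).1 h.indep_samples,
    lintegral_map' hG.aemeasurable h.aemeasurable_samples]

theorem isProbabilityMeasure_map_sample (h : IsModel μ σ Δ J ε τ) (k : Fin n) :
    IsProbabilityMeasure (μ.map fun ω => (J k ω, ε k ω, τ k ω)) :=
  Measure.isProbabilityMeasure_map (h.aemeasurable_sample k)

theorem integral_dotProduct_exp_noiseDilation_le [NeZero d] (h : IsModel μ σ Δ J ε τ) (hs : 0 < s)
    (hσs : σ < s) (hΔ : 0 ≤ Δ) (hΔs : 2 * Δ ≤ s) (Θ : Matrix (Fin d) (Fin d) ℝ) {κ : ℝ}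
    (hκ0 : 0 ≤ κ) (hκ : κ ≤ 1 / 2) (k : Fin n) (v : Fin d ⊕ Fin d → ℝ) :
    ∫ ω, v ⬝ᵥ exp (noiseDilation Δ Θ (κ / s) (J k ω, ε k ω, τ k ω)) *ᵥ v ∂μ ≤
      (1 + 32 * κ ^ 2 / d) * (v ⬝ᵥ v) := by
  obtain ⟨x, y, rfl⟩ : ∃ x y, v = Sum.elim x y := ⟨_, _, (Sum.elim_comp_inl_inr v).symm⟩
  set ξ : Ω → ℝ := fun ω => noiseTerm Δ Θ (J k ω, ε k ω, τ k ω)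
  set S := x ⬝ᵥ x + y ⬝ᵥ y
  set linear : Ω → ℝ := fun ω => 2 * κ / s * (ξ ω * (x (J k ω).1 * y (J k ω).2))
  set quadratic : Ω → ℝ := fun ω =>
    8 * κ ^ 2 * (Real.exp (|ξ ω| / s) * (x (J k ω).1 ^ 2 + y (J k ω).2 ^ 2))
  have exp_integrable := h.integrable_exp_abs_noiseTerm hs hσs hΔ hΔs Θ k
  have linear_integrable : Integrable linear μ :=
    (h.integrable_mul_position (integrable_of_integrable_exp_abs_div (h.aemeasurable_noiseTerm Θ k)
      hs exp_integrable) k fun p => x p.1 * y p.2).const_mul _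
  have quadratic_integrable : Integrable quadratic μ :=
    (h.integrable_mul_position exp_integrable k fun p => x p.1 ^ 2 + y p.2 ^ 2).const_mul _
  have affine_integrable : Integrable (fun ω => S + linear ω) μ :=
    (integrable_const S).add linear_integrable
  have linear_eq_zero : ∫ ω, linear ω ∂μ = 0 := by
    rw [integral_const_mul, h.integral_noiseTerm_mul_position hΔ Θ k fun p => x p.1 * y p.2,
      mul_zero]
  have quadratic_le : ∫ ω, quadratic ω ∂μ ≤ 8 * κ ^ 2 * (4 * (S / d)) := by
    rw [integral_const_mul, ← expect_design_sq]
    exact mul_le_mul_of_nonneg_left (h.integral_exp_abs_noiseTerm_mul_position_le hs hσs hΔ hΔs Θ k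
      (g := fun p => x p.1 ^ 2 + y p.2 ^ 2) fun p => by positivity) (by positivity)
  have form_nonneg : ∀ ω, 0 ≤ Sum.elim x y ⬝ᵥ
      exp (noiseDilation Δ Θ (κ / s) (J k ω, ε k ω, τ k ω)) *ᵥ Sum.elim x y := fun ω => by
    simpa using (posSemidef_exp (isSymm_noiseDilation Δ Θ (κ / s) _)).dotProduct_mulVec_nonneg
      (Sum.elim x y)
  calc _ ≤ ∫ ω, S + linear ω + quadratic ω ∂μ :=
        integral_mono_of_nonneg (.of_forall form_nonneg)
          (affine_integrable.add quadratic_integrable)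
          (.of_forall fun ω => dotProduct_exp_noiseDilation_le hs Δ Θ hκ0 hκ _ x y)
    _ = S + ∫ ω, quadratic ω ∂μ := by
        rw [integral_add affine_integrable quadratic_integrable,
          integral_add (integrable_const S) linear_integrable, linear_eq_zero]
        simp
    _ ≤ S + 8 * κ ^ 2 * (4 * (S / d)) := by gcongr
    _ = (1 + 32 * κ ^ 2 / d) * (Sum.elim x y ⬝ᵥ Sum.elim x y) := by
        rw [sumElim_dotProduct_sumElim]
        ring

theorem lintegral_trace_exp_noiseDilation_le [NeZero d] (h : IsModel μ σ Δ J ε τ) (hs : 0 < s)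
    (hσs : σ < s) (hΔ : 0 ≤ Δ) (hΔs : 2 * Δ ≤ s) (Θ : Matrix (Fin d) (Fin d) ℝ) {κ : ℝ}
    (hκ0 : 0 ≤ κ) (hκ : κ ≤ 1 / 2) :
    ∫⁻ z, ENNReal.ofReal (exp (∑ k, noiseDilation Δ Θ (κ / s) (z k))).trace
        ∂Measure.pi (fun k => μ.map fun ω => (J k ω, ε k ω, τ k ω)) ≤
      ENNReal.ofReal ((1 + 32 * κ ^ 2 / d) ^ n * (2 * d)) := by
  have := h.isProbabilityMeasure_map_sample
  have measurable := stronglyMeasurable_noiseDilation Δ Θ (κ / s)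
  have card_eq : (2 * d : ℝ) = Fintype.card (Fin d ⊕ Fin d) := by simp [two_mul]
  rw [card_eq]
  refine lintegral_trace_exp_sum_le (isSymm_noiseDilation Δ Θ (κ / s)) measurable (by positivity) _
    (h.integrable_exp_noiseDilation hs hσs hΔ hΔs Θ (abs_le.2 ⟨by linarith, by linarith⟩))
    fun k v => ?_
  have form_continuous : Continuous fun A : Matrix (Fin d ⊕ Fin d) (Fin d ⊕ Fin d) ℝ =>
      v ⬝ᵥ A *ᵥ v := continuous_const.dotProduct (continuous_id.matrix_mulVec continuous_const)
  rw [integral_map (h.aemeasurable_sample k) (form_continuous.comp_stronglyMeasurable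
    (stronglyMeasurable_exp measurable)).aestronglyMeasurable]
  exact h.integral_dotProduct_exp_noiseDilation_le hs hσs hΔ hΔs Θ hκ0 hκ k v

theorem measure_lt_norm_noiseMatrix_le [NeZero d] (h : IsModel μ σ Δ J ε τ) (hs : 0 < s)
    (hσs : σ < s) (hΔ : 0 ≤ Δ) (hΔs : 2 * Δ ≤ s) (Θ : Matrix (Fin d) (Fin d) ℝ) {κ : ℝ}
    (hκ0 : 0 < κ) (hκ : κ ≤ 1 / 2) (t : ℝ) :
    μ {ω | s / κ * t < ‖noiseMatrix Δ Θ fun k => (J k ω, ε k ω, τ k ω)‖} ≤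
      ENNReal.ofReal ((1 + 32 * κ ^ 2 / d) ^ n * (2 * d) * Real.exp (-t)) := by
  have G_measurable : Measurable fun z : Fin n → (Fin d × Fin d) × ℝ × ℝ =>
      ENNReal.ofReal (exp (∑ k, noiseDilation Δ Θ (κ / s) (z k))).trace :=
    measurable_ofReal_trace <| stronglyMeasurable_exp <| Finset.stronglyMeasurable_fun_sum _
      fun k _ => (stronglyMeasurable_noiseDilation Δ Θ _).comp_measurable (measurable_pi_apply k)
  refine le_trans (measure_mono fun ω hω => ?_) (measure_exp_le_le_of_lintegral_le
    (G_measurable.comp_aemeasurable h.aemeasurable_samples)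
    ((h.lintegral_samples G_measurable).trans_le
      (h.lintegral_trace_exp_noiseDilation_le hs hσs hΔ hΔs Θ hκ0.le hκ)) t)
  refine ENNReal.ofReal_le_ofReal (le_of_not_gt fun trace_lt => ?_)
  rw [sum_noiseDilation] at trace_lt
  have norm_le := l2_opNorm_le_of_trace_exp_dilation_le trace_lt.le
  rw [norm_smul, Real.norm_of_nonneg (by positivity)] at norm_le
  have lt_norm : s / κ * t < ‖noiseMatrix Δ Θ fun k => (J k ω, ε k ω, τ k ω)‖ := hω
  refine absurd lt_norm (not_lt.2 ?_)
  calc _ = s / κ * (κ / s * ‖noiseMatrix Δ Θ fun k => (J k ω, ε k ω, τ k ω)‖) := by field_simp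
    _ ≤ s / κ * t := by gcongr

theorem lintegral_exp_sum_abs_noiseTerm_le [NeZero d] (h : IsModel μ σ Δ J ε τ) (hs : 0 < s)
    (hσs : σ < s) (hΔ : 0 ≤ Δ) (hΔs : 2 * Δ ≤ s) (Θ : Matrix (Fin d) (Fin d) ℝ) :
    ∫⁻ z, ENNReal.ofReal (∏ k, Real.exp (|noiseTerm Δ Θ (z k)| / s))
        ∂Measure.pi (fun k => μ.map fun ω => (J k ω, ε k ω, τ k ω)) ≤ ENNReal.ofReal (4 ^ n) := by
  have := h.isProbabilityMeasure_map_sample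
  have measurable : StronglyMeasurable fun z => Real.exp (|noiseTerm Δ Θ z| / s) :=
    ((measurable_noiseTerm Δ Θ).norm.div_const s).exp.stronglyMeasurable
  have exp_integrable : ∀ k, Integrable (fun z => Real.exp (|noiseTerm Δ Θ z| / s))
      (μ.map fun ω => (J k ω, ε k ω, τ k ω)) := fun k =>
    (integrable_map_measure measurable.aestronglyMeasurable (h.aemeasurable_sample k)).2
      (h.integrable_exp_abs_noiseTerm hs hσs hΔ hΔs Θ k)
  have exp_integral_le : ∀ k, ∫ z, Real.exp (|noiseTerm Δ Θ z| / s)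
      ∂(μ.map fun ω => (J k ω, ε k ω, τ k ω)) ≤ 4 := fun k => by
    rw [integral_map (h.aemeasurable_sample k) measurable.aestronglyMeasurable]
    simpa using h.integral_exp_abs_noiseTerm_mul_position_le hs hσs hΔ hΔs Θ k
      (g := fun _ => 1) fun _ => zero_le_one
  rw [← ofReal_integral_eq_lintegral_ofReal (Integrable.fintype_prod exp_integrable)
    (.of_forall fun z => Finset.prod_nonneg fun k _ => (Real.exp_pos _).le),
    integral_fintype_prod_eq_prod fun _ z => Real.exp (|noiseTerm Δ Θ z| / s)]
  refine ENNReal.ofReal_le_ofReal ?_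
  calc _ ≤ ∏ _k : Fin n, (4 : ℝ) := Finset.prod_le_prod
        (fun k _ => integral_nonneg fun z => (Real.exp_pos _).le) fun k _ => exp_integral_le k
    _ = 4 ^ n := by simp

theorem measure_le_sum_abs_noiseTerm_le [NeZero d] (h : IsModel μ σ Δ J ε τ) (hs : 0 < s)
    (hσs : σ < s) (hΔ : 0 ≤ Δ) (hΔs : 2 * Δ ≤ s) (Θ : Matrix (Fin d) (Fin d) ℝ) (t : ℝ) :
    μ {ω | t ≤ ∑ k, |noiseTerm Δ Θ (J k ω, ε k ω, τ k ω)| / s} ≤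
      ENNReal.ofReal (4 ^ n * Real.exp (-t)) := by
  have G_measurable : Measurable fun z : Fin n → (Fin d × Fin d) × ℝ × ℝ =>
      ENNReal.ofReal (∏ k, Real.exp (|noiseTerm Δ Θ (z k)| / s)) :=
    (Finset.measurable_prod _ fun k _ => (((measurable_noiseTerm Δ Θ).comp
      (measurable_pi_apply k)).norm.div_const s).exp).ennreal_ofReal
  refine le_trans (measure_mono fun ω hω => ?_) (measure_exp_le_le_of_lintegral_le
    (G_measurable.comp_aemeasurable h.aemeasurable_samples)
    ((h.lintegral_samples G_measurable).trans_le
      (h.lintegral_exp_sum_abs_noiseTerm_le hs hσs hΔ hΔs Θ)) t)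
  refine ENNReal.ofReal_le_ofReal ?_
  rw [← Real.exp_sum]
  exact Real.exp_le_exp.2 hω

end IsModel

end Events

end QMC

/-! ### Deterministic error analysis -/

namespace QMC

open Matrix
open scoped Matrix.Norms.L2Operator

variable {d n : ℕ}

theorem abs_apply_le_maxNorm (A : Matrix (Fin d) (Fin d) ℝ) (i j : Fin d) :
    |A i j| ≤ maxNorm A :=
  Finite.le_ciSup (fun p : Fin d × Fin d => |A p.1 p.2|) (i, j)

theorem maxNorm_nonneg (A : Matrix (Fin d) (Fin d) ℝ) : 0 ≤ maxNorm A :=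
  Real.iSup_nonneg fun _ => abs_nonneg _

theorem frobNorm_smul {c : ℝ} (hc : 0 ≤ c) (A : Matrix (Fin d) (Fin d) ℝ) :
    frobNorm (c • A) = c * frobNorm A := by
  rw [← sq_eq_sq₀ (frobNorm_nonneg _) (mul_nonneg hc (frobNorm_nonneg _)), mul_pow, frobNorm_sq,
    frobNorm_sq, matInner_smul_left, matInner_smul_right, ← mul_assoc, sq]

theorem frobNorm_le_mul_maxNorm (A : Matrix (Fin d) (Fin d) ℝ) : frobNorm A ≤ d * maxNorm A := by
  refine Real.sqrt_le_iff.2 ⟨mul_nonneg d.cast_nonneg (maxNorm_nonneg A), ?_⟩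
  calc ∑ i, ∑ j, A i j ^ 2 ≤ ∑ _i : Fin d, ∑ _j : Fin d, maxNorm A ^ 2 :=
        Finset.sum_le_sum fun i _ => Finset.sum_le_sum fun j _ =>
          sq_le_sq.2 ((abs_apply_le_maxNorm A i j).trans (le_abs_self _))
    _ = (d * maxNorm A) ^ 2 := by
        simp only [Finset.sum_const, Finset.card_univ, Fintype.card_fin, nsmul_eq_mul]
        ring

theorem maxNorm_sub_le (A B : Matrix (Fin d) (Fin d) ℝ) :
    maxNorm (A - B) ≤ maxNorm A + maxNorm B :=
  Real.iSup_le (fun p => (abs_sub (A p.1 p.2) (B p.1 p.2)).trans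
    (add_le_add (abs_apply_le_maxNorm A _ _) (abs_apply_le_maxNorm B _ _)))
    (add_nonneg (maxNorm_nonneg A) (maxNorm_nonneg B))

section LeastSquares

variable {lam : ℝ} {p : Fin n → Fin d × Fin d} {y : Fin n → ℝ} {Θ Θhat : Matrix (Fin d) (Fin d) ℝ}

theorem half_sum_sq_le_of_objective_le (hn : 0 < n)
    (h : objective lam p y Θhat ≤ objective lam p y Θ) :
    1 / 2 * ∑ k, (Θhat - Θ) (p k).1 (p k).2 ^ 2 ≤
      ∑ k, (y k - Θ (p k).1 (p k).2) * (Θhat - Θ) (p k).1 (p k).2 +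
        n * lam * (nuclearNorm Θ - nuclearNorm Θhat) := by
  have n_mul_objective : ∀ M : Matrix (Fin d) (Fin d) ℝ, n * objective lam p y M =
      1 / 2 * ∑ k, (y k - M (p k).1 (p k).2) ^ 2 + n * lam * nuclearNorm M := fun M => by
    simp only [objective, matInner_design]
    field_simp
  have residual_expansion : ∑ k, (y k - Θhat (p k).1 (p k).2) ^ 2 =
      ∑ k, (y k - Θ (p k).1 (p k).2) ^ 2 -
        2 * ∑ k, (y k - Θ (p k).1 (p k).2) * (Θhat - Θ) (p k).1 (p k).2 +
        ∑ k, (Θhat - Θ) (p k).1 (p k).2 ^ 2 := by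
    rw [Finset.mul_sum, ← Finset.sum_sub_distrib, ← Finset.sum_add_distrib]
    refine Finset.sum_congr rfl fun k _ => ?_
    rw [Matrix.sub_apply]
    ring
  have scaled := mul_le_mul_of_nonneg_left h n.cast_nonneg (α := ℝ)
  rw [n_mul_objective, n_mul_objective, residual_expansion] at scaled
  linarith

theorem sum_residual_mul_le {ν : ℝ}
    (hν : ‖∑ k, (y k - Θ (p k).1 (p k).2) • design (p k)‖ ≤ ν) (D : Matrix (Fin d) (Fin d) ℝ) :
    ∑ k, (y k - Θ (p k).1 (p k).2) * D (p k).1 (p k).2 ≤ ν * nuclearNorm D := by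
  have duality := matInner_le_l2_opNorm_mul_nuclearNorm
    (∑ k, (y k - Θ (p k).1 (p k).2) • design (p k)) D
  simp only [matInner_sum_left, matInner_smul_left, matInner_design] at duality
  exact duality.trans (mul_le_mul_of_nonneg_right hν (nuclearNorm_nonneg D))

/-- If the residual is dominated by the regularization, then decomposability of the nuclear norm
places the error in a cone on which the nuclear norm is controlled by the Frobenius norm. -/
theorem nuclearNorm_sub_le_and_sum_sq_le (hn : 0 < n) (hlam : 0 < lam)
    (h : objective lam p y Θhat ≤ objective lam p y Θ)
    (hres : ‖∑ k, (y k - Θ (p k).1 (p k).2) • design (p k)‖ ≤ n * lam / 2) {r : ℕ}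
    (hr : Θ.rank ≤ r) :
    nuclearNorm (Θhat - Θ) ≤ 4 * √(2 * r) * frobNorm (Θhat - Θ) ∧
      ∑ k, (Θhat - Θ) (p k).1 (p k).2 ^ 2 ≤
        3 * (n * lam) * √(2 * r) * frobNorm (Θhat - Θ) := by
  have n_lam_pos : 0 < n * lam := by positivity
  obtain ⟨D₁, D₂, hD, hD₁_rank, hD₁_frob, decomposable⟩ :=
    exists_nuclearNorm_decomposition Θ (Θhat - Θ)
  rw [add_sub_cancel] at decomposable
  have triangle := hD ▸ nuclearNorm_add_le D₁ D₂
  have D₁_le : nuclearNorm D₁ ≤ √(2 * r) * frobNorm (Θhat - Θ) := by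
    refine (nuclearNorm_le_sqrt_rank_mul_frobNorm D₁).trans
      (mul_le_mul (Real.sqrt_le_sqrt ?_) hD₁_frob (frobNorm_nonneg _) (Real.sqrt_nonneg _))
    exact_mod_cast hD₁_rank.trans (Nat.mul_le_mul_left 2 hr)
  have sum_sq_le : ∑ k, (Θhat - Θ) (p k).1 (p k).2 ^ 2 ≤
      n * lam * (3 * nuclearNorm D₁ - nuclearNorm D₂) := by
    have basic := half_sum_sq_le_of_objective_le hn h
    have residual := (sum_residual_mul_le hres (Θhat - Θ)).trans
      (mul_le_mul_of_nonneg_left triangle (by positivity))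
    have penalty : n * lam * (nuclearNorm Θ - nuclearNorm Θhat) ≤
        n * lam * (nuclearNorm D₁ - nuclearNorm D₂) :=
      mul_le_mul_of_nonneg_left (by linarith) n_lam_pos.le
    linarith
  have cone : 0 ≤ 3 * nuclearNorm D₁ - nuclearNorm D₂ :=
    nonneg_of_mul_nonneg_right ((Finset.sum_nonneg fun k _ => sq_nonneg _).trans sum_sq_le)
      n_lam_pos
  refine ⟨by linarith, sum_sq_le.trans ?_⟩
  have : n * lam * (3 * nuclearNorm D₁ - nuclearNorm D₂) ≤
      n * lam * (3 * (√(2 * r) * frobNorm (Θhat - Θ))) :=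
    mul_le_mul_of_nonneg_left (by linarith [nuclearNorm_nonneg D₂]) n_lam_pos.le
  linarith

theorem nuclearNorm_sub_nuclearNorm_le (hn : 0 < n)
    (h : objective lam p y Θhat ≤ objective lam p y Θ) {a : ℝ} (ha : maxNorm (Θhat - Θ) ≤ a) :
    n * lam * (nuclearNorm Θhat - nuclearNorm Θ) ≤ a * ∑ k, |y k - Θ (p k).1 (p k).2| := by
  have basic := half_sum_sq_le_of_objective_le hn h
  have sum_sq_nonneg : 0 ≤ ∑ k, (Θhat - Θ) (p k).1 (p k).2 ^ 2 :=
    Finset.sum_nonneg fun k _ => sq_nonneg _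
  have residual_le : ∑ k, (y k - Θ (p k).1 (p k).2) * (Θhat - Θ) (p k).1 (p k).2 ≤
      a * ∑ k, |y k - Θ (p k).1 (p k).2| := by
    rw [Finset.mul_sum]
    refine Finset.sum_le_sum fun k _ => (le_abs_self _).trans ?_
    rw [abs_mul, mul_comm]
    exact mul_le_mul_of_nonneg_right ((abs_apply_le_maxNorm _ _ _).trans ha) (abs_nonneg _)
  linarith

end LeastSquares

section RestrictedConvexity

variable [NeZero d] {p : Fin n → Fin d × Fin d} {D : Matrix (Fin d) (Fin d) ℝ} {a s : ℝ}

theorem lt_sum_sq_of_notMem_convexityFailures {ρ : ℝ}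
    (hp : p ∉ convexityFailures d n a ρ (n * s ^ 2 / 2)) (hD : maxNorm D ≤ a)
    (hD_nuc : nuclearNorm D ≤ ρ) (hD_frob : frobNorm D = s * d) :
    n * s ^ 2 / 2 < ∑ k, D (p k).1 (p k).2 ^ 2 := by
  have deficit_lt : samplingDeficit p D < n * s ^ 2 / 2 := by
    by_contra! hle
    exact hp ⟨D, fun i j => (abs_apply_le_maxNorm D i j).trans hD, hD_nuc, hle⟩
  rw [samplingDeficit, hD_frob, mul_pow,
    mul_div_cancel_right₀ _ (pow_ne_zero 2 (NeZero.ne (d : ℝ)))] at deficit_lt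
  linarith

/-- A matrix of large Frobenius norm is first scaled down to Frobenius norm `s * d`, where
restricted convexity applies. -/
theorem frobNorm_div_le_max_of_notMem_convexityFailures (hs : 0 < s) {b c : ℝ}
    (hp : p ∉ convexityFailures d n a (b * (s * d)) (n * s ^ 2 / 2)) (hD : maxNorm D ≤ a)
    (hD_nuc : nuclearNorm D ≤ b * frobNorm D)
    (hD_sum : ∑ k, D (p k).1 (p k).2 ^ 2 ≤ n * c * frobNorm D) :
    frobNorm D / d ≤ max s (2 * c * d) := by
  have d_pos : (0 : ℝ) < d := by exact_mod_cast NeZero.pos d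
  refine (le_or_gt (frobNorm D / d) s).elim le_max_of_le_left fun hlt => le_max_of_le_right ?_
  have lt_frobNorm : s * d < frobNorm D := (lt_div_iff₀ d_pos).1 hlt
  have frobNorm_pos : 0 < frobNorm D := (by positivity : 0 < s * d).trans lt_frobNorm
  set t := s * d / frobNorm D
  have t_pos : 0 < t := by positivity
  have t_le_one : t ≤ 1 := (div_le_one frobNorm_pos).2 lt_frobNorm.le
  have t_mul : t * frobNorm D = s * d := div_mul_cancel₀ _ frobNorm_pos.ne'
  have scaled_maxNorm : maxNorm (t • D) ≤ a := by
    refine Real.iSup_le (fun q => ?_) ((maxNorm_nonneg D).trans hD)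
    rw [Matrix.smul_apply, smul_eq_mul, abs_mul, abs_of_pos t_pos]
    exact (mul_le_of_le_one_left (abs_nonneg _) t_le_one).trans
      ((abs_apply_le_maxNorm D _ _).trans hD)
  have scaled_nuclearNorm : nuclearNorm (t • D) ≤ b * (s * d) := by
    refine (nuclearNorm_smul_le t_pos.le D).trans ?_
    rw [← t_mul]
    linarith [mul_le_mul_of_nonneg_left hD_nuc t_pos.le]
  have lt_scaled_sum := lt_sum_sq_of_notMem_convexityFailures hp scaled_maxNorm
    scaled_nuclearNorm ((frobNorm_smul t_pos.le D).trans t_mul)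
  simp only [Matrix.smul_apply, smul_eq_mul, mul_pow, ← Finset.mul_sum] at lt_scaled_sum
  have comparison : n * s * s < n * s * (2 * (t * c * d)) :=
    calc n * s * s = 2 * (n * s ^ 2 / 2) := by ring
      _ < 2 * (t ^ 2 * (n * c * frobNorm D)) := by
        linarith [mul_le_mul_of_nonneg_left hD_sum (sq_nonneg t)]
      _ = 2 * (t * (n * c) * (t * frobNorm D)) := by ring
      _ = n * s * (2 * (t * c * d)) := by rw [t_mul]; ring
  have s_lt : s < 2 * (t * c * d) := lt_of_mul_lt_mul_left comparison (by positivity)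
  refine le_of_mul_le_mul_left ?_ t_pos
  rw [← mul_div_assoc, t_mul, mul_div_cancel_right₀ _ d_pos.ne']
  linarith

end RestrictedConvexity

section Estimator

variable {α lam : ℝ} {p : Fin n → Fin d × Fin d} {y : Fin n → ℝ} {Θ Θhat : Matrix (Fin d) (Fin d) ℝ}

namespace IsEstimator

theorem maxNorm_sub_le (h : IsEstimator α lam p y Θhat) (hΘ : maxNorm Θ ≤ α) :
    maxNorm (Θhat - Θ) ≤ 2 * α :=
  (QMC.maxNorm_sub_le Θhat Θ).trans (by linarith [h.1])

theorem error_le_of_notMem_convexityFailures [NeZero d] (h : IsEstimator α lam p y Θhat)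
    (hΘ : maxNorm Θ ≤ α) (hn : 0 < n) (hlam : 0 < lam)
    (hres : ‖∑ k, (y k - Θ (p k).1 (p k).2) • design (p k)‖ ≤ n * lam / 2) {r : ℕ}
    (hr : Θ.rank ≤ r) {a s : ℝ} (ha : 2 * α ≤ a) (hs : 0 < s)
    (hp : p ∉ convexityFailures d n a (4 * √(2 * r) * (s * d)) (n * s ^ 2 / 2)) :
    frobNorm (Θhat - Θ) / d ≤ max s (6 * √(2 * r) * (lam * d)) ∧
      nuclearNorm (Θhat - Θ) / d ≤ 4 * √(2 * r) * max s (6 * √(2 * r) * (lam * d)) := by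
  obtain ⟨cone, sum_sq_le⟩ := nuclearNorm_sub_le_and_sum_sq_le hn hlam (h.2 hΘ) hres hr
  have frobNorm_le : frobNorm (Θhat - Θ) / d ≤ max s (6 * √(2 * r) * (lam * d)) := by
    refine (frobNorm_div_le_max_of_notMem_convexityFailures hs hp ((h.maxNorm_sub_le hΘ).trans ha)
      cone (c := 3 * lam * √(2 * r)) (by linarith)).trans_eq ?_
    ring_nf
  refine ⟨frobNorm_le, ?_⟩
  calc nuclearNorm (Θhat - Θ) / d ≤ 4 * √(2 * r) * frobNorm (Θhat - Θ) / d := by gcongr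
    _ = 4 * √(2 * r) * (frobNorm (Θhat - Θ) / d) := mul_div_assoc _ _ _
    _ ≤ 4 * √(2 * r) * max s (6 * √(2 * r) * (lam * d)) := by gcongr

theorem frobNorm_sub_le (h : IsEstimator α lam p y Θhat) (hΘ : maxNorm Θ ≤ α) :
    frobNorm (Θhat - Θ) / d ≤ 2 * α :=
  div_le_of_le_mul₀ d.cast_nonneg (by linarith [maxNorm_nonneg Θ])
    ((frobNorm_le_mul_maxNorm _).trans (by
      linarith [mul_le_mul_of_nonneg_left (h.maxNorm_sub_le hΘ) (Nat.cast_nonneg (α := ℝ) d)]))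

theorem nuclearNorm_sub_le (h : IsEstimator α lam p y Θhat) (hΘ : maxNorm Θ ≤ α) (hn : 0 < n)
    (hlam : 0 < lam) {r : ℕ} (hr : Θ.rank ≤ r) :
    nuclearNorm (Θhat - Θ) ≤
      2 * (√r * (d * α)) + 2 * α * (∑ k, |y k - Θ (p k).1 (p k).2|) / (n * lam) := by
  have truth_le : nuclearNorm Θ ≤ √r * (d * α) := by
    refine (nuclearNorm_le_sqrt_rank_mul_frobNorm Θ).trans ?_
    gcongr
    · exact frobNorm_nonneg Θ
    · exact (frobNorm_le_mul_maxNorm Θ).trans (by gcongr)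
  have excess_le : nuclearNorm Θhat - nuclearNorm Θ ≤
      2 * α * (∑ k, |y k - Θ (p k).1 (p k).2|) / (n * lam) := by
    rw [le_div_iff₀' (by positivity)]
    exact nuclearNorm_sub_nuclearNorm_le hn (h.2 hΘ) (h.maxNorm_sub_le hΘ)
  linarith [QMC.nuclearNorm_sub_le Θhat Θ]

end IsEstimator

end Estimator

end QMC

/-! ### Error bounds with high probability -/

namespace QMC

open scoped Matrix.Norms.L2Operator

variable {d n : ℕ}

theorem exists_measurableSet_subset_compl {Ω : Type*} [MeasurableSpace Ω] {μ : Measure Ω}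
    [IsProbabilityMeasure μ] {q : ℝ} (hq : 0 ≤ q) {B : Set Ω} (hB : μ B ≤ ENNReal.ofReal q) :
    ∃ E : Set Ω, MeasurableSet E ∧ 1 - q ≤ μ.real E ∧ E ⊆ Bᶜ := by
  have measurable := measurableSet_toMeasurable μ B
  refine ⟨(toMeasurable μ B)ᶜ, measurable.compl, ?_, compl_subset_compl.2 (subset_toMeasurable μ B)⟩
  rw [probReal_compl_eq_one_sub measurable, Measure.real, measure_toMeasurable]
  exact sub_le_sub_left (ENNReal.toReal_le_of_le_ofReal hq hB) 1

theorem two_mul_mul_exp_neg_le (hd : 2 ≤ d) {δ x : ℝ} (hx : (δ + 2) * Real.log d ≤ x) :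
    2 * d * Real.exp (-x) ≤ (d : ℝ) ^ (-δ) := by
  have d_pos : (0 : ℝ) < d := by exact_mod_cast (by lia : 0 < d)
  have two_mul_le : (2 * d : ℝ) ≤ Real.exp (2 * Real.log d) := by
    rw [mul_comm 2 (Real.log _), Real.exp_mul, Real.exp_log d_pos]
    norm_cast
    nlinarith
  calc 2 * d * Real.exp (-x) ≤ Real.exp (2 * Real.log d) * Real.exp (-x) := by gcongr
    _ = Real.exp (2 * Real.log d + -x) := (Real.exp_add _ _).symm
    _ ≤ Real.exp (Real.log d * -δ) := Real.exp_le_exp.2 (by linarith)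
    _ = (d : ℝ) ^ (-δ) := (Real.rpow_def_of_pos d_pos _).symm

theorem one_add_pow_le_exp {x : ℝ} (hx : 0 ≤ x) (n : ℕ) : (1 + x) ^ n ≤ Real.exp (n * x) := by
  rw [Real.exp_nat_mul]
  exact pow_le_pow_left₀ (by positivity) (by linarith [Real.add_one_le_exp x]) n

theorem four_pow_le_exp (n : ℕ) : (4 : ℝ) ^ n ≤ Real.exp (2 * n) := by
  have two_le : (2 : ℝ) ≤ Real.exp 1 := by linarith [Real.add_one_le_exp (1 : ℝ)]
  calc (4 : ℝ) ^ n = (2 ^ 2) ^ n := by norm_num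
    _ ≤ (Real.exp 1 ^ 2) ^ n := by gcongr
    _ = Real.exp (2 * n) := by rw [← pow_mul, ← Real.exp_nat_mul]; push_cast; ring_nf

section Model

variable {Ω : Type*} [MeasurableSpace Ω] {μ : Measure Ω} [IsProbabilityMeasure μ] {σ Δ : ℝ}
  {J : Fin n → Ω → Fin d × Fin d} {ε τ : Fin n → Ω → ℝ}

namespace IsModel

theorem measure_lt_norm_noiseMatrix_le_rpow (h : IsModel μ σ Δ J ε τ) (hd : 2 ≤ d) (hσ : 0 ≤ σ)
    (hΔ : 0 ≤ Δ) (hσΔ : 0 < σ + Δ) (Θ : Matrix (Fin d) (Fin d) ℝ) {Y δ : ℝ} (hY0 : 0 < Y)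
    (hY1 : Y ≤ 1) (hδ : (δ + 2) * Real.log d ≤ n * Y ^ 2 / d) :
    μ {ω | 36 * (σ + Δ) * (n * Y / d) < ‖noiseMatrix Δ Θ fun k => (J k ω, ε k ω, τ k ω)‖} ≤
      ENNReal.ofReal ((d : ℝ) ^ (-δ)) := by
  have : NeZero d := ⟨by lia⟩
  have threshold_eq : 2 * (σ + Δ) / (Y / 2) * (9 * (n * Y ^ 2 / d)) =
      36 * (σ + Δ) * (n * Y / d) := by
    field_simp
    ring
  rw [← threshold_eq]
  refine (h.measure_lt_norm_noiseMatrix_le (by positivity) (by linarith) hΔ (by linarith) Θ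
    (by positivity) (by linarith) _).trans (ENNReal.ofReal_le_ofReal ?_)
  calc (1 + 32 * (Y / 2) ^ 2 / d) ^ n * (2 * d) * Real.exp (-(9 * (n * Y ^ 2 / d)))
      ≤ Real.exp (n * (32 * (Y / 2) ^ 2 / d)) * (2 * d) *
          Real.exp (-(9 * (n * Y ^ 2 / d))) := by
        gcongr
        exact one_add_pow_le_exp (by positivity) n
    _ = 2 * d * Real.exp (-(n * Y ^ 2 / d)) := by
        rw [mul_comm (Real.exp _), mul_assoc, ← Real.exp_add]
        ring_nf
    _ ≤ (d : ℝ) ^ (-δ) := two_mul_mul_exp_neg_le hd hδ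

theorem measure_convexityFailures_le_rpow (h : IsModel μ σ Δ J ε τ) (hd : 2 ≤ d) {L b Y δ s : ℝ}
    (hL : 0 < L) (hb : 0 < b) (hY0 : 0 < Y) (hY1 : Y ≤ 1)
    (hδ : (δ + 2) * Real.log d ≤ n * Y ^ 2 / d) (hs : s = 32 * L * b * Y) :
    μ {ω | (fun k => J k ω) ∈ convexityFailures d n (2 * L) (b * (s * d)) (n * s ^ 2 / 2)} ≤
      ENNReal.ofReal ((d : ℝ) ^ (-δ)) := by
  have : NeZero d := ⟨by lia⟩
  have s_pos : 0 < s := hs ▸ by positivity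
  rw [h.measure_positions_eq]
  refine ENNReal.ofReal_le_ofReal ((expect_indicator_convexityFailures_le (by positivity)
    (by positivity) hY0.le hY1 _).trans (le_trans (le_of_eq ?_) (two_mul_mul_exp_neg_le hd hδ)))
  have exponent_eq : Y / (4 * (2 * L) * (b * (s * d))) * (n * s ^ 2 / 2) =
      2 * (n * Y ^ 2 / d) := by
    rw [hs]
    field_simp
    ring
  rw [exponent_eq]
  ring_nf

theorem exists_measurableSet_norm_noiseMatrix_le_and_notMem_convexityFailures
    (h : IsModel μ σ Δ J ε τ) (hd : 2 ≤ d) (hσ : 0 ≤ σ) (hΔ : 0 ≤ Δ) (hσΔ : 0 < σ + Δ)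
    (Θ : Matrix (Fin d) (Fin d) ℝ) {L b Y δ s : ℝ} (hL : 0 < L) (hb : 0 < b) (hY0 : 0 < Y)
    (hY1 : Y ≤ 1) (hδ : (δ + 2) * Real.log d ≤ n * Y ^ 2 / d) (hs : s = 32 * L * b * Y) :
    ∃ E : Set Ω, MeasurableSet E ∧ 1 - 2 * (d : ℝ) ^ (-δ) ≤ μ.real E ∧ ∀ ω ∈ E,
      ‖noiseMatrix Δ Θ fun k => (J k ω, ε k ω, τ k ω)‖ ≤ 36 * (σ + Δ) * (n * Y / d) ∧
      (fun k => J k ω) ∉ convexityFailures d n (2 * L) (b * (s * d)) (n * s ^ 2 / 2) := by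
  have measure_union_le := (measure_union_le _ _).trans
    (add_le_add (h.measure_lt_norm_noiseMatrix_le_rpow hd hσ hΔ hσΔ Θ hY0 hY1 hδ)
      (h.measure_convexityFailures_le_rpow hd hL hb hY0 hY1 hδ hs))
  rw [← ENNReal.ofReal_add (by positivity) (by positivity), ← two_mul] at measure_union_le
  obtain ⟨E, hE, hE_prob, hE_subset⟩ :=
    exists_measurableSet_subset_compl (by positivity) measure_union_le
  refine ⟨E, hE, hE_prob, fun ω hω => ?_⟩
  obtain ⟨norm_not_lt, notMem⟩ := not_or.1 (hE_subset hω)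
  exact ⟨not_lt.1 norm_not_lt, notMem⟩

theorem exists_measurableSet_error_le_of_le_one (h : IsModel μ σ Δ J ε τ) (hd : 2 ≤ d)
    (hn : 0 < n) (hσ : 0 ≤ σ) (hΔ : 0 ≤ Δ) (hσΔ : 0 < σ + Δ) {α lam : ℝ} {r : ℕ} (hr : 0 < r)
    {Θ : Matrix (Fin d) (Fin d) ℝ} (hΘ_rank : Θ.rank ≤ r) (hΘ : maxNorm Θ ≤ α) {Y δ : ℝ}
    (hY0 : 0 < Y) (hY1 : Y ≤ 1) (hδ : (δ + 2) * Real.log d ≤ n * Y ^ 2 / d)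
    (hlam : 72 * (σ + Δ) * Y ≤ lam * d) :
    ∃ E : Set Ω, MeasurableSet E ∧ 1 - 2 * (d : ℝ) ^ (-δ) ≤ μ.real E ∧
      ∀ ω ∈ E, ∀ Θhat : Matrix (Fin d) (Fin d) ℝ,
        IsEstimator α lam (fun k => J k ω)
          (fun k => quantizedObs Δ Θ (J k ω) (ε k ω) (τ k ω)) Θhat →
        frobNorm (Θhat - Θ) / d ≤ √r * (192 * ((α + σ + Δ) * Y) + 9 * (lam * d)) ∧
        nuclearNorm (Θhat - Θ) / d ≤ r * (1024 * ((α + σ + Δ) * Y) + 48 * (lam * d)) := by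
  have : NeZero d := ⟨by lia⟩
  have d_pos : (0 : ℝ) < d := by exact_mod_cast NeZero.pos d
  have α_nonneg : 0 ≤ α := (maxNorm_nonneg Θ).trans hΘ
  set L := α + σ + Δ
  have L_pos : 0 < L := by linarith
  have lam_pos : 0 < lam := pos_of_mul_pos_left (lt_of_lt_of_le (by positivity) hlam) d_pos.le
  set s := 32 * L * (4 * √(2 * r)) * Y with hs
  have scale_le : max s (6 * √(2 * r) * (lam * d)) ≤ √(2 * r) * (128 * (L * Y) + 6 * (lam * d)) :=
    have : 0 ≤ √(2 * r) * (L * Y) := by positivity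
    have : 0 ≤ √(2 * r) * (lam * d) := by positivity
    max_le (by linarith) (by linarith)
  obtain ⟨E, hE, hE_prob, good⟩ :=
    h.exists_measurableSet_norm_noiseMatrix_le_and_notMem_convexityFailures hd hσ hΔ hσΔ Θ L_pos
      (by positivity : 0 < 4 * √(2 * r : ℝ)) hY0 hY1 hδ hs
  refine ⟨E, hE, hE_prob, fun ω hω Θhat est => ?_⟩
  obtain ⟨noise_le, convexity⟩ := good ω hω
  have noise_le_lam : ‖noiseMatrix Δ Θ fun k => (J k ω, ε k ω, τ k ω)‖ ≤ n * lam / 2 :=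
    calc _ ≤ 36 * (σ + Δ) * (n * Y / d) := noise_le
      _ = n / (2 * d) * (72 * (σ + Δ) * Y) := by ring
      _ ≤ n / (2 * d) * (lam * d) := by gcongr
      _ = n * lam / 2 := by field_simp
  obtain ⟨frob_le, nuc_le⟩ := est.error_le_of_notMem_convexityFailures hΘ hn lam_pos noise_le_lam
    hΘ_rank (by linarith) (by positivity) convexity
  have sqrt_two_mul_le : √(2 * r : ℝ) ≤ 3 / 2 * √r := by
    rw [Real.sqrt_mul zero_le_two]
    gcongr
    exact Real.sqrt_le_iff.2 ⟨by norm_num, by norm_num⟩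
  constructor
  · calc _ ≤ √(2 * r) * (128 * (L * Y) + 6 * (lam * d)) := frob_le.trans scale_le
      _ ≤ 3 / 2 * √r * (128 * (L * Y) + 6 * (lam * d)) := by gcongr
      _ = √r * (192 * (L * Y) + 9 * (lam * d)) := by ring
  · calc _ ≤ 4 * √(2 * r) * (√(2 * r) * (128 * (L * Y) + 6 * (lam * d))) :=
          nuc_le.trans (by gcongr)
      _ = 4 * √(2 * r) ^ 2 * (128 * (L * Y) + 6 * (lam * d)) := by ring
      _ = r * (1024 * (L * Y) + 48 * (lam * d)) := by
          rw [Real.sq_sqrt (by positivity)]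
          ring

theorem measure_le_sum_abs_noiseTerm_le_rpow (h : IsModel μ σ Δ J ε τ) (hd : 0 < d) (hσ : 0 ≤ σ)
    (hΔ : 0 ≤ Δ) (hσΔ : 0 < σ + Δ) (Θ : Matrix (Fin d) (Fin d) ℝ) (δ : ℝ) :
    μ {ω | 2 * n + δ * Real.log d ≤
        ∑ k, |noiseTerm Δ Θ (J k ω, ε k ω, τ k ω)| / (2 * (σ + Δ))} ≤
      ENNReal.ofReal ((d : ℝ) ^ (-δ)) := by
  have : NeZero d := ⟨hd.ne'⟩
  refine (h.measure_le_sum_abs_noiseTerm_le (by positivity) (by linarith) hΔ (by linarith) Θ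
    _).trans (ENNReal.ofReal_le_ofReal ?_)
  calc (4 : ℝ) ^ n * Real.exp (-(2 * n + δ * Real.log d))
      ≤ Real.exp (2 * n) * Real.exp (-(2 * n + δ * Real.log d)) := by
        gcongr
        exact four_pow_le_exp n
    _ = Real.exp (Real.log d * -δ) := by
        rw [← Real.exp_add]
        ring_nf
    _ = (d : ℝ) ^ (-δ) := (Real.rpow_def_of_pos (by exact_mod_cast hd) _).symm

theorem exists_measurableSet_error_le (h : IsModel μ σ Δ J ε τ) (hd : 0 < d) (hn : 0 < n)
    (hσ : 0 ≤ σ) (hΔ : 0 ≤ Δ) (hσΔ : 0 < σ + Δ) {α lam : ℝ} (hlam : 0 < lam) {r : ℕ}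
    {Θ : Matrix (Fin d) (Fin d) ℝ} (hΘ_rank : Θ.rank ≤ r) (hΘ : maxNorm Θ ≤ α) (δ : ℝ) :
    ∃ E : Set Ω, MeasurableSet E ∧ 1 - (d : ℝ) ^ (-δ) ≤ μ.real E ∧
      ∀ ω ∈ E, ∀ Θhat : Matrix (Fin d) (Fin d) ℝ,
        IsEstimator α lam (fun k => J k ω)
          (fun k => quantizedObs Δ Θ (J k ω) (ε k ω) (τ k ω)) Θhat →
        frobNorm (Θhat - Θ) / d ≤ 2 * α ∧
        nuclearNorm (Θhat - Θ) / d ≤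
          α * (2 * √r + 4 * (σ + Δ) / (lam * d) * (2 + δ * Real.log d / n)) := by
  have α_nonneg : 0 ≤ α := (maxNorm_nonneg Θ).trans hΘ
  obtain ⟨E, hE, hE_prob, hE_subset⟩ := exists_measurableSet_subset_compl (by positivity)
    (h.measure_le_sum_abs_noiseTerm_le_rpow hd hσ hΔ hσΔ Θ δ)
  refine ⟨E, hE, hE_prob, fun ω hω Θhat est => ⟨est.frobNorm_sub_le hΘ, ?_⟩⟩
  have noise_le : ∑ k, |noiseTerm Δ Θ (J k ω, ε k ω, τ k ω)| ≤
      (2 * n + δ * Real.log d) * (2 * (σ + Δ)) := by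
    have sum_lt : ∑ k, |noiseTerm Δ Θ (J k ω, ε k ω, τ k ω)| / (2 * (σ + Δ)) <
        2 * n + δ * Real.log d := not_le.1 (hE_subset hω)
    rw [← Finset.sum_div, div_lt_iff₀ (by positivity)] at sum_lt
    exact sum_lt.le
  calc nuclearNorm (Θhat - Θ) / d
      ≤ (2 * (√r * (d * α)) + 2 * α * (∑ k, |noiseTerm Δ Θ (J k ω, ε k ω, τ k ω)|) /
          (n * lam)) / d := by
        gcongr
        exact est.nuclearNorm_sub_le hΘ hn hlam hΘ_rank
    _ ≤ (2 * (√r * (d * α)) + 2 * α * ((2 * n + δ * Real.log d) * (2 * (σ + Δ))) /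
          (n * lam)) / d := by gcongr
    _ = α * (2 * √r + 4 * (σ + Δ) / (lam * d) * (2 + δ * Real.log d / n)) := by
        field_simp
        ring

end IsModel

end Model

end QMC

/-! ### The two sample size regimes -/

namespace QMC

theorem sqrt_mul_regularization {x : ℝ} {d n : ℕ} (hd : 0 < d) :
    √(x / (n * d)) * d = √(x * d / n) := by
  have d_pos : (0 : ℝ) < d := by exact_mod_cast hd
  rw [← Real.sqrt_sq d_pos.le, ← Real.sqrt_mul' _ (sq_nonneg _), Real.sqrt_sq d_pos.le]
  congr 1
  field_simp

theorem nuclear_rate_of_one_le {t X β C x r : ℝ} (ht : 0 < t) (hX : 0 < X) (hβ : 1 ≤ β)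
    (hC : 1 ≤ C) (hβX : 1 ≤ β * X) (hx : x ≤ X ^ 2) (hr : 1 ≤ r) :
    2 * √r + 4 * t / (C * t * X) * (2 + x) ≤ 14 * β ^ 2 * r * X := by
  have sqrt_le : √r ≤ β ^ 2 * r * X :=
    calc √r ≤ r := Real.sqrt_le_self_iff.2 (.inr hr)
      _ ≤ β * X * r := le_mul_of_one_le_left (by linarith) hβX
      _ ≤ β ^ 2 * X * r := by gcongr; exact le_self_pow₀ hβ two_ne_zero
      _ = β ^ 2 * r * X := by ring
  have regularization_le : 4 * t / (C * t * X) * (2 + x) ≤ 12 * β ^ 2 * X :=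
    calc 4 * t / (C * t * X) * (2 + x) = 4 * (2 + x) / (C * X) := by field_simp
      _ ≤ 4 * (2 * (β * X) ^ 2 + (β * X) ^ 2) / (1 * X) := by
        gcongr
        · linarith [one_le_pow₀ hβX (n := 2)]
        · exact hx.trans (by gcongr; exact le_mul_of_one_le_left hX.le hβ)
      _ = 12 * β ^ 2 * X := by field_simp; ring
  have le_mul_r : 12 * β ^ 2 * X ≤ 12 * β ^ 2 * X * r := le_mul_of_one_le_right (by positivity) hr
  linarith

theorem add_two_le_sq_mul {δ₀ δ : ℝ} (hδ₀ : 0 < δ₀) (hδ : δ₀ ≤ δ) :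
    δ + 2 ≤ (1 + 1 / δ₀) ^ 2 * δ := by
  have one_le : 1 ≤ 1 / δ₀ * δ := by rwa [one_div_mul_eq_div, one_le_div hδ₀]
  have δ_pos : 0 < δ := hδ₀.trans_le hδ
  have : 0 ≤ (1 / δ₀) ^ 2 * δ := by positivity
  linarith

section Model

variable {Ω : Type*} [MeasurableSpace Ω] {μ : Measure Ω} [IsProbabilityMeasure μ] {d n r : ℕ}
  {σ Δ α lam δ β C X : ℝ} {J : Fin n → Ω → Fin d × Fin d} {ε τ : Fin n → Ω → ℝ}
  {Θ : Matrix (Fin d) (Fin d) ℝ}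

namespace IsModel

theorem exists_measurableSet_rate_of_le_one (h : IsModel μ σ Δ J ε τ) (hd : 2 ≤ d) (hn : 0 < n)
    (hσ : 0 ≤ σ) (hΔ : 0 ≤ Δ) (hσΔ : 0 < σ + Δ) (hr : 0 < r) (hΘ_rank : Θ.rank ≤ r)
    (hΘ : maxNorm Θ ≤ α) (hβ : 0 < β) (hC : 72 * β ≤ C) (hδ : δ + 2 ≤ β ^ 2 * δ) (hX : 0 < X)
    (hX_sq : n * X ^ 2 = δ * Real.log d * d) (hβX : β * X ≤ 1)
    (hlam : lam * d = C * (σ + Δ) * X) :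
    ∃ E : Set Ω, MeasurableSet E ∧ 1 - 2 * (d : ℝ) ^ (-δ) ≤ μ.real E ∧
      ∀ ω ∈ E, ∀ Θhat : Matrix (Fin d) (Fin d) ℝ,
        IsEstimator α lam (fun k => J k ω)
          (fun k => quantizedObs Δ Θ (J k ω) (ε k ω) (τ k ω)) Θhat →
        frobNorm (Θhat - Θ) / d ≤ (192 * β + 9 * C) * (α + σ + Δ) * (√r * X) ∧
        nuclearNorm (Θhat - Θ) / d ≤ (1024 * β + 48 * C) * (α + σ + Δ) * r * X := by
  have : NeZero d := ⟨by lia⟩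
  have : 0 ≤ Real.log d := Real.log_natCast_nonneg d
  have α_nonneg : 0 ≤ α := (maxNorm_nonneg Θ).trans hΘ
  have C_pos : 0 < C := by linarith
  have deviation_le : (δ + 2) * Real.log d ≤ n * (β * X) ^ 2 / d :=
    calc (δ + 2) * Real.log d ≤ β ^ 2 * δ * Real.log d := by gcongr
      _ = β ^ 2 * (n * X ^ 2) / d := by
        rw [hX_sq]
        field_simp
      _ = n * (β * X) ^ 2 / d := by ring
  have noise_le : 72 * (σ + Δ) * (β * X) ≤ lam * d :=
    calc 72 * (σ + Δ) * (β * X) = 72 * β * (σ + Δ) * X := by ring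
      _ ≤ C * (σ + Δ) * X := by gcongr
      _ = lam * d := hlam.symm
  have lam_le : lam * d ≤ C * (α + σ + Δ) * X := by
    rw [hlam]
    gcongr
    linarith
  obtain ⟨E, hE, hE_prob, error_le⟩ := h.exists_measurableSet_error_le_of_le_one hd hn hσ hΔ hσΔ
    hr hΘ_rank hΘ (by positivity) hβX deviation_le noise_le
  refine ⟨E, hE, hE_prob, fun ω hω Θhat est => ?_⟩
  obtain ⟨frob_le, nuc_le⟩ := error_le ω hω Θhat est
  constructor
  · calc _ ≤ √r * (192 * ((α + σ + Δ) * (β * X)) + 9 * (C * (α + σ + Δ) * X)) :=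
          frob_le.trans (by gcongr)
      _ = (192 * β + 9 * C) * (α + σ + Δ) * (√r * X) := by ring
  · calc _ ≤ r * (1024 * ((α + σ + Δ) * (β * X)) + 48 * (C * (α + σ + Δ) * X)) :=
          nuc_le.trans (by gcongr)
      _ = (1024 * β + 48 * C) * (α + σ + Δ) * r * X := by ring

theorem exists_measurableSet_rate_of_one_le (h : IsModel μ σ Δ J ε τ) (hd : 0 < d) (hn : 0 < n)
    (hσ : 0 ≤ σ) (hΔ : 0 ≤ Δ) (hσΔ : 0 < σ + Δ) (hr : 0 < r) (hΘ_rank : Θ.rank ≤ r)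
    (hΘ : maxNorm Θ ≤ α) (hβ : 1 ≤ β) (hC : 1 ≤ C) (hX : 0 < X)
    (hX_sq : n * X ^ 2 = δ * Real.log d * d) (hβX : 1 ≤ β * X)
    (hlam : lam * d = C * (σ + Δ) * X) :
    ∃ E : Set Ω, MeasurableSet E ∧ 1 - (d : ℝ) ^ (-δ) ≤ μ.real E ∧
      ∀ ω ∈ E, ∀ Θhat : Matrix (Fin d) (Fin d) ℝ,
        IsEstimator α lam (fun k => J k ω)
          (fun k => quantizedObs Δ Θ (J k ω) (ε k ω) (τ k ω)) Θhat →
        frobNorm (Θhat - Θ) / d ≤ 2 * β * (α + σ + Δ) * (√r * X) ∧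
        nuclearNorm (Θhat - Θ) / d ≤ 14 * β ^ 2 * (α + σ + Δ) * r * X := by
  have : NeZero d := ⟨hd.ne'⟩
  have one_le_d : (1 : ℝ) ≤ d := by exact_mod_cast hd
  have one_le_r : (1 : ℝ) ≤ r := by exact_mod_cast hr
  have α_nonneg : 0 ≤ α := (maxNorm_nonneg Θ).trans hΘ
  have α_le : α ≤ α + σ + Δ := by linarith
  have lam_pos : 0 < lam :=
    pos_of_mul_pos_left (hlam ▸ by positivity : 0 < lam * d) (by positivity)
  have deviation_le : δ * Real.log d / n ≤ X ^ 2 :=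
    calc δ * Real.log d / n = X ^ 2 / d := by
          field_simp
          linarith
      _ ≤ X ^ 2 := div_le_self (sq_nonneg X) one_le_d
  obtain ⟨E, hE, hE_prob, error_le⟩ :=
    h.exists_measurableSet_error_le hd hn hσ hΔ hσΔ lam_pos hΘ_rank hΘ δ
  refine ⟨E, hE, hE_prob, fun ω hω Θhat est => ?_⟩
  obtain ⟨frob_le, nuc_le⟩ := error_le ω hω Θhat est
  constructor
  · calc _ ≤ 2 * α * (√r * (β * X)) := frob_le.trans <| le_mul_of_one_le_right (by positivity) <|
          one_le_mul_of_one_le_of_one_le (Real.one_le_sqrt.2 one_le_r) hβX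
      _ ≤ 2 * (α + σ + Δ) * (√r * (β * X)) := by gcongr
      _ = 2 * β * (α + σ + Δ) * (√r * X) := by ring
  · rw [hlam] at nuc_le
    calc _ ≤ α * (14 * β ^ 2 * r * X) := nuc_le.trans <| by
          gcongr
          exact nuclear_rate_of_one_le hσΔ hX hβ hC hβX deviation_le one_le_r
      _ ≤ (α + σ + Δ) * (14 * β ^ 2 * r * X) := by gcongr
      _ = 14 * β ^ 2 * (α + σ + Δ) * r * X := by ring

theorem exists_measurableSet_rate (h : IsModel μ σ Δ J ε τ) (hd : 2 ≤ d) (hn : 0 < n)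
    (hσ : 0 ≤ σ) (hΔ : 0 ≤ Δ) (hσΔ : 0 < σ + Δ) (hr : 0 < r) (hΘ_rank : Θ.rank ≤ r)
    (hΘ : maxNorm Θ ≤ α) (hβ : 1 ≤ β) (hC : 72 * β ≤ C) (hδ : δ + 2 ≤ β ^ 2 * δ) (hX : 0 < X)
    (hX_sq : n * X ^ 2 = δ * Real.log d * d) (hlam : lam * d = C * (σ + Δ) * X) :
    ∃ E : Set Ω, MeasurableSet E ∧ 1 - 2 * (d : ℝ) ^ (-δ) ≤ μ.real E ∧
      ∀ ω ∈ E, ∀ Θhat : Matrix (Fin d) (Fin d) ℝ,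
        IsEstimator α lam (fun k => J k ω)
          (fun k => quantizedObs Δ Θ (J k ω) (ε k ω) (τ k ω)) Θhat →
        frobNorm (Θhat - Θ) / d ≤ (194 * β + 9 * C) * (α + σ + Δ) * (√r * X) ∧
        nuclearNorm (Θhat - Θ) / d ≤
          (1024 * β + 48 * C + 14 * β ^ 2) * (α + σ + Δ) * r * X := by
  have : NeZero d := ⟨by lia⟩
  have α_nonneg : 0 ≤ α := (maxNorm_nonneg Θ).trans hΘ
  have frob_scale_nonneg : 0 ≤ (α + σ + Δ) * (√r * X) := by positivity
  have nuc_scale_nonneg : 0 ≤ (α + σ + Δ) * r * X := by positivity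
  rcases le_total (β * X) 1 with hβX | hβX
  · obtain ⟨E, hE, hE_prob, rate⟩ := h.exists_measurableSet_rate_of_le_one hd hn hσ hΔ hσΔ hr
      hΘ_rank hΘ (by linarith) hC hδ hX hX_sq hβX hlam
    refine ⟨E, hE, hE_prob, fun ω hω Θhat est => (rate ω hω Θhat est).imp
      (fun frob_le => frob_le.trans (by nlinarith)) (fun nuc_le => nuc_le.trans (by nlinarith))⟩
  · obtain ⟨E, hE, hE_prob, rate⟩ := h.exists_measurableSet_rate_of_one_le (by lia) hn hσ hΔ hσΔ
      hr hΘ_rank hΘ hβ (by linarith) hX hX_sq hβX hlam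
    have rpow_nonneg : 0 ≤ (d : ℝ) ^ (-δ) := by positivity
    refine ⟨E, hE, by linarith, fun ω hω Θhat est => (rate ω hω Θhat est).imp
      (fun frob_le => frob_le.trans (by nlinarith)) (fun nuc_le => nuc_le.trans (by nlinarith))⟩

end IsModel

end Model

end QMC

theorem theorem3p6_general :
    ∀ δ₀ : ℝ, 0 < δ₀ → ∃ C₀ : ℝ, 0 < C₀ ∧ ∀ C₁ : ℝ, C₀ ≤ C₁ →
    ∃ C₂ C₃ : ℝ, 0 < C₂ ∧ 0 < C₃ ∧
    ∀ (d n r : ℕ) (δ α σ Δ : ℝ), 2 ≤ d → 0 < n → 0 < r → δ₀ ≤ δ → 0 ≤ σ → 0 ≤ Δ →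
    0 < σ + Δ →
    ∀ Θstar : Matrix (Fin d) (Fin d) ℝ, Θstar.rank ≤ r → QMC.maxNorm Θstar ≤ α →
    ∀ {Ω : Type*} [MeasurableSpace Ω] (μ : Measure Ω) [IsProbabilityMeasure μ]
      (J : Fin n → Ω → Fin d × Fin d) (ε τ : Fin n → Ω → ℝ),
    QMC.IsModel μ σ Δ J ε τ →
    ∃ E : Set Ω, MeasurableSet E ∧ 1 - 2 * (d : ℝ) ^ (-δ) ≤ μ.real E ∧
      ∀ ω ∈ E, ∀ Θhat : Matrix (Fin d) (Fin d) ℝ,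
        QMC.IsEstimator α (C₁ * (σ + Δ) * √(δ * Real.log d / (n * d)))
          (fun k => J k ω)
          (fun k => QMC.quantizedObs Δ Θstar (J k ω) (ε k ω) (τ k ω)) Θhat →
        QMC.frobNorm (Θhat - Θstar) / d
            ≤ C₂ * (α + σ + Δ) * √(δ * r * d * Real.log d / n) ∧
        QMC.nuclearNorm (Θhat - Θstar) / d
            ≤ C₃ * (α + σ + Δ) * r * √(δ * d * Real.log d / n) := by
  intro δ₀ hδ₀
  have one_le_β : 1 ≤ 1 + 1 / δ₀ := le_add_of_nonneg_right (by positivity)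
  refine ⟨72 * (1 + 1 / δ₀), by positivity, fun C₁ hC₁ => ?_⟩
  have C₁_pos : 0 < C₁ := by linarith
  refine ⟨194 * (1 + 1 / δ₀) + 9 * C₁, 1024 * (1 + 1 / δ₀) + 48 * C₁ + 14 * (1 + 1 / δ₀) ^ 2,
    by positivity, by positivity, ?_⟩
  intro d n r δ α σ Δ hd hn hr hδ hσ hΔ hσΔ Θstar hΘ_rank hΘ Ω _ μ _ J ε τ h
  have log_pos : 0 < Real.log d := Real.log_pos (by exact_mod_cast hd)
  have δ_pos : 0 < δ := hδ₀.trans_le hδ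
  set X := √(δ * Real.log d * d / n)
  have X_sq : n * X ^ 2 = δ * Real.log d * d := by
    rw [Real.sq_sqrt (by positivity)]
    field_simp
  have frob_scale : √(δ * r * d * Real.log d / n) = √r * X := by
    rw [← Real.sqrt_mul (by positivity)]
    congr 1
    ring
  have nuc_scale : √(δ * d * Real.log d / n) = X := by rw [mul_right_comm]
  rw [frob_scale, nuc_scale]
  exact h.exists_measurableSet_rate hd hn hσ hΔ hσΔ hr hΘ_rank hΘ one_le_β hC₁
    (QMC.add_two_le_sq_mul hδ₀ hδ) (by positivity) X_sq
    (by rw [mul_assoc, QMC.sqrt_mul_regularization (by lia)])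

theorem theorem3p6 :
    ∀ δ₀ : ℝ, 0 < δ₀ → ∃ C₀ : ℝ, 0 < C₀ ∧ ∀ C₁ : ℝ, C₀ ≤ C₁ →
    ∀ c K : ℝ, 0 < c → 0 < K → ∃ C₂ C₃ : ℝ, 0 < C₂ ∧ 0 < C₃ ∧
    ∀ (d n r : ℕ) (δ α σ Δ : ℝ), 1 ≤ d → δ₀ ≤ δ → 0 ≤ σ → 0 ≤ Δ → 0 < σ + Δ →
    c * ((d : ℝ) * Real.log d ^ 3) ≤ (n : ℝ) →
    (n : ℝ) ≤ K * ((r : ℝ) ^ 2 * (d : ℝ) ^ 2 * Real.log d) →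
    ∀ Θstar : Matrix (Fin d) (Fin d) ℝ, Θstar.rank ≤ r → QMC.maxNorm Θstar ≤ α →
    ∀ {Ω : Type*} [MeasurableSpace Ω] (μ : Measure Ω) [IsProbabilityMeasure μ]
      (J : Fin n → Ω → Fin d × Fin d) (ε τ : Fin n → Ω → ℝ),
    QMC.IsModel μ σ Δ J ε τ →
    ∃ E : Set Ω, MeasurableSet E ∧ 1 - 4 * (d : ℝ) ^ (-δ) ≤ μ.real E ∧
      ∀ ω ∈ E, ∀ Θhat : Matrix (Fin d) (Fin d) ℝ,
        QMC.IsEstimator α (C₁ * (σ + Δ) * √(δ * Real.log d / (n * d)))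
          (fun k => J k ω)
          (fun k => QMC.quantizedObs Δ Θstar (J k ω) (ε k ω) (τ k ω)) Θhat →
        QMC.frobNorm (Θhat - Θstar) / d
            ≤ C₂ * (α + σ + Δ) * √(δ * r * d * Real.log d / n) ∧
        QMC.nuclearNorm (Θhat - Θstar) / d
            ≤ C₃ * (α + σ + Δ) * r * √(δ * d * Real.log d / n) := by
  intro δ₀ hδ₀
  obtain ⟨C₀, hC₀, general⟩ := theorem3p6_general δ₀ hδ₀
  refine ⟨C₀, hC₀, fun C₁ hC₁ c K hc _ => ?_⟩
  obtain ⟨C₂, C₃, hC₂, hC₃, error_le⟩ := general C₁ hC₁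
  refine ⟨C₂, C₃, hC₂, hC₃, ?_⟩
  intro d n r δ α σ Δ hd hδ hσ hΔ hσΔ n_ge n_le Θstar hΘ_rank hΘ Ω _ μ _ J ε τ h
  obtain rfl | two_le_d := hd.eq_or_lt'
  · exact ⟨∅, .empty, by norm_num, by simp⟩
  have log_pos : 0 < Real.log d := Real.log_pos (by exact_mod_cast two_le_d)
  have n_pos : (0 : ℝ) < n := lt_of_lt_of_le (by positivity) n_ge
  have r_pos : 0 < r :=
    Nat.pos_of_ne_zero fun r_eq_zero => (n_pos.trans_le n_le).ne' (by simp [r_eq_zero])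
  obtain ⟨E, hE, hE_prob, est_error_le⟩ := error_le d n r δ α σ Δ two_le_d
    (by exact_mod_cast n_pos) r_pos hδ hσ hΔ hσΔ Θstar hΘ_rank hΘ μ J ε τ h
  have rpow_nonneg : 0 ≤ (d : ℝ) ^ (-δ) := by positivity
  exact ⟨E, hE, by linarith, est_error_le⟩
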